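/- **Setting.** Let $S=\mathbb Z[q,q^{-1}]$ and $n\ge 1$. Permutations act on the right, so in a product $vw$ the factor $v$ is applied first; $s_i=(i,i+1)\in\mathfrak S_n$ and $\ell$ is the Coxeter length. *The algebra.* The algebra of braids and ties $\mathcal E_n(q)$ is the associative unital $S$-algebra with generators $g_1,\dots,g_{n-1},e_1,\dots,e_{n-1}$ and relations $g_ig_j=g_jg_i$ and $g_ie_j=e_jg_i$ for $|i-j|>1$; $g_ie_i=e_ig_i$, $e_i^2=e_i$, $g_i^2=1+(q-q^{-1})e_ig_i$ for all $i$; $e_ie_j=e_je_i$ for all $i,j$; and $g_ig_jg_i=g_jg_ig_j$, $e_ig_jg_i=g_jg_ie_j$, $e_ie_jg_j=e_ig_je_i=g_je_ie_j$ for $|i-j|=1$. Let $*$ be the anti-automorphism fixing all $g_i$ and $e_i$; let $g_w=g_{i_1}\cdots g_{i_k}$ for a reduced expression $w=s_{i_1}\cdots s_{i_k}$. Put $E_{i,i+1}=e_i$, $E_{ij}=g_iE_{i+1,j}g_i^{-1}$ for $i+1<j$; for a set partition $A$ of $\{1,\dots,n\}$ let $E_A$ be the product of the (commuting) $E_{ij}$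 over the pairs $i<j$ in a common block of $A$, and $\mathbb E_A=\sum_{B\supseteq A}\mu(A,B)E_B$, where $A\subseteq B$ means that every block of $B$ is a union of blocks of $A$ and $\mu$ is the Möbius function of this order. For a partition $\alpha$ of $n$ let $\mathbb E_\alpha=\sum_A\mathbb E_A$ over the set partitions $A$ whose block sizes are the parts of $\alpha$ ("of type $\alpha$"), a central idempotent, and $\mathcal E_n^\alpha(q)=\mathbb E_\alpha\mathcal E_n(q)$. *Tensor space.* For $N,r\ge1$ let $V$ be the free $S$-module with basis $v_i^s$ ($1\le i\le N$, $1\le s\le r$). Then $V^{\otimes n}$ is a right $\mathcal E_n(q)$-module on which $e_k$, $g_k$ act in the factors $k,k+1$ by $$(v_i^s\otimes v_j^t)\mathbf E=\delta_{st}\,v_i^s\otimes v_j^t,\qquad (v_i^s\otimes v_j^t)\mathbf G=\begin{cases}v_j^t\otimes v_i^s& s\ne t,\\ q\,v_i^s\otimes v_j^t& s=t,\ i=j,\\ v_j^t\otimes v_i^s& s=t,\ i<j,\\ (q-q^{-1})v_i^s\otimes v_j^t+v_j^t\otimes v_i^s& s=t,\ i>j.\end{cases}$$ *Index set.* Fix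 a total order $\le$ on the set of all integer partitions that extends the dominance order on the partitions of each integer. Let $\alpha$ be a partition of $n$ with $r$ parts. $\mathcal L_n(\alpha)$ is the set of pairs $\Lambda=(\boldsymbol\lambda\mid\boldsymbol\mu)$ where $\boldsymbol\lambda=(\lambda^{(1)}\le\dots\le\lambda^{(r)})$ is a weakly increasing $r$-tuple of partitions of total size $n$ such that $|\lambda^{(1)}|,\dots,|\lambda^{(r)}|$ are, up to order, the parts of $\alpha$, and where, if $\lambda^{(i_1)}<\dots<\lambda^{(i_s)}$ are the distinct components of $\boldsymbol\lambda$ with multiplicities $m_1,\dots,m_s$, $\boldsymbol\mu=(\mu^{(1)},\dots,\mu^{(s)})$ is a tuple of partitions with $\mu^{(j)}\vdash m_j$. A $\boldsymbol\lambda$-multitableau is a bijection from $\{1,\dots,n\}$ to the nodes of the Young diagrams of $\boldsymbol\lambda$; it is standard if the entries of each component increase along rows and down columns. $\mathfrak t^{\boldsymbol\lambda}$ is the one with $1,\dots,n$ entered in order along the rows of the first component, then of the second one, and so on; $d(\mathfrak t)\in\mathfrak S_n$ is given by $\mathfrak t=\mathfrak t^{\boldsymbol\lambda}d(\mathfrak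 t)$, and $\mathfrak S_{\boldsymbol\lambda}$ is the row stabilizer of $\mathfrak t^{\boldsymbol\lambda}$. The same is used for $\boldsymbol\mu$, with $\{1,\dots,r\}$ in place of $\{1,\dots,n\}$. $\mathrm{Std}(\Lambda)$ is the set of pairs $(\mathfrak t\mid\mathfrak u)$ where $\mathfrak t$ is a standard $\boldsymbol\lambda$-multitableau such that, whenever $\lambda^{(i)}=\lambda^{(j)}$, one has $i<j$ if and only if the least entry of the $i$-th component of $\mathfrak t$ is smaller than that of the $j$-th one, and $\mathfrak u$ is a standard $\boldsymbol\mu$-multitableau in which every entry lies in the same component as in $\mathfrak t^{\boldsymbol\mu}$. *Dual cellular basis elements.* Let $A_{\boldsymbol\lambda}=\{I_1,\dots,I_r\}$ be the set partition given by the components of $\mathfrak t^{\boldsymbol\lambda}$, $\mathbb E_{\boldsymbol\lambda}=\mathbb E_{A_{\boldsymbol\lambda}}$ and $y_{\boldsymbol\lambda}=\sum_{w\in\mathfrak S_{\boldsymbol\lambda}}(-q)^{-\ell(w)}g_w$. For $w\in\mathfrak S_r$ permuting only equal components of $\boldsymbol\lambda$ let $B_w\in\mathfrak S_n$ map each $I_i$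 onto $I_{w(i)}$ preserving the order, and $\mathbb B_w=\mathbb E_{\boldsymbol\lambda}g_{B_w}$; put $c_{\boldsymbol\mu}=\sum_{w\in\mathfrak S_{\boldsymbol\mu}}(-1)^{\ell(w)}\mathbb B_w$. For $\mathfrak s=(\mathfrak a\mid\mathfrak u)$ and $\mathfrak t=(\mathfrak b\mid\mathfrak v)$ in $\mathrm{Std}(\Lambda)$ let $$n_{\mathfrak s\mathfrak t}=g_{d(\mathfrak a)}^{*}\,\mathbb E_{\boldsymbol\lambda}\,y_{\boldsymbol\lambda}\,\mathbb B_{d(\mathfrak u)}^{*}\,c_{\boldsymbol\mu}\,\mathbb B_{d(\mathfrak v)}\,g_{d(\mathfrak b)} .$$ **Theorem.** Let $N\ge 1$, let $\alpha$ be a partition of $n$ of length $r$, and let $V$ be as above, of rank $rN$. Let $\mathcal I\subseteq\mathcal E_n^\alpha(q)$ be the annihilator ideal of the action of $\mathcal E_n^\alpha(q)$ on $\mathbb E_\alpha V^{\otimes n}$. Then $\mathcal I$ is free over $S$, with basis the family of the elements $n_{\mathfrak s\mathfrak t}$, where $\Lambda=(\boldsymbol\lambda\mid\boldsymbol\mu)$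 runs over the elements of $\mathcal L_n(\alpha)$ such that some component $\lambda^{(k)}$ has more than $N$ columns, and $\mathfrak s,\mathfrak t$ run over $\mathrm{Std}(\Lambda)$. The same statement, with the algebra, the tensor space and the elements $n_{\mathfrak s\mathfrak t}$ formed over $\mathcal K$, holds over every field $\mathcal K$ and every nonzero $q\in\mathcal K$. -/

import Mathlib

open scoped TensorProduct

noncomputable section

namespace BraidsTies

/-! ### The symmetric group as a Coxeter group, acting on the right -/

/-- The left position `i` of the two neighbouring positions `i`, `i + 1`. -/
def lo {n : ℕ} (i : Fin (n - 1)) : Fin n := ⟨i, by omega⟩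

/-- The right position `i + 1` of the two neighbouring positions `i`, `i + 1`. -/
def hi {n : ℕ} (i : Fin (n - 1)) : Fin n := ⟨i + 1, by omega⟩

/-- The simple transposition `s_i = (i, i + 1)`. -/
def simple {n : ℕ} (i : Fin (n - 1)) : Equiv.Perm (Fin n) := Equiv.swap (lo i) (hi i)

/-- The product `s_{i₁} s_{i₂} ⋯ s_{iₖ}`. Permutations act on the right, so the leftmost factor
is applied first: the product of `v` and `w` is `v.trans w`. -/
def wordPerm {n : ℕ} : List (Fin (n - 1)) → Equiv.Perm (Fin n)
  | [] => Equiv.refl _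
  | i :: l => (simple i).trans (wordPerm l)

theorem wordPerm_append {n : ℕ} (l l' : List (Fin (n - 1))) :
    wordPerm (l ++ l') = (wordPerm l).trans (wordPerm l') := by
  induction l with
  | nil => rfl
  | cons i l ih => simp [wordPerm, ih, Equiv.trans_assoc]

theorem exists_wordPerm {n : ℕ} (w : Equiv.Perm (Fin n)) : ∃ l, wordPerm l = w := by
  cases n with
  | zero => exact ⟨[], Subsingleton.elim _ _⟩
  | succ m =>
    have hw : w ∈ Submonoid.closure
        (Set.range fun i : Fin m => Equiv.swap i.castSucc i.succ) := by
      rw [Equiv.Perm.mclosure_swap_castSucc_succ]; trivial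
    induction hw using Submonoid.closure_induction with
    | mem x hx =>
      obtain ⟨i, rfl⟩ := hx
      exact ⟨[i], rfl⟩
    | one => exact ⟨[], rfl⟩
    | mul x y _ _ hx hy =>
      obtain ⟨a, rfl⟩ := hx
      obtain ⟨b, rfl⟩ := hy
      exact ⟨b ++ a, by rw [wordPerm_append]; rfl⟩

theorem exists_reducedWord {n : ℕ} (w : Equiv.Perm (Fin n)) :
    ∃ l, wordPerm l = w ∧ ∀ l', wordPerm l' = w → l.length ≤ l'.length := by
  classical
  have h : ∃ k, ∃ l : List (Fin (n - 1)), wordPerm l = w ∧ l.length = k := by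
    obtain ⟨l, hl⟩ := exists_wordPerm w
    exact ⟨_, l, hl, rfl⟩
  obtain ⟨l, hl, hk⟩ := Nat.find_spec h
  exact ⟨l, hl, fun l' hl' => hk ▸ Nat.find_min' h ⟨l', hl', rfl⟩⟩

/-- A reduced expression of `w`. -/
def reducedWord {n : ℕ} (w : Equiv.Perm (Fin n)) : List (Fin (n - 1)) :=
  (exists_reducedWord w).choose

/-- The Coxeter length of `w`. -/
def len {n : ℕ} (w : Equiv.Perm (Fin n)) : ℕ := (reducedWord w).length

/-! ### The algebra of braids and ties -/

/-- `|i - j| > 1`. -/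
def Far {m : ℕ} (i j : Fin m) : Prop := (i : ℕ) + 1 < j ∨ (j : ℕ) + 1 < i

/-- `|i - j| = 1`. -/
def Near {m : ℕ} (i j : Fin m) : Prop := (i : ℕ) + 1 = j ∨ (j : ℕ) + 1 = i

/-- The generators `g_1, …, g_{n-1}`, `e_1, …, e_{n-1}`. -/
inductive Gen (n : ℕ) : Type
  | g (i : Fin (n - 1)) : Gen n
  | e (i : Fin (n - 1)) : Gen n

section Algebra

variable {R : Type*} [CommRing R]

/-- The free generator `g_i`. -/
abbrev fg (R : Type*) [CommRing R] {n : ℕ} (i : Fin (n - 1)) : FreeAlgebra R (Gen n) :=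
  FreeAlgebra.ι R (Gen.g i)

/-- The free generator `e_i`. -/
abbrev fe (R : Type*) [CommRing R] {n : ℕ} (i : Fin (n - 1)) : FreeAlgebra R (Gen n) :=
  FreeAlgebra.ι R (Gen.e i)

/-- The defining relations of the algebra of braids and ties, for an invertible parameter `q`. -/
inductive Rel (q : Rˣ) (n : ℕ) : FreeAlgebra R (Gen n) → FreeAlgebra R (Gen n) → Prop
  | gg_far (i j : Fin (n - 1)) : Far i j → Rel q n (fg R i * fg R j) (fg R j * fg R i)
  | ge_same (i : Fin (n - 1)) : Rel q n (fg R i * fe R i) (fe R i * fg R i)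
  | braid (i j : Fin (n - 1)) : Near i j →
      Rel q n (fg R i * fg R j * fg R i) (fg R j * fg R i * fg R j)
  | egg (i j : Fin (n - 1)) : Near i j →
      Rel q n (fe R i * fg R j * fg R i) (fg R j * fg R i * fe R j)
  | eeg_ege (i j : Fin (n - 1)) : Near i j →
      Rel q n (fe R i * fe R j * fg R j) (fe R i * fg R j * fe R i)
  | ege_gee (i j : Fin (n - 1)) : Near i j →
      Rel q n (fe R i * fg R j * fe R i) (fg R j * fe R i * fe R j)
  | ee (i j : Fin (n - 1)) : Rel q n (fe R i * fe R j) (fe R j * fe R i)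
  | ge_far (i j : Fin (n - 1)) : Far i j → Rel q n (fg R i * fe R j) (fe R j * fg R i)
  | e_sq (i : Fin (n - 1)) : Rel q n (fe R i ^ 2) (fe R i)
  | g_sq (i : Fin (n - 1)) : Rel q n (fg R i ^ 2)
      (1 + ((q : R) - ((q⁻¹ : Rˣ) : R)) • (fe R i * fg R i))

/-- The algebra of braids and ties over `R` with parameter `q`. For `R = ℤ[q, q⁻¹]` this is
`𝓔_n(q)`; since it is given by generators and relations, for any other `R` it is the
specialisation `𝓔_n(q) ⊗ R`. -/
abbrev BT (q : Rˣ) (n : ℕ) : Type _ := RingQuot (Rel q n)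

variable (q : Rˣ) {n : ℕ}

/-- The generator `g_i`. -/
def g (i : Fin (n - 1)) : BT q n := RingQuot.mkAlgHom R (Rel q n) (fg R i)

/-- The generator `e_i`. -/
def e (i : Fin (n - 1)) : BT q n := RingQuot.mkAlgHom R (Rel q n) (fe R i)

/-- A family of elements of an algebra that satisfies the defining relations. -/
structure Satisfies {A : Type*} [Ring A] [Algebra R A] (G E : Fin (n - 1) → A) : Prop where
  gg_far : ∀ i j, Far i j → G i * G j = G j * G i
  ge_same : ∀ i, G i * E i = E i * G i
  braid : ∀ i j, Near i j → G i * G j * G i = G j * G i * G j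
  egg : ∀ i j, Near i j → E i * G j * G i = G j * G i * E j
  eeg_ege : ∀ i j, Near i j → E i * E j * G j = E i * G j * E i
  ege_gee : ∀ i j, Near i j → E i * G j * E i = G j * E i * E j
  ee : ∀ i j, E i * E j = E j * E i
  ge_far : ∀ i j, Far i j → G i * E j = E j * G i
  e_sq : ∀ i, E i ^ 2 = E i
  g_sq : ∀ i, G i ^ 2 = 1 + ((q : R) - ((q⁻¹ : Rˣ) : R)) • (E i * G i)

/-- The homomorphism out of the algebra of braids and ties given on generators. -/
def lift {A : Type*} [Ring A] [Algebra R A] {G E : Fin (n - 1) → A} (h : Satisfies q G E) :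
    BT q n →ₐ[R] A :=
  RingQuot.liftAlgHom R ⟨FreeAlgebra.lift R fun x : Gen n =>
      match x with
      | .g i => G i
      | .e i => E i, by
    intro x y hxy
    cases hxy with
    | gg_far i j hij => simpa using h.gg_far i j hij
    | ge_same i => simpa using h.ge_same i
    | braid i j hij => simpa using h.braid i j hij
    | egg i j hij => simpa using h.egg i j hij
    | eeg_ege i j hij => simpa using h.eeg_ege i j hij
    | ege_gee i j hij => simpa using h.ege_gee i j hij
    | ee i j => simpa using h.ee i j
    | ge_far i j hij => simpa using h.ge_far i j hij
    | e_sq i => simpa using h.e_sq i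
    | g_sq i => simpa using h.g_sq i⟩

theorem lift_g {A : Type*} [Ring A] [Algebra R A] {G E : Fin (n - 1) → A}
    (h : Satisfies q G E) (i : Fin (n - 1)) : lift q h (g q i) = G i := by
  simp [lift, g]

theorem lift_e {A : Type*} [Ring A] [Algebra R A] {G E : Fin (n - 1) → A}
    (h : Satisfies q G E) (i : Fin (n - 1)) : lift q h (e q i) = E i := by
  simp [lift, e]

theorem satisfies_gens : Satisfies q (g q (n := n)) (e q) where
  gg_far i j h := by simpa [g, e] using RingQuot.mkAlgHom_rel R (Rel.gg_far (q := q) i j h)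
  ge_same i := by simpa [g, e] using RingQuot.mkAlgHom_rel R (Rel.ge_same (q := q) i)
  braid i j h := by simpa [g, e] using RingQuot.mkAlgHom_rel R (Rel.braid (q := q) i j h)
  egg i j h := by simpa [g, e] using RingQuot.mkAlgHom_rel R (Rel.egg (q := q) i j h)
  eeg_ege i j h := by simpa [g, e] using RingQuot.mkAlgHom_rel R (Rel.eeg_ege (q := q) i j h)
  ege_gee i j h := by simpa [g, e] using RingQuot.mkAlgHom_rel R (Rel.ege_gee (q := q) i j h)
  ee i j := by simpa [g, e] using RingQuot.mkAlgHom_rel R (Rel.ee (q := q) i j)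
  ge_far i j h := by simpa [g, e] using RingQuot.mkAlgHom_rel R (Rel.ge_far (q := q) i j h)
  e_sq i := by simpa [g, e] using RingQuot.mkAlgHom_rel R (Rel.e_sq (q := q) i)
  g_sq i := by simpa [g, e] using RingQuot.mkAlgHom_rel R (Rel.g_sq (q := q) i)

theorem Near.symm {m : ℕ} {i j : Fin m} (h : Near i j) : Near j i := Or.symm h

theorem Far.symm {m : ℕ} {i j : Fin m} (h : Far i j) : Far j i := Or.symm h

/-- The relations are invariant under reversing all the products. -/
theorem Satisfies.op {q : Rˣ} {A : Type*} [Ring A] [Algebra R A] {G E : Fin (n - 1) → A}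
    (H : Satisfies q G E) :
    Satisfies q (fun i => MulOpposite.op (G i)) (fun i => MulOpposite.op (E i)) where
  gg_far i j h := by simp only [← MulOpposite.op_mul, H.gg_far j i h.symm]
  ge_same i := by simp only [← MulOpposite.op_mul, H.ge_same i]
  braid i j h := by simp only [← MulOpposite.op_mul, ← mul_assoc, H.braid i j h]
  egg i j h := by simp only [← MulOpposite.op_mul, ← mul_assoc, H.egg j i h.symm]
  eeg_ege i j h := by
    simp only [← MulOpposite.op_mul]
    congr 1
    rw [H.ee j i, ← mul_assoc, ← H.ege_gee i j h, mul_assoc]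
  ege_gee i j h := by
    simp only [← MulOpposite.op_mul]
    congr 1
    rw [← mul_assoc, ← H.eeg_ege i j h, ← mul_assoc, H.ee j i]
  ee i j := by simp only [← MulOpposite.op_mul, H.ee i j]
  ge_far i j h := by simp only [← MulOpposite.op_mul, H.ge_far i j h]
  e_sq i := by rw [← MulOpposite.op_pow, H.e_sq i]
  g_sq i := by
    rw [← MulOpposite.op_pow, H.g_sq i, ← MulOpposite.op_mul, H.ge_same i]
    simp

/-- The anti-involution `a ↦ a^*`, which fixes all the generators `g_i` and `e_i`. -/
def star : BT q n →ₐ[R] (BT q n)ᵐᵒᵖ := lift q (satisfies_gens q).op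

/-- The element `a^*`. -/
def st (a : BT q n) : BT q n := (star q a).unop

/-- `g_w = g_{i₁} ⋯ g_{iₖ}` for a reduced expression `w = s_{i₁} ⋯ s_{iₖ}`; by the braid relations
it does not depend on the reduced expression. -/
def gPerm (w : Equiv.Perm (Fin n)) : BT q n := ((reducedWord w).map (g q)).prod

/-- `g_i⁻¹ = g_i + (q⁻¹ - q) e_i`. -/
def gInv (i : Fin (n - 1)) : BT q n := g q i + (((q⁻¹ : Rˣ) : R) - (q : R)) • e q i

theorem g_mul_gInv (i : Fin (n - 1)) : g q i * gInv q i = 1 ∧ gInv q i * g q i = 1 := by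
  have H := satisfies_gens q (n := n)
  have h1 := H.g_sq i
  have h2 := H.ge_same i
  constructor
  · rw [gInv, mul_add, ← pow_two, h1, mul_smul_comm, h2, add_assoc, ← add_smul]
    simp
  · rw [gInv, add_mul, ← pow_two, h1, smul_mul_assoc, add_assoc, ← add_smul]
    simp

/-! ### The tensor space -/

/-- The free module `V` with basis `v_i^s`, `1 ≤ i ≤ N`, `1 ≤ s ≤ r`. -/
abbrev V (R : Type*) [CommRing R] (N r : ℕ) : Type _ := Fin N × Fin r → R

/-- The tensor space `V^{⊗ n}`. -/
abbrev Tens (R : Type*) [CommRing R] (n N r : ℕ) : Type _ := ⨂[R] _ : Fin n, V R N r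

/-- The basis `v_{i₁}^{s₁} ⊗ ⋯ ⊗ v_{iₙ}^{sₙ}` of the tensor space, indexed by the sequences
of the pairs `(i_j, s_j)`. -/
def tensBasis (R : Type*) [CommRing R] (n N r : ℕ) :
    Module.Basis (Fin n → Fin N × Fin r) R (Tens R n N r) :=
  Basis.piTensorProduct fun _ => Pi.basisFun R (Fin N × Fin r)

/-- The operator `𝐄_i`: the operator `v_i^s ⊗ v_j^t ↦ δ_{s t} v_i^s ⊗ v_j^t`, acting in the factors
`i` and `i + 1`. -/
def opE (R : Type*) [CommRing R] {n : ℕ} (N r : ℕ) (i : Fin (n - 1)) :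
    Tens R n N r →ₗ[R] Tens R n N r :=
  (tensBasis R n N r).constr R fun f =>
    if (f (lo i)).2 = (f (hi i)).2 then tensBasis R n N r f else 0

/-- The operator `𝐆_i`: the operator
* `v_i^s ⊗ v_j^t ↦ v_j^t ⊗ v_i^s` if `s ≠ t`,
* `v_i^s ⊗ v_j^t ↦ q v_i^s ⊗ v_j^t` if `s = t` and `i = j`,
* `v_i^s ⊗ v_j^t ↦ v_j^t ⊗ v_i^s` if `s = t` and `i < j`,
* `v_i^s ⊗ v_j^t ↦ (q - q⁻¹) v_i^s ⊗ v_j^t + v_j^t ⊗ v_i^s` if `s = t` and `i > j`,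

acting in the factors `i` and `i + 1`. -/
def opG (N r : ℕ) (i : Fin (n - 1)) : Tens R n N r →ₗ[R] Tens R n N r :=
  (tensBasis R n N r).constr R fun f =>
    if (f (lo i)).2 ≠ (f (hi i)).2 then tensBasis R n N r (f ∘ simple i)
    else if (f (lo i)).1 = (f (hi i)).1 then (q : R) • tensBasis R n N r f
    else if (f (lo i)).1 < (f (hi i)).1 then tensBasis R n N r (f ∘ simple i)
    else ((q : R) - ((q⁻¹ : Rˣ) : R)) • tensBasis R n N r f + tensBasis R n N r (f ∘ simple i)

theorem opE_basis (N r : ℕ) (i : Fin (n - 1)) (f : Fin n → Fin N × Fin r) :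
    opE R N r i (tensBasis R n N r f) =
      (if (f (lo i)).2 = (f (hi i)).2 then (1 : R) else 0) • tensBasis R n N r f := by
  rw [opE, Module.Basis.constr_basis]
  split_ifs <;> simp

/-- The diagonal coefficient of `𝐆`. -/
def cG {N r : ℕ} (a b : Fin N × Fin r) : R :=
  if a.2 ≠ b.2 then 0 else if a.1 = b.1 then (q : R) else if a.1 < b.1 then 0
    else (q : R) - ((q⁻¹ : Rˣ) : R)

/-- The off-diagonal coefficient of `𝐆`. -/
def dG (R : Type*) [CommRing R] {N r : ℕ} (a b : Fin N × Fin r) : R :=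
  if a.2 ≠ b.2 then 1 else if a.1 = b.1 then 0 else 1

theorem opG_basis (N r : ℕ) (i : Fin (n - 1)) (f : Fin n → Fin N × Fin r) :
    opG q N r i (tensBasis R n N r f) =
      cG q (f (lo i)) (f (hi i)) • tensBasis R n N r f +
        dG R (f (lo i)) (f (hi i)) • tensBasis R n N r (f ∘ simple i) := by
  rw [opG, Module.Basis.constr_basis, cG, dG]
  split_ifs <;> simp

theorem simple_lo (i : Fin (n - 1)) : simple i (lo i) = hi i := by simp [simple]
theorem simple_hi (i : Fin (n - 1)) : simple i (hi i) = lo i := by simp [simple]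
theorem simple_of_ne (i : Fin (n - 1)) (x : Fin n) (h1 : x ≠ lo i) (h2 : x ≠ hi i) :
    simple i x = x := Equiv.swap_apply_of_ne_of_ne h1 h2

theorem comp_simple_simple {α : Type*} (i : Fin (n - 1)) (f : Fin n → α) :
    (f ∘ simple i) ∘ simple i = f := by
  funext x; simp [simple]

theorem op_e_sq (N r : ℕ) (i : Fin (n - 1)) : opE R N r i ^ 2 = opE R N r i := by
  refine (tensBasis R n N r).ext fun f => ?_
  rw [pow_two, Module.End.mul_apply]
  simp only [opE_basis, map_smul, smul_smul]
  split_ifs <;> simp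

theorem op_ee (N r : ℕ) (i j : Fin (n - 1)) :
    opE R N r i * opE R N r j = opE R N r j * opE R N r i := by
  refine (tensBasis R n N r).ext fun f => ?_
  simp only [Module.End.mul_apply, opE_basis, map_smul, smul_smul, mul_comm]

theorem op_ge_same (N r : ℕ) (i : Fin (n - 1)) :
    opG q N r i * opE R N r i = opE R N r i * opG q N r i := by
  refine (tensBasis R n N r).ext fun f => ?_
  simp only [Module.End.mul_apply, opE_basis, opG_basis, map_smul, map_add, Function.comp_apply,
    simple_lo, simple_hi]
  by_cases h : (f (lo i)).2 = (f (hi i)).2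
  · simp [h]
  · simp [h, Ne.symm h]

theorem op_g_sq (N r : ℕ) (i : Fin (n - 1)) :
    opG q N r i ^ 2 = 1 + ((q : R) - ((q⁻¹ : Rˣ) : R)) • (opG q N r i * opE R N r i) := by
  refine (tensBasis R n N r).ext fun f => ?_
  simp only [pow_two, Module.End.mul_apply, opE_basis, opG_basis, map_smul, map_add,
    Function.comp_apply, simple_lo, simple_hi, LinearMap.add_apply, LinearMap.smul_apply,
    Module.End.one_apply, comp_simple_simple]
  have hq : (q : R) * ((q⁻¹ : Rˣ) : R) = 1 := by simp
  generalize tensBasis R n N r (f ∘ simple i) = y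
  generalize tensBasis R n N r f = x
  generalize f (lo i) = a
  generalize f (hi i) = b
  obtain ⟨a, s⟩ := a
  obtain ⟨b, t⟩ := b
  by_cases hst : s = t
  · subst hst
    rcases lt_trichotomy a b with h | h | h
    · simp only [cG, dG, h, h.ne, h.ne', h.not_gt, ne_eq, not_true, if_true, if_false]
      module
    · subst h
      simp only [cG, dG, ne_eq, not_true, if_true, if_false]
      match_scalars <;> first | ring1 | linear_combination hq
    · simp only [cG, dG, h, h.ne, h.ne', h.not_gt, ne_eq, not_true, if_true, if_false]
      module
  · simp only [cG, dG, hst, Ne.symm hst, ne_eq, not_false_eq_true, if_true, if_false]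
    module

theorem lo_ne_hi (i : Fin (n - 1)) : lo i ≠ hi i := by
  simp [lo, hi, Fin.ext_iff]

theorem far_ne {i j : Fin (n - 1)} (h : Far i j) :
    lo j ≠ lo i ∧ lo j ≠ hi i ∧ hi j ≠ lo i ∧ hi j ≠ hi i := by
  simp only [Far] at h
  simp only [lo, hi, ne_eq, Fin.mk.injEq]
  omega

theorem simple_far {α : Type*} {i j : Fin (n - 1)} (h : Far i j) (f : Fin n → α) :
    (f ∘ simple i) ∘ simple j = (f ∘ simple j) ∘ simple i := by
  obtain ⟨h1, h2, h3, h4⟩ := far_ne h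
  funext x
  simp only [Function.comp_apply]
  congr 1
  by_cases a : x = lo i
  · subst a; rw [simple_of_ne j _ h1.symm h3.symm, simple_lo, simple_of_ne j _ h2.symm h4.symm]
  by_cases b : x = hi i
  · subst b; rw [simple_of_ne j _ h2.symm h4.symm, simple_hi, simple_of_ne j _ h1.symm h3.symm]
  rw [simple_of_ne i x a b]
  by_cases c : x = lo j
  · subst c; rw [simple_lo, simple_of_ne i _ h3 h4]
  by_cases d : x = hi j
  · subst d; rw [simple_hi, simple_of_ne i _ h1 h2]
  rw [simple_of_ne j x c d, simple_of_ne i x a b]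

theorem op_gg_far (N r : ℕ) (i j : Fin (n - 1)) (h : Far i j) :
    opG q N r i * opG q N r j = opG q N r j * opG q N r i := by
  obtain ⟨h1, h2, h3, h4⟩ := far_ne h
  refine (tensBasis R n N r).ext fun f => ?_
  simp only [Module.End.mul_apply, opG_basis, map_smul, map_add, Function.comp_apply,
    simple_of_ne i _ h1 h2, simple_of_ne i _ h3 h4, simple_of_ne j _ h1.symm h3.symm,
    simple_of_ne j _ h2.symm h4.symm, simple_far h f]
  module

theorem op_ge_far (N r : ℕ) (i j : Fin (n - 1)) (h : Far i j) :
    opG q N r i * opE R N r j = opE R N r j * opG q N r i := by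
  obtain ⟨h1, h2, h3, h4⟩ := far_ne h
  refine (tensBasis R n N r).ext fun f => ?_
  simp only [Module.End.mul_apply, opG_basis, opE_basis, map_smul, map_add, Function.comp_apply,
    simple_of_ne i _ h1 h2, simple_of_ne i _ h3 h4]
  module

theorem next_facts {i j : Fin (n - 1)} (h : (i : ℕ) + 1 = j) :
    hi i = lo j ∧ simple i (hi j) = hi j ∧ simple j (lo i) = lo i := by
  refine ⟨by simp [lo, hi, h], simple_of_ne _ _ ?_ ?_, simple_of_ne _ _ ?_ ?_⟩ <;>
    simp only [lo, hi, ne_eq, Fin.mk.injEq] <;> omega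

theorem simple_braid {α : Type*} {i j : Fin (n - 1)} (h : (i : ℕ) + 1 = j) (f : Fin n → α) :
    ((f ∘ simple i) ∘ simple j) ∘ simple i = ((f ∘ simple j) ∘ simple i) ∘ simple j := by
  obtain ⟨h1, h2, h3⟩ := next_facts h
  have e1 : simple i (lo j) = lo i := by rw [← h1, simple_hi]
  have e2 : simple i (lo i) = lo j := by rw [← h1, simple_lo]
  have e3 := simple_lo j
  have e4 := simple_hi j
  funext x
  simp only [Function.comp_apply]
  congr 1
  by_cases a : x = lo i
  · rw [a, h3, e2, e3, h2]
  by_cases b : x = lo j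
  · rw [b, e1, h3, e2, e3, h2, e4]
  by_cases c : x = hi j
  · rw [c, h2, e4, e1, h3]
  have k1 := simple_of_ne i x a (h1 ▸ b)
  have k2 := simple_of_ne j x b c
  simp only [k1, k2]

set_option maxHeartbeats 4000000 in
/-- The two-step products of the operators in three neighbouring factors. -/
theorem op_near (N r : ℕ) {i j : Fin (n - 1)} (h : (i : ℕ) + 1 = j) :
    opG q N r i * opG q N r j * opG q N r i = opG q N r j * opG q N r i * opG q N r j ∧
    opE R N r i * opG q N r j * opG q N r i = opG q N r j * opG q N r i * opE R N r j ∧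
    opE R N r j * opG q N r i * opG q N r j = opG q N r i * opG q N r j * opE R N r i ∧
    opE R N r i * opE R N r j * opG q N r j = opE R N r i * opG q N r j * opE R N r i ∧
    opE R N r j * opE R N r i * opG q N r i = opE R N r j * opG q N r i * opE R N r j ∧
    opE R N r i * opG q N r j * opE R N r i = opG q N r j * opE R N r i * opE R N r j ∧
    opE R N r j * opG q N r i * opE R N r j = opG q N r i * opE R N r j * opE R N r i := by
  obtain ⟨h1, h2, h3⟩ := next_facts h
  have e1 : simple i (lo j) = lo i := by rw [← h1, simple_hi]
  have e2 : simple i (lo i) = lo j := by rw [← h1, simple_lo]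
  have e3 := simple_lo j
  have e4 := simple_hi j
  have hq : (q : R) * ((q⁻¹ : Rˣ) : R) = 1 := by simp
  refine ⟨?_, ?_, ?_, ?_, ?_, ?_, ?_⟩ <;>
  · refine (tensBasis R n N r).ext fun f => ?_
    simp only [Module.End.mul_apply, opE_basis, opG_basis, map_smul, map_add, Function.comp_apply,
      h1, e1, e2, e3, e4, h2, h3, comp_simple_simple, simple_braid h f]
    generalize tensBasis R n N r (f ∘ simple i) = y1
    generalize tensBasis R n N r (f ∘ simple j) = y2
    generalize tensBasis R n N r ((f ∘ simple i) ∘ simple j) = y3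
    generalize tensBasis R n N r ((f ∘ simple j) ∘ simple i) = y4
    generalize tensBasis R n N r (((f ∘ simple j) ∘ simple i) ∘ simple j) = y5
    generalize tensBasis R n N r f = x
    generalize f (lo i) = a
    generalize f (lo j) = b
    generalize f (hi j) = c
    obtain ⟨a, s⟩ := a
    obtain ⟨b, t⟩ := b
    obtain ⟨c, u⟩ := c
    by_cases hst : s = t <;> by_cases htu : t = u <;> by_cases hsu : s = u <;>
      first
      | (exfalso; omega)
      | (simp (disch := omega) only [cG, dG, if_pos, if_neg]; module)
      | (rcases lt_trichotomy a b with h | h | h <;> rcases lt_trichotomy b c with h' | h' | h' <;>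
        rcases lt_trichotomy a c with h'' | h'' | h'' <;>
        first
        | (exfalso; omega)
        | (simp (disch := omega) only [cG, dG, if_pos, if_neg]
           first
           | module
           | (match_scalars <;> first | ring1 | 
                linear_combination (q : R) * hq |
                linear_combination -(q : R) * hq |
                linear_combination ((q⁻¹ : Rˣ) : R) * hq |
                linear_combination -((q⁻¹ : Rˣ) : R) * hq |
                linear_combination ((q : R) - ((q⁻¹ : Rˣ) : R)) * hq |
                linear_combination (((q⁻¹ : Rˣ) : R) - (q : R)) * hq)))

theorem satisfies_ops (N r : ℕ) :
    Satisfies q (A := Module.End R (Tens R n N r)) (opG q N r) (opE R N r) where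
  gg_far i j h := op_gg_far q N r i j h
  ge_same i := op_ge_same q N r i
  braid i j h := by
    rcases h with h | h
    · exact (op_near q N r h).1
    · exact (op_near q N r h).1.symm
  egg i j h := by
    rcases h with h | h
    · exact (op_near q N r h).2.1
    · exact (op_near q N r h).2.2.1
  eeg_ege i j h := by
    rcases h with h | h
    · exact (op_near q N r h).2.2.2.1
    · exact (op_near q N r h).2.2.2.2.1
  ege_gee i j h := by
    rcases h with h | h
    · exact (op_near q N r h).2.2.2.2.2.1
    · exact (op_near q N r h).2.2.2.2.2.2
  ee i j := op_ee N r i j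
  ge_far i j h := op_ge_far q N r i j h
  e_sq i := op_e_sq N r i
  g_sq i := by rw [op_g_sq, op_ge_same]

/-- The right action of the algebra of braids and ties on the tensor space, in which `g_i` acts by
`𝐆_i` and `e_i` acts by `𝐄_i`. -/
def rightAct (n N r : ℕ) : BT q n →ₐ[R] (Module.End R (Tens R n N r))ᵐᵒᵖ :=
  lift q (satisfies_ops q N r).op

/-- `v · a` for a vector `v` of the tensor space and an element `a` of the algebra. -/
def act {N r : ℕ} (v : Tens R n N r) (a : BT q n) : Tens R n N r := (rightAct q n N r a).unop v

/-! ### Set partitions and idempotents -/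

/-- The set partitions of `{1, …, n}`, ordered by `A ≤ B` iff every block of `A` is contained in
a block of `B`. -/
abbrev SetPart (n : ℕ) : Type := Finpartition (Finset.univ : Finset (Fin n))

open Classical in
instance (n : ℕ) : LocallyFiniteOrder (SetPart n) := Fintype.toLocallyFiniteOrder

/-- `E_{i, i+k+1}`, where `E_{i, i+1} = e_i` and `E_{i j} = g_i E_{i+1, j} g_i⁻¹`. -/
def tieAux : (k i : ℕ) → i + k + 1 < n → BT q n
  | 0, i, h => e q ⟨i, by omega⟩
  | k + 1, i, h =>
      g q ⟨i, by omega⟩ * tieAux k (i + 1) (by omega) * gInv q ⟨i, by omega⟩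

/-- The element `E_{i j}` for `i < j`. -/
def tie (i j : Fin n) (h : i < j) : BT q n :=
  tieAux q (j - i - 1) i (by have := j.2; have : (i : ℕ) < j := h; omega)

/-- `E_A`, the product of the (commuting) elements `E_{i j}` over the pairs `i < j` of elements of a
common block of `A`. -/
def tieProd (A : SetPart n) : BT q n :=
  ((List.finRange n ×ˢ List.finRange n).map fun p =>
    if h : p.1 < p.2 ∧ p.2 ∈ A.part p.1 then tie q p.1 p.2 h.1 else 1).prod

open Classical in
/-- The idempotent `𝔼_A = ∑_{A ≤ B} μ(A, B) E_B`, with `μ` the Möbius function of the lattice of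
set partitions. -/
def idem (A : SetPart n) : BT q n :=
  ∑ B : SetPart n with A ≤ B, (IncidenceAlgebra.mu ℤ : IncidenceAlgebra ℤ (SetPart n)) A B •
    tieProd q B

/-- `A` is of type `α`: the sizes of its blocks are the parts of `α`. -/
def HasType (A : SetPart n) (α : n.Partition) : Prop := A.parts.val.map Finset.card = α.parts

open Classical in
/-- The central idempotent `𝔼_α = ∑_{|A| = α} 𝔼_A`. -/
def idemType (α : n.Partition) : BT q n := ∑ A : SetPart n with HasType A α, idem q A

/-- The two-sided ideal `𝓔_n^α(q) = 𝔼_α 𝓔_n(q)`. -/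
def btType (α : n.Partition) : Submodule R (BT q n) :=
  LinearMap.range (LinearMap.mulLeft R (idemType q α))

/-- The submodule `𝔼_α V^{⊗ n}` of the tensor space. -/
def tensType (N r : ℕ) (α : n.Partition) : Submodule R (Tens R n N r) :=
  LinearMap.range (rightAct q n N r (idemType q α)).unop

/-- The annihilator ideal of the action of `𝓔_n^α(q)` on `𝔼_α V^{⊗ n}`: the elements `a` of
`𝓔_n^α(q)` such that `v · a = 0` for all `v` in `𝔼_α V^{⊗ n}`. -/
def annIdeal (N r : ℕ) (α : n.Partition) : Submodule R (BT q n) where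
  carrier := {a | a ∈ btType q α ∧ ∀ v ∈ tensType q N r α, act q v a = 0}
  add_mem' ha hb := ⟨add_mem ha.1 hb.1, fun v hv => by
    have h1 := ha.2 v hv
    have h2 := hb.2 v hv
    simp only [act] at h1 h2 ⊢
    simp [h1, h2]⟩
  zero_mem' := ⟨zero_mem _, fun v _ => by simp [act]⟩
  smul_mem' c a ha := ⟨Submodule.smul_mem _ c ha.1, fun v hv => by
    have h1 := ha.2 v hv
    simp only [act] at h1 ⊢
    simp [h1]⟩

end Algebra

/-! ### Multipartitions and multitableaux -/

/-- The nodes of a `k`-multipartition `lam`: triples of a component, a row and a column. -/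
def Node {k : ℕ} (lam : Fin k → YoungDiagram) : Type :=
  {x : Fin k × ℕ × ℕ // x.2 ∈ lam x.1}

namespace Node

variable {k : ℕ} {lam : Fin k → YoungDiagram}

/-- The component of a node. -/
def comp (x : Node lam) : Fin k := x.1.1

/-- The row of a node. -/
def row (x : Node lam) : ℕ := x.1.2.1

/-- The column of a node. -/
def col (x : Node lam) : ℕ := x.1.2.2

/-- The reading order of the nodes: by components, then by rows, then by columns. -/
instance : LinearOrder (Node lam) :=
  LinearOrder.lift' (fun x => (toLex (x.comp, toLex (x.row, x.col)) : Fin k ×ₗ ℕ ×ₗ ℕ)) (by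
    intro x y h
    simp only [comp, row, col, EmbeddingLike.apply_eq_iff_eq, Prod.mk.injEq] at h
    exact Subtype.ext (Prod.ext h.1 (Prod.ext h.2.1 h.2.2)))

/-- The nodes, component by component. -/
def equivSigma (lam : Fin k → YoungDiagram) :
    Node lam ≃ (Σ i : Fin k, {c : ℕ × ℕ // c ∈ (lam i).cells}) where
  toFun x := ⟨x.1.1, x.1.2, x.2⟩
  invFun y := ⟨(y.1, y.2.1), y.2.2⟩
  left_inv _ := rfl
  right_inv _ := rfl

instance : Fintype (Node lam) := Fintype.ofEquiv _ (equivSigma lam).symm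

theorem card_eq (lam : Fin k → YoungDiagram) :
    Fintype.card (Node lam) = ∑ i, (lam i).card := by
  rw [Fintype.card_congr (equivSigma lam), Fintype.card_sigma]
  simp

end Node

section Tableaux

variable {k m : ℕ} {lam : Fin k → YoungDiagram}

/-- The multitableau `𝔱^λ`, in which the labels `1, …, m` are entered in order along the rows of the
first component, then along the rows of the second component, and so on. A multitableau is
a bijection from the labels to the nodes. -/
def initTab (h : ∑ i, (lam i).card = m) : Fin m ≃ Node lam :=
  (Fintype.orderIsoFinOfCardEq (Node lam) ((Node.card_eq lam).trans h)).toEquiv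

/-- `t` is standard: in every component the labels increase from left to right in each row and
from top to bottom in each column. -/
def IsStd (t : Fin m ≃ Node lam) : Prop :=
  (∀ x y, (t x).comp = (t y).comp → (t x).row = (t y).row → (t x).col < (t y).col → x < y) ∧
  (∀ x y, (t x).comp = (t y).comp → (t x).col = (t y).col → (t x).row < (t y).row → x < y)

/-- The permutation `d(t)` with `t = 𝔱^λ d(t)`: it maps the label of a node in `𝔱^λ` to the label of
the same node in `t`. -/
def dPerm (h : ∑ i, (lam i).card = m) (t : Fin m ≃ Node lam) : Equiv.Perm (Fin m) :=
  (initTab h).trans t.symm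

open Classical in
/-- The Young subgroup `𝔖_λ`, the row stabiliser of `𝔱^λ`. -/
def young (h : ∑ i, (lam i).card = m) : Finset (Equiv.Perm (Fin m)) :=
  {w | ∀ x, (initTab h (w x)).comp = (initTab h x).comp ∧
    (initTab h (w x)).row = (initTab h x).row}

open Classical in
/-- The set partition `A_λ` of the labels into the components of `𝔱^λ`. -/
def blockPart (h : ∑ i, (lam i).card = m) : SetPart m :=
  Finpartition.ofSetoid (Setoid.ker fun x => (initTab h x).comp)

/-- The order preserving permutation `B_w` of the blocks `I_1, …, I_k` of `A_λ`, which moves the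
block `I_i` to the place `w(i)` and keeps the order inside the blocks: the label `x` is mapped to its
rank when the labels are sorted stably by the new place of their blocks. If `w` only permutes
blocks of equal size, then `B_w` maps `I_i` onto `I_{w(i)}`. -/
def blockPerm (h : ∑ i, (lam i).card = m) (w : Equiv.Perm (Fin k)) : Equiv.Perm (Fin m) :=
  (Tuple.sort fun x => w (initTab h x).comp).symm

/-- The least label in the component `i` of `t`. -/
def minLabel (t : Fin m ≃ Node lam) (i : Fin k) : WithTop (Fin m) :=
  (Finset.univ.filter fun x => (t x).comp = i).min

end Tableaux

/-! ### The index set of the dual cellular basis -/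

/-- Dominance order on partitions. -/
def Dominated (μ ν : YoungDiagram) : Prop :=
  ∀ k, ∑ i ∈ Finset.range k, μ.rowLen i ≤ ∑ i ∈ Finset.range k, ν.rowLen i

/-- `le` is a total order on the set of all partitions, which on the partitions of each fixed integer
extends the dominance order. -/
structure ExtendsDominance (le : YoungDiagram → YoungDiagram → Prop) : Prop where
  refl : ∀ μ, le μ μ
  trans : ∀ μ ν ρ, le μ ν → le ν ρ → le μ ρ
  antisymm : ∀ μ ν, le μ ν → le ν μ → μ = ν
  total : ∀ μ ν, le μ ν ∨ le ν μ
  extends_dominance : ∀ μ ν : YoungDiagram, μ.card = ν.card → Dominated μ ν → le μ ν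

/-- The set `𝓛_n(α)` of the pairs `Λ = (λ | μ)`, where `λ` is an increasing `r`-multipartition of `n`
of type `α` and `μ` is an `s`-multipartition of `r`, with `s` the number of distinct components of
`λ`, such that the size of the `j`-th component of `μ` is the multiplicity in `λ` of the `j`-th
of the distinct components of `λ` (in increasing order). -/
structure Shape (le : YoungDiagram → YoungDiagram → Prop) {n : ℕ} (r : ℕ) (α : n.Partition) where
  lam : Fin r → YoungDiagram
  lam_size : ∑ i, (lam i).card = n
  lam_type : HasType (blockPart lam_size) α
  lam_incr : ∀ i j, i ≤ j → le (lam i) (lam j)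
  s : ℕ
  mu : Fin s → YoungDiagram
  mu_size : ∑ j, (mu j).card = r
  mu_mult : ∃ val : Fin s → YoungDiagram,
    (∀ i j, i < j → le (val i) (val j) ∧ val i ≠ val j) ∧
    Set.range val = Set.range lam ∧
    ∀ j, (mu j).card = Nat.card {i // lam i = val j}

/-- `Λ` is not in `𝓛_{n, ≤ N}(α)`: some component of `λ` has more than `N` columns. -/
def Shape.Wide {le : YoungDiagram → YoungDiagram → Prop} {n r : ℕ} {α : n.Partition}
    (Λ : Shape le r α) (N : ℕ) : Prop := ∃ i, N < (Λ.lam i).rowLen 0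

/-- The set `Std(Λ)` of the standard `Λ`-tableaux `(t | u)`: `t` is a standard `λ`-multitableau in
which equal components are ordered by their least labels, and `u` is a standard `μ`-multitableau
of the initial kind. -/
structure StdTab {le : YoungDiagram → YoungDiagram → Prop} {n r : ℕ} {α : n.Partition}
    (Λ : Shape le r α) where
  t : Fin n ≃ Node Λ.lam
  t_std : IsStd t
  t_incr : ∀ i j, Λ.lam i = Λ.lam j → (i < j ↔ minLabel t i < minLabel t j)
  u : Fin r ≃ Node Λ.mu
  u_std : IsStd u
  u_init : ∀ i, (u i).comp = (initTab Λ.mu_size i).comp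

section DualBasis

variable {R : Type*} [CommRing R] (q : Rˣ) {le : YoungDiagram → YoungDiagram → Prop} {n r : ℕ}
  {α : n.Partition} (Λ : Shape le r α)

/-- The idempotent `𝔼_λ`. -/
def eLam : BT q n := idem q (blockPart Λ.lam_size)

/-- The element `y_λ = ∑_{w ∈ 𝔖_λ} (-q)^{-ℓ(w)} g_w`. -/
def yLam : BT q n :=
  ∑ w ∈ young Λ.lam_size, (((-q) ^ (-(len w : ℤ)) : Rˣ) : R) • gPerm q w

/-- The image `𝔹_w = 𝔼_λ g_{B_w}` of `w` under the embedding of the group algebra of the group of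
the permutations of the equal components of `λ`. -/
def bPerm (w : Equiv.Perm (Fin r)) : BT q n := eLam q Λ * gPerm q (blockPerm Λ.lam_size w)

/-- The element `c_μ`, the image of `∑_{w ∈ 𝔖_μ} (-1)^{ℓ(w)} w`. -/
def cMu : BT q n := ∑ w ∈ young Λ.mu_size, ((-1 : R) ^ len w) • bPerm q Λ w

/-- The dual cellular basis element
`n_{𝔰𝔱} = g_{d(s)}^* 𝔼_λ y_λ 𝔹_{d(u)}^* c_μ 𝔹_{d(v)} g_{d(t)}` for `𝔰 = (s | u)`, `𝔱 = (t | v)`. -/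
def nElt (a b : StdTab Λ) : BT q n :=
  st q (gPerm q (dPerm Λ.lam_size a.t)) * eLam q Λ * yLam q Λ *
    st q (bPerm q Λ (dPerm Λ.mu_size a.u)) * cMu q Λ * bPerm q Λ (dPerm Λ.mu_size b.u) *
    gPerm q (dPerm Λ.lam_size b.t)

end DualBasis

/-- The indices `(Λ, 𝔰, 𝔱)` with `Λ ∈ 𝓛_n(α)` not in `𝓛_{n, ≤ N}(α)` and `𝔰, 𝔱 ∈ Std(Λ)`. -/
abbrev WideIndex (le : YoungDiagram → YoungDiagram → Prop) {n : ℕ} (N r : ℕ)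
    (α : n.Partition) : Type :=
  Σ Λ : {Λ : Shape le r α // Λ.Wide N}, StdTab Λ.1 × StdTab Λ.1

/-- The indeterminate `q` as a unit of `ℤ[q, q⁻¹]`. -/
def laurentQ : (LaurentPolynomial ℤ)ˣ where
  val := LaurentPolynomial.T 1
  inv := LaurentPolynomial.T (-1)
  val_inv := by rw [← LaurentPolynomial.T_add]; simp
  inv_val := by rw [← LaurentPolynomial.T_add]; simp

end BraidsTies

end

open scoped TensorProduct

noncomputable section

namespace BraidsTies

/-! ### Reduced expressions in the symmetric group -/

section Coxeter

variable {n : ℕ}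

/-! Let `rho` be the matrix representation on the tensor space. The idempotent of type α acts as the
identity on its ideal, so the annihilator is the kernel of `rho` inside `btType`
(`mem_annIdeal_iff`). It has to be shown that the elements of wide shape lie in this kernel, that
the elements of all shapes form a basis of `btType`, and that no nontrivial combination of the
non-wide ones acts by zero.

Vanishing. For every simple transposition in the row stabiliser, the antisymmetriser is divisible on
the left by `1 - q⁻¹ g_i` (`exists_antisym_eq`). Hence it kills every basis vector with a repeated
entry inside a row, and a row with more than `N` cells always contains a repetition
(`rho_eBlock_antisym_eq_zero`).

Independence. The matrix Y of the idempotent times the antisymmetriser satisfies Y = Yᵀ D Y, where D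
is the diagonal projection to the sequences that increase along rows (`rho_eBlock_antisym`). Since
the anti-involution is transposition, the entries of a dual cellular element become sums, over such
sequences `f₀`, of products of entries of two elements `stdElt` (`rho_sandwich`, `rho_nElt`). These
entries are read off at the sequences of columns and components of standard multitableaux. A nonzero
entry forces dominance between the shapes (`dominated_of_rowIncr`). For equal shapes `f₀` is the
initial sequence up to its colours, and `rho_antisym_gPerm_dPerm` gives unitriangularity in the
tableaux. Permutations of equal components leave a signed sum over the row stabiliser of μ; it is
the same kind of expression for the parameter 1 (`signedSum_eq`) and is therefore triangular as
well. Suitable sums of entries of `rho` thus give functionals `pairing` that are unitriangular on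
the dual cellular elements (`pairing_nElt_self`, `fullKey_le_of_pairing_ne_zero`). They exist for
all shapes whose rows have length at most `N`.

Spanning. The products of an idempotent of type α and some `gPerm q w` span `btType`
(`mem_span_of_mem_btType`). The pairs (set partition, permutation) inject into the index set
(`exists_injection_index`): the number of permutations is the sum of the squares of the numbers of
standard tableaux, and this count is used once inside the blocks and once for the permutation of the
blocks. A unitriangular family that is at least as large as a spanning family spans, because a
surjective endomorphism of a finitely generated module is injective (`span_le_of_triangular`).

Conclusion. In the expansion of an element of the annihilator the wide terms act by zero, so the
remaining terms together act by zero; triangularity of the pairings on the tensor space itself kills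
their coefficients (`annIdeal_le_span`). Nothing depends on the coefficients beyond a nontrivial
commutative ring with a unit `q`, so the Laurent polynomials and the fields are treated alike. -/

theorem simple_val (i : Fin (n - 1)) (x : Fin n) :
    ((simple i x : Fin n) : ℕ) =
      if (x : ℕ) = i then (i : ℕ) + 1 else if (x : ℕ) = i + 1 then (i : ℕ) else x := by
  by_cases h1 : x = lo i
  · rw [h1, simple_lo]; simp [lo, hi]
  by_cases h2 : x = hi i
  · rw [h2, simple_hi]; simp [lo, hi]
  rw [simple_of_ne i x h1 h2, if_neg, if_neg]
  · intro h; exact h2 (Fin.ext h)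
  · intro h; exact h1 (Fin.ext h)

theorem lo_lt_hi (i : Fin (n - 1)) : lo i < hi i := Nat.lt_succ_self (i : ℕ)

@[simp] theorem simple_symm (i : Fin (n - 1)) : (simple i).symm = simple i := by simp [simple]

@[simp] theorem simple_simple (i : Fin (n - 1)) (x : Fin n) : simple i (simple i x) = x := by
  simp [simple]

theorem trans_simple_simple (w : Equiv.Perm (Fin n)) (i : Fin (n - 1)) :
    (w.trans (simple i)).trans (simple i) = w := by
  ext x; simp

theorem strictMono_of_lo_lt_hi {α : Type*} [Preorder α] {f : Fin n → α}
    (h : ∀ i, f (lo i) < f (hi i)) : StrictMono f := by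
  cases n with
  | zero => exact fun x => x.elim0
  | succ m =>
    rw [Fin.strictMono_iff_lt_succ]
    exact fun i => h i

theorem exists_hi_lt_lo {α : Type*} [LinearOrder α] {f : Fin n → α} (hf : Function.Injective f)
    (h : ¬ StrictMono f) : ∃ i, f (hi i) < f (lo i) := by
  by_contra hc
  push Not at hc
  exact h (strictMono_of_lo_lt_hi fun i => lt_of_le_of_ne (hc i) fun e => lo_ne_hi i (hf e))

theorem perm_eq_refl_of_strictMono {w : Equiv.Perm (Fin n)} (h : StrictMono w) :
    w = Equiv.refl _ := by
  have h1 : h.orderIsoOfSurjective w w.surjective = OrderIso.refl _ := Subsingleton.elim _ _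
  ext x
  have := congrArg (fun e : Fin n ≃o Fin n => ((e x : Fin n) : ℕ)) h1
  simpa using this

/-- The inversions of a permutation. -/
def inversions (w : Equiv.Perm (Fin n)) : Finset (Fin n × Fin n) :=
  {p | p.1 < p.2 ∧ w p.2 < w p.1}

theorem mem_inversions {w : Equiv.Perm (Fin n)} {p : Fin n × Fin n} :
    p ∈ inversions w ↔ p.1 < p.2 ∧ w p.2 < w p.1 := by simp [inversions]

theorem inversions_refl : inversions (Equiv.refl (Fin n)) = ∅ := by
  ext p
  simp only [mem_inversions, Equiv.refl_apply, Finset.notMem_empty, iff_false, not_and, not_lt]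
  exact le_of_lt

/-- The last factor swaps two adjacent values and keeps the order of every other pair of values. So
only the preimages of these two values can form a new inversion. -/
theorem inversions_trans_simple {w : Equiv.Perm (Fin n)} {i : Fin (n - 1)}
    (h : w.symm (lo i) < w.symm (hi i)) :
    inversions (w.trans (simple i)) = insert (w.symm (lo i), w.symm (hi i)) (inversions w) := by
  ext ⟨x, y⟩
  simp only [mem_inversions, Finset.mem_insert, Prod.mk.injEq, Equiv.trans_apply,
    Equiv.eq_symm_apply]
  have hx : ∀ z, w z = lo i → z = w.symm (lo i) := fun z hz => by rw [← hz]; simp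
  have hy : ∀ z, w z = hi i → z = w.symm (hi i) := fun z hz => by rw [← hz]; simp
  have key : ∀ a b : Fin n, (simple i b < simple i a) ↔
      (a = lo i ∧ b = hi i) ∨ (b < a ∧ ¬ (b = lo i ∧ a = hi i)) := by
    intro a b
    simp only [Fin.lt_def, simple_val, Fin.ext_iff, lo, hi]
    split_ifs <;> omega
  rw [key]
  constructor
  · rintro ⟨h1, h2 | h2⟩
    · exact Or.inl h2
    · exact Or.inr ⟨h1, h2.1⟩
  · rintro (h2 | h2)
    · refine ⟨?_, Or.inl h2⟩
      rw [hx x h2.1, hy y h2.2]; exact h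
    · refine ⟨h2.1, Or.inr ⟨h2.2, ?_⟩⟩
      rintro ⟨h3, h4⟩
      rw [hx y h3, hy x h4] at h2
      exact absurd h2.1 h.not_gt

theorem card_inversions_trans_simple {w : Equiv.Perm (Fin n)} {i : Fin (n - 1)}
    (h : w.symm (lo i) < w.symm (hi i)) :
    (inversions (w.trans (simple i))).card = (inversions w).card + 1 := by
  rw [inversions_trans_simple h, Finset.card_insert_of_notMem]
  simp only [mem_inversions, Equiv.apply_symm_apply, not_and, not_lt]
  intro _
  simp [Fin.le_def, lo, hi]

theorem card_inversions_of_descent {w : Equiv.Perm (Fin n)} {i : Fin (n - 1)}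
    (h : w.symm (hi i) < w.symm (lo i)) :
    (inversions w).card = (inversions (w.trans (simple i))).card + 1 := by
  have := card_inversions_trans_simple (w := w.trans (simple i)) (i := i)
    (by simpa [simple_lo, simple_hi] using h)
  rwa [trans_simple_simple] at this

theorem ascent_or_descent (w : Equiv.Perm (Fin n)) (i : Fin (n - 1)) :
    w.symm (lo i) < w.symm (hi i) ∨ w.symm (hi i) < w.symm (lo i) :=
  lt_or_gt_of_ne fun h => lo_ne_hi i (w.symm.injective h)

theorem card_inversions_trans_simple_le (w : Equiv.Perm (Fin n)) (i : Fin (n - 1)) :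
    (inversions (w.trans (simple i))).card ≤ (inversions w).card + 1 := by
  rcases ascent_or_descent w i with h | h
  · exact (card_inversions_trans_simple h).le
  · have := card_inversions_of_descent h; omega

theorem exists_descent {w : Equiv.Perm (Fin n)} (h : w ≠ Equiv.refl _) :
    ∃ i, w.symm (hi i) < w.symm (lo i) := by
  apply exists_hi_lt_lo w.symm.injective
  intro hs
  apply h
  have := perm_eq_refl_of_strictMono (w := w.symm) hs
  rw [← Equiv.symm_symm w, this]; rfl

/-- Induction over a permutation along the descents. -/
theorem perm_induction {P : Equiv.Perm (Fin n) → Prop} (one : P (Equiv.refl _))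
    (step : ∀ w i, w.symm (lo i) < w.symm (hi i) → P w → P (w.trans (simple i))) (w) : P w := by
  induction hk : (inversions w).card using Nat.strong_induction_on generalizing w with
  | _ k ih =>
    by_cases hw : w = Equiv.refl _
    · exact hw ▸ one
    obtain ⟨i, hi'⟩ := exists_descent hw
    have h1 := card_inversions_of_descent hi'
    have h2 := step (w.trans (simple i)) i (by simpa [simple_lo, simple_hi] using hi')
      (ih _ (by omega) _ rfl)
    rwa [trans_simple_simple] at h2

theorem wordPerm_concat (l : List (Fin (n - 1))) (i : Fin (n - 1)) :
    wordPerm (l ++ [i]) = (wordPerm l).trans (simple i) := by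
  rw [wordPerm_append]; rfl

theorem card_inversions_le_length (l : List (Fin (n - 1))) :
    (inversions (wordPerm l)).card ≤ l.length := by
  induction l using List.reverseRecOn with
  | nil => simp [wordPerm, inversions_refl]
  | append_singleton l i ih =>
    rw [wordPerm_concat, List.length_append, List.length_singleton]
    exact (card_inversions_trans_simple_le _ _).trans (by omega)

theorem exists_word_length_eq (w : Equiv.Perm (Fin n)) :
    ∃ l, wordPerm l = w ∧ l.length = (inversions w).card := by
  induction w using perm_induction with
  | one => exact ⟨[], rfl, by simp [inversions_refl]⟩
  | step w i h ih =>
    obtain ⟨l, hl, hl'⟩ := ih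
    refine ⟨l ++ [i], by rw [wordPerm_concat, hl], ?_⟩
    rw [card_inversions_trans_simple h, List.length_append, hl']; rfl

theorem wordPerm_reducedWord (w : Equiv.Perm (Fin n)) : wordPerm (reducedWord w) = w :=
  (exists_reducedWord w).choose_spec.1

/-- Each letter changes the number of inversions by at most one, which bounds the length of a word
from below; removing descents one at a time produces a word that attains the bound. -/
theorem len_eq_card_inversions (w : Equiv.Perm (Fin n)) : len w = (inversions w).card := by
  obtain ⟨l, hl, hl'⟩ := exists_word_length_eq w
  apply le_antisymm
  · rw [← hl']; exact (exists_reducedWord w).choose_spec.2 l hl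
  · have := card_inversions_le_length (reducedWord w)
    rwa [wordPerm_reducedWord] at this

theorem len_refl : len (Equiv.refl (Fin n)) = 0 := by
  rw [len_eq_card_inversions, inversions_refl]; rfl

theorem len_trans_simple {w : Equiv.Perm (Fin n)} {i : Fin (n - 1)}
    (h : w.symm (lo i) < w.symm (hi i)) : len (w.trans (simple i)) = len w + 1 := by
  rw [len_eq_card_inversions, len_eq_card_inversions, card_inversions_trans_simple h]

theorem len_symm (w : Equiv.Perm (Fin n)) : len w.symm = len w := by
  rw [len_eq_card_inversions, len_eq_card_inversions]
  refine Finset.card_bij (fun p _ => (w.symm p.2, w.symm p.1)) ?_ ?_ ?_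
  · intro p hp
    rw [mem_inversions] at hp ⊢
    simpa using hp.symm
  · intro p _ p' _ h
    simp only [Prod.mk.injEq, EmbeddingLike.apply_eq_iff_eq] at h
    exact Prod.ext h.2 h.1
  · intro p hp
    rw [mem_inversions] at hp
    exact ⟨(w p.2, w p.1), by rw [mem_inversions]; simpa using hp.symm, by simp⟩

theorem simple_trans_far {i j : Fin (n - 1)} (h : Far i j) :
    (simple i).trans (simple j) = (simple j).trans (simple i) := by
  ext x
  simp only [Equiv.trans_apply, simple_val]
  simp only [Far] at h
  split_ifs <;> omega

theorem simple_trans_near {i j : Fin (n - 1)} (h : Near i j) :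
    ((simple i).trans (simple j)).trans (simple i) =
      ((simple j).trans (simple i)).trans (simple j) := by
  rcases h with h | h
  · exact Equiv.ext fun x => congrFun (simple_braid h id) x
  · exact Equiv.ext fun x => (congrFun (simple_braid h id) x).symm

theorem near_or_far {i j : Fin (n - 1)} (h : i ≠ j) : Near i j ∨ Far i j := by
  simp only [Near, Far]
  have := Fin.val_ne_of_ne h
  omega

theorem far_descents {w : Equiv.Perm (Fin n)} {i j : Fin (n - 1)} (h : Far i j)
    (hi' : w.symm (hi i) < w.symm (lo i)) (hj' : w.symm (hi j) < w.symm (lo j)) :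
    (inversions w).card = (inversions ((w.trans (simple i)).trans (simple j))).card + 2 := by
  obtain ⟨h1, h2, h3, h4⟩ := far_ne h
  have e1 := card_inversions_of_descent hi'
  have e2 := card_inversions_of_descent (w := w.trans (simple i)) (i := j)
    (by simpa [simple_of_ne i _ h1 h2, simple_of_ne i _ h3 h4] using hj')
  omega

theorem next_descents {w : Equiv.Perm (Fin n)} {i j : Fin (n - 1)} (h : (i : ℕ) + 1 = j)
    (hi' : w.symm (hi i) < w.symm (lo i)) (hj' : w.symm (hi j) < w.symm (lo j)) :
    (inversions w).card = (inversions
      (((w.trans (simple i)).trans (simple j)).trans (simple i))).card + 3 := by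
  obtain ⟨h1, h2, h3⟩ := next_facts h
  have e1 := card_inversions_of_descent hi'
  have e2 := card_inversions_of_descent (w := w.trans (simple i)) (i := j)
    (by simp only [Equiv.symm_trans_apply, simple_symm, h2, ← h1, simple_hi]
        exact (h1 ▸ hj').trans hi')
  have e3 := card_inversions_of_descent (w := (w.trans (simple i)).trans (simple j)) (i := i)
    (by simp only [Equiv.symm_trans_apply, simple_symm, h1, h2, h3, simple_lo]
        exact h1 ▸ hj')
  omega

/-- Matsumoto's theorem for the symmetric group. -/
theorem prod_eq_of_reduced {M : Type*} [Monoid M] {G : Fin (n - 1) → M}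
    (far : ∀ i j, Far i j → G i * G j = G j * G i)
    (braid : ∀ i j, Near i j → G i * G j * G i = G j * G i * G j) (l l' : List (Fin (n - 1)))
    (h : wordPerm l = wordPerm l') (hl : l.length = (inversions (wordPerm l)).card)
    (hl' : l'.length = (inversions (wordPerm l')).card) :
    (l.map G).prod = (l'.map G).prod := by
  induction hk : l.length using Nat.strong_induction_on generalizing l l' with
  | _ k ih =>
  have hlen : l'.length = l.length := by rw [hl, hl', h]
  rcases List.eq_nil_or_concat l with rfl | ⟨m, i, rfl⟩
  · have : l' = [] := List.eq_nil_of_length_eq_zero (by simpa using hlen)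
    rw [this]
  rcases List.eq_nil_or_concat l' with rfl | ⟨m', j, rfl⟩
  · simp at hlen
  simp only [List.concat_eq_append] at *
  simp only [List.length_append, List.length_singleton] at hl hl' hlen hk
  have hmw : wordPerm m = (wordPerm (m ++ [i])).trans (simple i) := by
    rw [wordPerm_concat, trans_simple_simple]
  have hmw' : wordPerm m' = (wordPerm (m ++ [i])).trans (simple j) := by
    rw [h, wordPerm_concat, trans_simple_simple]
  rw [← h] at hl'
  generalize wordPerm (m ++ [i]) = w at *
  have desc : ∀ (m : List (Fin (n - 1))) (i), wordPerm m = w.trans (simple i) →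
      m.length + 1 = (inversions w).card → w.symm (hi i) < w.symm (lo i) ∧
        m.length = (inversions (wordPerm m)).card := by
    intro m i hm hl
    have h1 := card_inversions_le_length m
    rcases ascent_or_descent w i with h2 | h2
    · rw [hm, card_inversions_trans_simple h2] at h1; omega
    · have h3 := card_inversions_of_descent h2
      rw [← hm] at h3
      exact ⟨h2, by omega⟩
  obtain ⟨hi', hm1⟩ := desc m i hmw hl
  obtain ⟨hj', hm1'⟩ := desc m' j hmw' hl'
  simp only [List.map_append, List.prod_append, List.map_cons, List.map_nil, List.prod_singleton]
  by_cases hij : i = j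
  · subst hij
    rw [ih m.length (by omega) m m' (by rw [hmw, hmw']) hm1 hm1' rfl]
  -- Two different last letters are both descents of `w`, so `w` also has reduced words ending in
  -- the longest element of the subgroup generated by the two letters. Induction rewrites the given
  -- words into these, and the two new words differ by a single braid or commutation relation.
  rcases near_or_far hij with hn | hf
  · have e1 : ∀ (i j : Fin (n - 1)) (u : Equiv.Perm (Fin n)),
        u = ((w.trans (simple i)).trans (simple j)).trans (simple i) →
        (u.trans (simple i)).trans (simple j) = w.trans (simple i) := by
      rintro i j u rfl
      rw [trans_simple_simple, trans_simple_simple]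
    obtain ⟨u, hu, hu', hc⟩ : ∃ u, u = ((w.trans (simple i)).trans (simple j)).trans (simple i) ∧
        u = ((w.trans (simple j)).trans (simple i)).trans (simple j) ∧
        (inversions w).card = (inversions u).card + 3 := by
      have hb : ((w.trans (simple i)).trans (simple j)).trans (simple i) =
          ((w.trans (simple j)).trans (simple i)).trans (simple j) := by
        simp only [Equiv.trans_assoc] at *
        rw [← Equiv.trans_assoc (simple i), simple_trans_near hn]
        simp only [Equiv.trans_assoc]
      rcases hn with hn | hn
      · exact ⟨_, rfl, hb, next_descents hn hi' hj'⟩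
      · exact ⟨_, hb.symm, rfl, next_descents hn hj' hi'⟩
    obtain ⟨v, hv, hvl⟩ := exists_word_length_eq u
    have w1 : wordPerm (v ++ [i] ++ [j]) = w.trans (simple i) := by
      rw [wordPerm_concat, wordPerm_concat, hv]; exact e1 i j u hu
    have w2 : wordPerm (v ++ [j] ++ [i]) = w.trans (simple j) := by
      rw [wordPerm_concat, wordPerm_concat, hv]; exact e1 j i u hu'
    have p1 := ih m.length (by omega) m (v ++ [i] ++ [j]) (by rw [hmw, w1]) hm1
      (by rw [w1, ← hmw]; simp; omega) rfl
    have p2 := ih m'.length (by omega) m' (v ++ [j] ++ [i]) (by rw [hmw', w2]) hm1'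
      (by rw [w2, ← hmw']; simp; omega) rfl
    rw [p1, p2]
    simp only [List.map_append, List.prod_append, List.map_cons, List.map_nil, List.prod_singleton]
    have := braid i j hn
    simp only [mul_assoc] at this ⊢
    rw [this]
  · have e2 : (w.trans (simple i)).trans (simple j) = (w.trans (simple j)).trans (simple i) := by
      rw [Equiv.trans_assoc, simple_trans_far hf, ← Equiv.trans_assoc]
    have hc := far_descents hf hi' hj'
    obtain ⟨v, hv, hvl⟩ := exists_word_length_eq ((w.trans (simple i)).trans (simple j))
    have w1 : wordPerm (v ++ [j]) = w.trans (simple i) := by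
      rw [wordPerm_concat, hv, trans_simple_simple]
    have w2 : wordPerm (v ++ [i]) = w.trans (simple j) := by
      rw [wordPerm_concat, hv, e2, trans_simple_simple]
    have p1 := ih m.length (by omega) m (v ++ [j]) (by rw [hmw, w1]) hm1
      (by rw [w1, ← hmw]; simp; omega) rfl
    have p2 := ih m'.length (by omega) m' (v ++ [i]) (by rw [hmw', w2]) hm1'
      (by rw [w2, ← hmw']; simp; omega) rfl
    rw [p1, p2]
    simp only [List.map_append, List.prod_append, List.map_cons, List.map_nil, List.prod_singleton,
      mul_assoc, far i j hf]

variable {R : Type*} [CommRing R] (q : Rˣ)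

theorem gPerm_eq_prod {w : Equiv.Perm (Fin n)} {l : List (Fin (n - 1))} (h : wordPerm l = w)
    (hl : l.length = len w) : gPerm q w = (l.map (g q)).prod := by
  have H := satisfies_gens q (n := n)
  refine prod_eq_of_reduced H.gg_far H.braid _ _ ?_ ?_ ?_
  · rw [wordPerm_reducedWord, h]
  · rw [wordPerm_reducedWord, ← len_eq_card_inversions]; rfl
  · rw [h, hl, len_eq_card_inversions]

theorem gPerm_refl : gPerm q (Equiv.refl (Fin n)) = 1 := by
  rw [gPerm_eq_prod q (w := Equiv.refl _) (l := []) rfl (by simp [len_refl])]; rfl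

theorem gPerm_trans_simple {w : Equiv.Perm (Fin n)} {i : Fin (n - 1)}
    (h : w.symm (lo i) < w.symm (hi i)) : gPerm q (w.trans (simple i)) = gPerm q w * g q i := by
  rw [gPerm_eq_prod q (l := reducedWord w ++ [i])]
  · simp [gPerm]
  · rw [wordPerm_concat, wordPerm_reducedWord]
  · rw [len_trans_simple h, List.length_append]; rfl

theorem st_g (i : Fin (n - 1)) : st q (g q i) = g q i := by
  rw [st, star, lift_g]; rfl

theorem st_e (i : Fin (n - 1)) : st q (e q i) = e q i := by
  rw [st, star, lift_e]; rfl

theorem st_mul (a b : BT q n) : st q (a * b) = st q b * st q a := by simp [st]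

theorem st_one : st q (1 : BT q n) = 1 := by simp [st]

/-- A reduced word read backwards is a reduced word of the inverse, and the anti-involution reverses
products of generators. -/
theorem st_gPerm (w : Equiv.Perm (Fin n)) : st q (gPerm q w) = gPerm q w.symm := by
  have h1 : ∀ l : List (Fin (n - 1)), st q (l.map (g q)).prod = (l.reverse.map (g q)).prod := by
    intro l
    induction l with
    | nil => simp [st_one]
    | cons i l ih => simp [st_mul, ih, st_g]
  have h2 : ∀ l : List (Fin (n - 1)), wordPerm l.reverse = (wordPerm l).symm := by
    intro l
    induction l with
    | nil => rfl
    | cons i l ih => rw [List.reverse_cons, wordPerm_concat, ih]; simp [wordPerm]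
  rw [gPerm, h1, gPerm_eq_prod q (l := (reducedWord w).reverse)]
  · rw [h2, wordPerm_reducedWord]
  · rw [len_symm, List.length_reverse]; rfl

theorem gPerm_simple_trans {w : Equiv.Perm (Fin n)} {i : Fin (n - 1)}
    (h : w (lo i) < w (hi i)) : gPerm q ((simple i).trans w) = g q i * gPerm q w := by
  have h1 := gPerm_trans_simple q (w := w.symm) (i := i) (by simpa using h)
  have h2 := congrArg (st q) h1
  rw [st_mul, st_gPerm, st_gPerm, st_g] at h2
  simpa [Equiv.symm_trans] using h2

theorem len_simple_trans {w : Equiv.Perm (Fin n)} {i : Fin (n - 1)}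
    (h : w (lo i) < w (hi i)) : len ((simple i).trans w) = len w + 1 := by
  have h1 := len_trans_simple (w := w.symm) (i := i) (by simpa using h)
  rw [len_symm] at h1
  rw [← h1, ← len_symm]; simp

end Coxeter

/-! ### The elements `E_{i j}` -/

section Ties

variable {R : Type*} [CommRing R] (q : Rˣ) {n : ℕ}

/-- The generator `g_i` as a unit. -/
def gU (i : Fin (n - 1)) : (BT q n)ˣ := ⟨g q i, gInv q i, (g_mul_gInv q i).1, (g_mul_gInv q i).2⟩

theorem tieAux_succ (k i : ℕ) (h : i + (k + 1) + 1 < n) :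
    tieAux q (k + 1) i h = (gU q (n := n) ⟨i, by omega⟩).val * tieAux q k (i + 1) (by omega) *
      ((gU q (n := n) ⟨i, by omega⟩)⁻¹).val := rfl

theorem tieAux_commute_far (k : ℕ) : ∀ (i : ℕ) (h : i + k + 1 < n) (l : Fin (n - 1)),
    ((l : ℕ) + 1 < i ∨ i + k + 1 < l) → Commute (gU q (n := n) l).val (tieAux q k i h) := by
  have H := satisfies_gens q (n := n)
  induction k with
  | zero => exact fun i h l hl => H.ge_far l ⟨i, by omega⟩ (by simp only [Far]; omega)
  | succ k ih =>
    intro i h l hl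
    have h1 : Commute (gU q (n := n) l).val (gU q (n := n) ⟨i, by omega⟩).val :=
      H.gg_far l ⟨i, by omega⟩ (by simp only [Far]; omega)
    rw [tieAux_succ]
    exact (h1.mul_right (ih (i + 1) (by omega) l (by omega))).mul_right h1.units_inv_right

/-- The braid relation says that conjugation by `ab` carries `a` to `b`. As `a` commutes with `X`,
`b` commutes with the conjugate of `X`. -/
theorem unit_braid {A : Type*} [Monoid A] {a b : Aˣ} {X : A}
    (h : (a : A) * b * a = b * a * b) (hX : Commute (a : A) X) :
    Commute (b : A) (a * (b * X * (b⁻¹ : Aˣ)) * (a⁻¹ : Aˣ)) := by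
  have h' : a * b * a = b * a * b := Units.ext h
  have h2 : a * b⁻¹ * a⁻¹ = b⁻¹ * a⁻¹ * b := by
    have : (a * b⁻¹ * a⁻¹) * (a * b) = (b⁻¹ * a⁻¹ * b) * (a * b) := by
      calc _ = a := by group
        _ = b⁻¹ * a⁻¹ * (a * b * a) := by group
        _ = _ := by rw [h']; group
    exact mul_right_cancel this
  have h2' := congrArg Units.val h2
  simp only [Units.val_mul] at h2'
  have h3 : (b : A) * (a * (b * X * (b⁻¹ : Aˣ)) * (a⁻¹ : Aˣ)) =
      (b * a * b) * X * ((b⁻¹ : Aˣ) * (a⁻¹ : Aˣ)) := by simp only [mul_assoc]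
  rw [commute_iff_eq, h3, ← h, mul_assoc _ (a : A) X, hX.eq]
  simp only [mul_assoc] at h2' ⊢
  rw [h2']

theorem tieAux_commute_inside (k : ℕ) : ∀ (i : ℕ) (h : i + k + 1 < n) (l : Fin (n - 1)),
    i < l → (l : ℕ) + 1 < i + k + 1 → Commute (gU q (n := n) l).val (tieAux q k i h) := by
  have H := satisfies_gens q (n := n)
  induction k with
  | zero => intro i h l h1 h2; omega
  | succ k ih =>
    intro i h l h1 h2
    rw [tieAux_succ]
    rcases Nat.lt_or_ge (i + 1) l with hl | hl
    · have h3 : Commute (gU q (n := n) l).val (gU q (n := n) ⟨i, by omega⟩).val :=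
        H.gg_far l ⟨i, by omega⟩ (by simp only [Far]; omega)
      exact (h3.mul_right (ih (i + 1) (by omega) l (by omega) (by omega))).mul_right
        h3.units_inv_right
    · obtain ⟨l, hl'⟩ := l
      obtain rfl : l = i + 1 := by simp only at h1 hl; omega
      cases k with
      | zero => simp only at h2; omega
      | succ k =>
        rw [tieAux_succ]
        exact unit_braid (H.braid ⟨i, by omega⟩ ⟨i + 1, by omega⟩ (Or.inl rfl))
          (tieAux_commute_far q k (i + 1 + 1) (by omega) _ (Or.inl (by simp)))

theorem g_mul_tieAux_pred (k i : ℕ) (h : i + (k + 1) + 1 < n) :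
    g q ⟨i, by omega⟩ * tieAux q k (i + 1) (by omega) =
      tieAux q (k + 1) i h * g q ⟨i, by omega⟩ := by
  rw [tieAux_succ]
  exact (Units.inv_mul_cancel_right _ (gU q ⟨i, by omega⟩)).symm

/-- Expanding the inverse, the main term is the relation `egg`, and the correction terms agree by
`eeg_ege`. -/
theorem gInv_conj {i j : Fin (n - 1)} (h : Near i j) :
    gInv q i * g q j * e q i = e q j * (gInv q i * g q j) := by
  have H := satisfies_gens q (n := n)
  rw [gInv, add_mul, add_mul, mul_add, ← H.egg j i h.symm, ← mul_assoc (e q j)]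
  simp only [smul_mul_assoc, mul_smul_comm]
  rw [← H.eeg_ege i j h, ← mul_assoc, H.ee j i]

/-- The recursion for the ties only moves the left end; this is the symmetric statement at the right
end. Away from the base case the generators at the two ends commute. -/
theorem g_mul_tieAux_last (k : ℕ) : ∀ (i : ℕ) (h : i + (k + 1) + 1 < n),
    g q ⟨i + k + 1, by omega⟩ * tieAux q k i (by omega) =
      tieAux q (k + 1) i h * g q ⟨i + k + 1, by omega⟩ := by
  have H := satisfies_gens q (n := n)
  induction k with
  | zero =>
    intro i h
    have h1 := gInv_conj q (i := (⟨i, by omega⟩ : Fin (n - 1))) (j := ⟨i + 1, by omega⟩)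
      (Or.inl rfl)
    have h2 := congrArg (g q (⟨i, by omega⟩ : Fin (n - 1)) * ·) h1
    simp only [← mul_assoc, (g_mul_gInv q _).1, one_mul] at h2
    exact h2
  | succ k ih =>
    intro i h
    have h3 : Commute (gU q (n := n) ⟨i + (k + 1) + 1, by omega⟩).val (gU q (n := n) ⟨i, by omega⟩).val :=
      H.gg_far _ ⟨i, by omega⟩ (by simp only [Far]; omega)
    have h4 : (gU q (n := n) ⟨i + (k + 1) + 1, by omega⟩).val * tieAux q k (i + 1) (by omega) =
        tieAux q (k + 1) (i + 1) (by omega) * (gU q (n := n) ⟨i + (k + 1) + 1, by omega⟩).val := by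
      have := ih (i + 1) (by omega)
      simp only [show i + 1 + k + 1 = i + (k + 1) + 1 by omega] at this
      exact this
    change (gU q (n := n) ⟨i + (k + 1) + 1, by omega⟩).val * _ =
      _ * (gU q (n := n) ⟨i + (k + 1) + 1, by omega⟩).val
    rw [tieAux_succ q k, tieAux_succ q (k + 1), ← mul_assoc, ← mul_assoc, h3.eq,
      mul_assoc (gU q (n := n) ⟨i, by omega⟩).val, h4, ← mul_assoc, mul_assoc, mul_assoc,
      h3.units_inv_right.eq]
    simp only [mul_assoc]

/-- The generators are not involutions, so lengthening a tie by conjugation does not by itself say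
that the same generator shortens it again. That needs the square of the generator to commute with
the tie. -/
theorem g_sq_commute_e {i j : Fin (n - 1)} (h : Near i j) : Commute (g q i * g q i) (e q j) := by
  have H := satisfies_gens q (n := n)
  have h1 : e q i * g q i * e q j = e q j * (e q i * g q i) := by
    rw [← mul_assoc, ← H.ge_same i, H.eeg_ege j i h.symm, H.ege_gee j i h.symm, mul_assoc, mul_assoc,
      H.ee i j]
  rw [commute_iff_eq, ← pow_two, H.g_sq, add_mul, mul_add, smul_mul_assoc, mul_smul_comm, h1,
    one_mul, mul_one]

theorem g_mul_tieAux_shrink (k : ℕ) : ∀ (i : ℕ) (h : i + (k + 1) + 1 < n),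
    g q ⟨i + k + 1, by omega⟩ * tieAux q (k + 1) i h =
      tieAux q k i (by omega) * g q ⟨i + k + 1, by omega⟩ := by
  have key : ∀ {A : Type _} [Monoid A] {a : Aˣ} {X Y : A}, (a : A) * X = Y * a →
      Commute ((a : A) * a) X → (a : A) * Y = X * a := by
    intro A _ a X Y h1 h2
    have : Y = a * X * (a⁻¹ : Aˣ) := by rw [h1, Units.mul_inv_cancel_right]
    rw [this, ← mul_assoc, ← mul_assoc, h2.eq, mul_assoc, mul_assoc, Units.mul_inv, mul_one]
  have H := satisfies_gens q (n := n)
  induction k with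
  | zero =>
    intro i h
    exact key (a := gU q (n := n) ⟨i + 0 + 1, by omega⟩) (g_mul_tieAux_last q 0 i h)
      (g_sq_commute_e q (Or.inr rfl))
  | succ k ih =>
    intro i h
    have h3 : Commute (gU q (n := n) ⟨i + (k + 1) + 1, by omega⟩).val (gU q (n := n) ⟨i, by omega⟩).val :=
      H.gg_far _ ⟨i, by omega⟩ (by simp only [Far]; omega)
    have h4 : (gU q (n := n) ⟨i + (k + 1) + 1, by omega⟩).val * tieAux q (k + 1) (i + 1) (by omega) =
        tieAux q k (i + 1) (by omega) * (gU q (n := n) ⟨i + (k + 1) + 1, by omega⟩).val := by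
      have := ih (i + 1) (by omega)
      simp only [show i + 1 + k + 1 = i + (k + 1) + 1 by omega] at this
      exact this
    change (gU q (n := n) ⟨i + (k + 1) + 1, by omega⟩).val * _ =
      _ * (gU q (n := n) ⟨i + (k + 1) + 1, by omega⟩).val
    rw [tieAux_succ q k, tieAux_succ q (k + 1), ← mul_assoc, ← mul_assoc, h3.eq,
      mul_assoc (gU q (n := n) ⟨i, by omega⟩).val, h4, ← mul_assoc, mul_assoc, mul_assoc,
      h3.units_inv_right.eq]
    simp only [mul_assoc]

theorem g_sq_commute_tieAux (k : ℕ) : ∀ (i : ℕ) (h : i + 1 + k + 1 < n),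
    Commute (g q ⟨i, by omega⟩ * g q ⟨i, by omega⟩) (tieAux q k (i + 1) h) := by
  have H := satisfies_gens q (n := n)
  induction k with
  | zero => exact fun i h => g_sq_commute_e q (Or.inl rfl)
  | succ k ih =>
    intro i h
    have h1 : tieAux q (k + 1) (i + 1) h = (gU q (n := n) ⟨i + 1 + k + 1, by omega⟩).val *
        tieAux q k (i + 1) (by omega) * ((gU q (n := n) ⟨i + 1 + k + 1, by omega⟩)⁻¹).val := by
      have := g_mul_tieAux_last q k (i + 1) h
      change (gU q (n := n) ⟨i + 1 + k + 1, by omega⟩).val * _ =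
        _ * (gU q (n := n) ⟨i + 1 + k + 1, by omega⟩).val at this
      rw [this, Units.mul_inv_cancel_right]
    have h3 : Commute (g q ⟨i, by omega⟩) (gU q (n := n) ⟨i + 1 + k + 1, by omega⟩).val :=
      H.gg_far ⟨i, by omega⟩ _ (by simp only [Far]; omega)
    have h4 := h3.mul_left h3
    rw [h1]
    exact (h4.mul_right (ih i (by omega))).mul_right h4.units_inv_right

theorem g_mul_tieAux_first (k i : ℕ) (h : i + (k + 1) + 1 < n) :
    g q ⟨i, by omega⟩ * tieAux q (k + 1) i h =
      tieAux q k (i + 1) (by omega) * g q ⟨i, by omega⟩ := by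
  rw [tieAux_succ]
  have h1 := g_sq_commute_tieAux q (n := n) k i (by omega)
  change (gU q (n := n) ⟨i, by omega⟩).val * _ = _ * (gU q (n := n) ⟨i, by omega⟩).val
  change Commute ((gU q (n := n) ⟨i, by omega⟩).val * (gU q (n := n) ⟨i, by omega⟩).val) _ at h1
  rw [← mul_assoc, ← mul_assoc, h1.eq, mul_assoc, mul_assoc, Units.mul_inv, mul_one]

/-- The element `E_{x y}` for any `x`, `y`, with `E_{x x} = 1`. -/
def tieS (x y : Fin n) : BT q n :=
  if h : x < y then tie q x y h else if h' : y < x then tie q y x h' else 1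

theorem tieS_comm (x y : Fin n) : tieS q x y = tieS q y x := by
  unfold tieS
  split_ifs with h1 h2
  · exact absurd h2 h1.not_gt
  all_goals rfl

theorem tieS_self (x : Fin n) : tieS q x x = 1 := by simp [tieS]

theorem tieS_eq_tieAux (k i : ℕ) (h : i + k + 1 < n) (x y : Fin n) (hx : (x : ℕ) = i)
    (hy : (y : ℕ) = i + k + 1) : tieS q x y = tieAux q k i h := by
  have hxy : x < y := by simp only [Fin.lt_def]; omega
  rw [tieS, dif_pos hxy, tie]
  congr 1
  omega

theorem tieS_lo_hi (i : Fin (n - 1)) : tieS q (lo i) (hi i) = e q i :=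
  tieS_eq_tieAux q 0 i (by omega) _ _ rfl rfl

theorem g_mul_tieS_of_lt (i : Fin (n - 1)) {x y : Fin n} (h : x < y) :
    g q i * tieS q x y = tieS q (simple i x) (simple i y) * g q i := by
  obtain ⟨k, hk⟩ : ∃ k, (y : ℕ) = x + k + 1 := ⟨y - x - 1, by simp only [Fin.lt_def] at h; omega⟩
  have hy := y.2
  have hs := simple_val i x
  have hs' := simple_val i y
  by_cases h1 : (i : ℕ) + 1 < x
  · rw [if_neg (by omega), if_neg (by omega)] at hs hs'
    rw [Fin.ext hs, Fin.ext hs', tieS_eq_tieAux q k x (by omega) x y rfl hk]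
    exact tieAux_commute_far q k _ _ i (Or.inl h1)
  by_cases h2 : (y : ℕ) < i
  · rw [if_neg (by omega), if_neg (by omega)] at hs hs'
    rw [Fin.ext hs, Fin.ext hs', tieS_eq_tieAux q k x (by omega) x y rfl hk]
    exact tieAux_commute_far q k _ _ i (Or.inr (by omega))
  by_cases h3 : (x : ℕ) < i ∧ (i : ℕ) + 1 < y
  · rw [if_neg (by omega), if_neg (by omega)] at hs hs'
    rw [Fin.ext hs, Fin.ext hs', tieS_eq_tieAux q k x (by omega) x y rfl hk]
    exact tieAux_commute_inside q k _ _ i h3.1 (by omega)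
  by_cases h4 : (i : ℕ) + 1 = x
  · rw [if_neg (by omega), if_pos (by omega)] at hs
    rw [if_neg (by omega), if_neg (by omega)] at hs'
    rw [tieS_eq_tieAux q k (i + 1) (by omega) x y h4.symm (by omega),
      tieS_eq_tieAux q (k + 1) i (by omega) _ _ hs (by omega)]
    exact g_mul_tieAux_pred q (n := n) k i (by omega)
  by_cases h5 : (i : ℕ) = y
  · rw [if_neg (by omega), if_neg (by omega)] at hs
    rw [if_pos (by omega)] at hs'
    rw [tieS_eq_tieAux q k x (by omega) x y rfl hk,
      tieS_eq_tieAux q (k + 1) x (by omega) _ _ hs (by omega)]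
    have := g_mul_tieAux_last q (n := n) k x (by omega)
    simp only [← hk, ← h5] at this
    exact this
  by_cases h6 : (i : ℕ) = x
  · rw [if_pos (by omega)] at hs
    by_cases hk0 : k = 0
    · subst hk0
      rw [if_neg (by omega), if_pos (by omega)] at hs'
      rw [tieS_comm q (simple i x), tieS_eq_tieAux q 0 i (by omega) x y h6.symm (by omega),
        tieS_eq_tieAux q 0 i (by omega) _ _ hs' (by omega)]
      exact (satisfies_gens q).ge_same i
    · obtain ⟨k, rfl⟩ := Nat.exists_eq_succ_of_ne_zero hk0
      rw [if_neg (by omega), if_neg (by omega)] at hs'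
      rw [tieS_eq_tieAux q (k + 1) i (by omega) x y h6.symm (by omega),
        tieS_eq_tieAux q k (i + 1) (by omega) _ _ hs (by omega)]
      exact g_mul_tieAux_first q (n := n) k i (by omega)
  · have h7 : (i : ℕ) + 1 = y := by simp only [Fin.lt_def] at h; omega
    obtain ⟨k, rfl⟩ := Nat.exists_eq_succ_of_ne_zero (n := k) (by omega)
    rw [if_neg (by omega), if_neg (by omega)] at hs
    rw [if_neg (by omega), if_pos (by omega)] at hs'
    rw [tieS_eq_tieAux q (k + 1) x (by omega) x y rfl (by omega),
      tieS_eq_tieAux q k x (by omega) _ _ hs (by omega)]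
    have := g_mul_tieAux_shrink q (n := n) k x (by omega)
    simp only [show (x : ℕ) + k + 1 = i by omega] at this
    exact this

theorem g_mul_tieS (i : Fin (n - 1)) (x y : Fin n) :
    g q i * tieS q x y = tieS q (simple i x) (simple i y) * g q i := by
  rcases lt_trichotomy x y with h | h | h
  · exact g_mul_tieS_of_lt q i h
  · subst h; rw [tieS_self, tieS_self, one_mul, mul_one]
  · rw [tieS_comm q x, tieS_comm q (simple i x)]; exact g_mul_tieS_of_lt q i h

theorem gPerm_mul_tieS (w : Equiv.Perm (Fin n)) (x y : Fin n) :
    gPerm q w * tieS q x y = tieS q (w.symm x) (w.symm y) * gPerm q w := by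
  induction w using perm_induction generalizing x y with
  | one => rw [gPerm_refl, one_mul, mul_one]; rfl
  | step w i h ih =>
    rw [gPerm_trans_simple q h, mul_assoc, g_mul_tieS, ← mul_assoc, ih, mul_assoc]; rfl

/-- `gPerm_mul_tieS` only moves ties through `gPerm`; here a unit is produced, so that relations
between ties can be conjugated back and forth. -/
theorem exists_unit_transport (w : Equiv.Perm (Fin n)) :
    ∃ U : (BT q n)ˣ, ∀ x y, (U : BT q n) * tieS q x y = tieS q (w x) (w y) * U := by
  induction w using perm_induction with
  | one => exact ⟨1, fun x y => by simp⟩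
  | step w i _ ih =>
    obtain ⟨U, hU⟩ := ih
    refine ⟨gU q i * U, fun x y => ?_⟩
    rw [Units.val_mul, mul_assoc, hU, ← mul_assoc, ← mul_assoc]
    congr 1
    exact g_mul_tieS q i _ _

/-- The symmetric group is transitive on tuples of distinct labels. A relation between ties on `k`
labels therefore has to be checked only for the first `k` labels, where the ties are generators or
nearly so. -/
theorem exists_transport {k : ℕ} (f : Fin k ↪ Fin n) :
    ∃ (hk : k ≤ n) (U : (BT q n)ˣ), ∀ a b : Fin k, tieS q (f a) (f b) =
      U * tieS q (Fin.castLE hk a) (Fin.castLE hk b) * (U⁻¹ : (BT q n)ˣ) := by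
  have hk : k ≤ n := by simpa using Fintype.card_le_of_embedding f
  have htr : MulAction.IsMultiplyPretransitive (Equiv.Perm (Fin n)) (Fin n) k :=
    Equiv.Perm.isMultiplyPretransitive _ _
  obtain ⟨w, hw⟩ := htr.exists_smul_eq (Fin.castLEEmb hk) f
  obtain ⟨U, hU⟩ := exists_unit_transport q w
  refine ⟨hk, U, fun a b => ?_⟩
  rw [hU, Units.mul_inv_cancel_right, ← hw]
  rfl

theorem tieS_idem (x y : Fin n) : tieS q x y * tieS q x y = tieS q x y := by
  by_cases hxy : x = y
  · subst hxy; simp [tieS_self]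
  obtain ⟨hk, U, hU⟩ := exists_transport q (k := 2) ⟨![x, y], by
    intro a b; fin_cases a <;> fin_cases b <;> simp [hxy, Ne.symm hxy]⟩
  have h := hU 0 1
  change tieS q x y = _ at h
  rw [tieS_eq_tieAux q 0 0 (by omega) (Fin.castLE hk 0) (Fin.castLE hk 1) rfl rfl] at h
  have he : tieAux q 0 0 (by omega) * tieAux q 0 0 (by omega : 0 + 0 + 1 < n) =
      tieAux q 0 0 (by omega) := by
    have := (satisfies_gens q (n := n)).e_sq ⟨0, by omega⟩
    rwa [pow_two] at this
  rw [h]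
  simp only [mul_assoc, Units.inv_mul_cancel_left]
  rw [← mul_assoc (tieAux q 0 0 _) (tieAux q 0 0 _), he]

theorem tieS_triple {x y z : Fin n} (hxy : x ≠ y) (hyz : y ≠ z) (hxz : x ≠ z) :
    Commute (tieS q x y) (tieS q y z) ∧
      tieS q x y * tieS q y z = tieS q x y * tieS q x z := by
  obtain ⟨hk, U, hU⟩ := exists_transport q (k := 3) ⟨![x, y, z], by
    intro a b; fin_cases a <;> fin_cases b <;>
      simp [hxy, hyz, hxz, Ne.symm hxy, Ne.symm hyz, Ne.symm hxz]⟩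
  have H := satisfies_gens q (n := n)
  have h1 := hU 0 1
  have h2 := hU 1 2
  have h3 := hU 0 2
  change tieS q x y = _ at h1
  change tieS q y z = _ at h2
  change tieS q x z = _ at h3
  rw [tieS_eq_tieAux q 0 0 (by omega) (Fin.castLE hk 0) (Fin.castLE hk 1) rfl rfl] at h1
  rw [tieS_eq_tieAux q 0 1 (by omega) (Fin.castLE hk 1) (Fin.castLE hk 2) rfl rfl] at h2
  rw [tieS_eq_tieAux q 1 0 (by omega) (Fin.castLE hk 0) (Fin.castLE hk 2) rfl rfl] at h3
  have e1 : tieAux q 0 0 (by omega) * tieAux q 0 1 (by omega : 1 + 0 + 1 < n) =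
      tieAux q 0 1 (by omega) * tieAux q 0 0 (by omega) := H.ee _ _
  -- For the labels 1, 2, 3 the claim reads e₁e₂ = e₁ g₁ e₂ g₁⁻¹, which follows from the mixed
  -- relations between the `e_i` and the `g_j`.
  have e2 : tieAux q 0 0 (by omega) * tieAux q 0 1 (by omega : 1 + 0 + 1 < n) =
      tieAux q 0 0 (by omega) * tieAux q 1 0 (by omega) := by
    change e q (⟨0, by omega⟩ : Fin (n - 1)) * e q ⟨1, by omega⟩ =
      e q ⟨0, by omega⟩ * (g q ⟨0, by omega⟩ * e q ⟨1, by omega⟩ * gInv q ⟨0, by omega⟩)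
    have h4 := H.eeg_ege ⟨1, by omega⟩ ⟨0, by omega⟩ (Or.inr rfl)
    rw [H.ege_gee ⟨1, by omega⟩ ⟨0, by omega⟩ (Or.inr rfl)] at h4
    rw [← mul_assoc, ← mul_assoc, ← H.ge_same, mul_assoc (g q _), H.ee ⟨0, by omega⟩, ← mul_assoc,
      ← h4, mul_assoc, (g_mul_gInv q _).1, mul_one]
  constructor
  · rw [commute_iff_eq, h1, h2]
    simp only [mul_assoc, Units.inv_mul_cancel_left]
    rw [← mul_assoc (tieAux q 0 0 _), e1, mul_assoc]
  · rw [h1, h2, h3]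
    simp only [mul_assoc, Units.inv_mul_cancel_left]
    rw [← mul_assoc (tieAux q 0 0 _), e2, mul_assoc]

theorem tieS_commute (x y z t : Fin n) : Commute (tieS q x y) (tieS q z t) := by
  by_cases hxy : x = y
  · subst hxy; rw [tieS_self]; exact Commute.one_left _
  by_cases hzt : z = t
  · subst hzt; rw [tieS_self]; exact Commute.one_right _
  by_cases hyz : y = z
  · subst hyz
    by_cases hxt : x = t
    · subst hxt; rw [tieS_comm q x]
    · exact (tieS_triple q hxy hzt hxt).1
  by_cases hyt : y = t
  · subst hyt
    rw [tieS_comm q z]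
    by_cases hxz : x = z
    · subst hxz; rw [tieS_comm q x]
    · exact (tieS_triple q hxy hyz hxz).1
  by_cases hxz : x = z
  · subst hxz
    rw [tieS_comm q x y]
    exact (tieS_triple q (Ne.symm hxy) hzt hyt).1
  by_cases hxt : x = t
  · subst hxt
    rw [tieS_comm q x y, tieS_comm q z]
    exact (tieS_triple q (Ne.symm hxy) hxz hyz).1
  obtain ⟨hk, U, hU⟩ := exists_transport q (k := 4) ⟨![x, y, z, t], by
    intro a b; fin_cases a <;> fin_cases b <;>
      simp [hxy, hyz, hxz, Ne.symm hxy, Ne.symm hyz, Ne.symm hxz, hxt, hyt, hzt, Ne.symm hxt,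
        Ne.symm hyt, Ne.symm hzt]⟩
  have h1 := hU 0 1
  have h2 := hU 2 3
  change tieS q x y = _ at h1
  change tieS q z t = _ at h2
  rw [tieS_eq_tieAux q 0 0 (by omega) (Fin.castLE hk 0) (Fin.castLE hk 1) rfl rfl] at h1
  rw [tieS_eq_tieAux q 0 2 (by omega) (Fin.castLE hk 2) (Fin.castLE hk 3) rfl rfl] at h2
  have e1 : tieAux q 0 0 (by omega) * tieAux q 0 2 (by omega : 2 + 0 + 1 < n) =
      tieAux q 0 2 (by omega) * tieAux q 0 0 (by omega) := (satisfies_gens q (n := n)).ee _ _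
  rw [commute_iff_eq, h1, h2]
  simp only [mul_assoc, Units.inv_mul_cancel_left]
  rw [← mul_assoc (tieAux q 0 0 _), e1, mul_assoc]

/-- `E_{x y} E_{y z}` absorbs `E_{x z}`. -/
theorem tieS_trans (x y z : Fin n) :
    tieS q x y * tieS q y z * tieS q x z = tieS q x y * tieS q y z := by
  by_cases hxz : x = z
  · subst hxz; rw [tieS_self, mul_one]
  by_cases hxy : x = y
  · subst hxy; rw [tieS_self, one_mul, tieS_idem]
  by_cases hyz : y = z
  · subst hyz; rw [tieS_self, mul_one, tieS_idem]
  rw [(tieS_triple q hxy hyz hxz).2, mul_assoc, tieS_idem]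

end Ties

/-! ### Set partitions and the idempotents `𝔼_A` -/

section SetPartitions

variable {n : ℕ}

theorem mem_part_iff (A : SetPart n) {x y : Fin n} : y ∈ A.part x ↔ A.part x = A.part y := by
  rw [A.mem_part_iff_part_eq_part (Finset.mem_univ _) (Finset.mem_univ _), eq_comm]

theorem setPart_le_iff {A B : SetPart n} :
    A ≤ B ↔ ∀ x y, A.part x = A.part y → B.part x = B.part y := by
  constructor
  · intro h x y hxy
    obtain ⟨c, hc, hle⟩ := h (A.part_mem.2 (Finset.mem_univ x))
    have hx : x ∈ c := hle (A.mem_part_self.2 (Finset.mem_univ x))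
    have hy : y ∈ c := hle (hxy ▸ A.mem_part_self.2 (Finset.mem_univ y))
    rw [B.part_eq_of_mem hc hx, B.part_eq_of_mem hc hy]
  · intro h b hb
    obtain ⟨x, hx⟩ := A.nonempty_of_mem_parts hb
    refine ⟨B.part x, B.part_mem.2 (Finset.mem_univ x), fun y hy => ?_⟩
    rw [mem_part_iff]
    apply h
    rw [A.part_eq_of_mem hb hx, A.part_eq_of_mem hb hy]

theorem setPart_ext {A B : SetPart n} (h : ∀ x y, A.part x = A.part y ↔ B.part x = B.part y) :
    A = B :=
  le_antisymm (setPart_le_iff.2 fun x y => (h x y).1) (setPart_le_iff.2 fun x y => (h x y).2)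

theorem ofSetoid_part_eq_iff (s : Setoid (Fin n)) [DecidableRel s.r] {x y : Fin n} :
    (Finpartition.ofSetoid s).part x = (Finpartition.ofSetoid s).part y ↔ s x y := by
  rw [← mem_part_iff, Finpartition.mem_part_ofSetoid_iff_rel]

/-- The set partition into the fibres of a map. -/
def kerPart {α : Type*} (f : Fin n → α) : SetPart n :=
  @Finpartition.ofSetoid (Fin n) _ _ (Setoid.ker f) (Classical.decRel _)

theorem kerPart_part_eq_iff {α : Type*} (f : Fin n → α) {x y : Fin n} :
    (kerPart f).part x = (kerPart f).part y ↔ f x = f y :=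
  @ofSetoid_part_eq_iff n (Setoid.ker f) (Classical.decRel _) x y

theorem bot_part_eq_iff {x y : Fin n} :
    (⊥ : SetPart n).part x = (⊥ : SetPart n).part y ↔ x = y := by
  constructor
  · intro h
    exact (setPart_le_iff.1 (bot_le : ⊥ ≤ kerPart (id : Fin n → Fin n)) x y h |>
      (kerPart_part_eq_iff _).1)
  · rintro rfl; rfl

/-- The finest set partition that is coarser than `A` and has `j`, `k` in the same block. -/
def joinPair (A : SetPart n) (j k : Fin n) : SetPart n :=
  kerPart fun x => if A.part x = A.part k then A.part j else A.part x

theorem joinPair_part_eq_iff (A : SetPart n) (j k x y : Fin n) :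
    (joinPair A j k).part x = (joinPair A j k).part y ↔ A.part x = A.part y ∨
      ((A.part x = A.part j ∨ A.part x = A.part k) ∧ (A.part y = A.part j ∨ A.part y = A.part k)) := by
  rw [joinPair, kerPart_part_eq_iff]
  grind

theorem joinPair_le_iff (A B : SetPart n) (j k : Fin n) :
    joinPair A j k ≤ B ↔ A ≤ B ∧ B.part j = B.part k := by
  simp only [setPart_le_iff, joinPair_part_eq_iff]
  constructor
  · intro h
    exact ⟨fun x y hxy => h x y (Or.inl hxy), h j k (Or.inr ⟨Or.inl rfl, Or.inr rfl⟩)⟩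
  · rintro ⟨h1, h2⟩ x y (h | ⟨h3 | h3, h4 | h4⟩)
    · exact h1 x y h
    · rw [h1 _ _ h3, h1 _ _ h4]
    · rw [h1 _ _ h3, h1 _ _ h4, h2]
    · rw [h1 _ _ h3, h1 _ _ h4, h2]
    · rw [h1 _ _ h3, h1 _ _ h4]

/-- The set partition whose blocks are the images of the blocks of `A` under `w`. -/
def permPart (A : SetPart n) (w : Equiv.Perm (Fin n)) : SetPart n := kerPart fun x => A.part (w.symm x)

theorem permPart_part_eq_iff (A : SetPart n) (w : Equiv.Perm (Fin n)) {x y : Fin n} :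
    (permPart A w).part x = (permPart A w).part y ↔
      A.part (w.symm x) = A.part (w.symm y) := kerPart_part_eq_iff _

theorem parts_permPart (A : SetPart n) (w : Equiv.Perm (Fin n)) :
    (permPart A w).parts = A.parts.map ⟨Finset.map w.toEmbedding, Finset.map_injective _⟩ := by
  have key : ∀ x, (permPart A w).part x = (A.part (w.symm x)).map w.toEmbedding := by
    intro x
    ext y
    rw [mem_part_iff, permPart_part_eq_iff, ← mem_part_iff]
    simp
  ext b
  simp only [Finset.mem_map, Function.Embedding.coeFn_mk]
  constructor
  · intro hb
    obtain ⟨x, hx⟩ := (permPart A w).nonempty_of_mem_parts hb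
    exact ⟨A.part (w.symm x), A.part_mem.2 (Finset.mem_univ _), by
      rw [← key, (permPart A w).part_eq_of_mem hb hx]⟩
  · rintro ⟨a, ha, rfl⟩
    obtain ⟨x, hx⟩ := A.nonempty_of_mem_parts ha
    rw [← A.part_eq_of_mem ha hx, show A.part x = A.part (w.symm (w x)) by simp, ← key]
    exact (permPart A w).part_mem.2 (Finset.mem_univ _)

theorem hasType_permPart {A : SetPart n} {w : Equiv.Perm (Fin n)} {α : n.Partition} :
    HasType (permPart A w) α ↔ HasType A α := by
  rw [HasType, HasType, parts_permPart, Finset.map_val, Multiset.map_map]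
  simp

end SetPartitions

/-! ### The orthogonal idempotents of set partitions and a spanning set of the algebra -/

section Idempotents

variable {R : Type*} [CommRing R] (q : Rˣ) {n : ℕ}

theorem mul_list_prod_eq_self {A : Type*} [Monoid A] {X : A} {l : List A}
    (h : ∀ a ∈ l, X * a = X) : X * l.prod = X := by
  induction l with
  | nil => simp
  | cons a l ih =>
    rw [List.prod_cons, ← mul_assoc, h a (by simp), ih fun b hb => h b (by simp [hb])]

theorem list_prod_mul_eq_self {A : Type*} [Monoid A] {l : List A} {a : A} (ha : a ∈ l)
    (hc : ∀ b ∈ l, Commute a b) (hi : a * a = a) : l.prod * a = l.prod := by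
  induction l with
  | nil => simp at ha
  | cons b l ih =>
    rw [List.prod_cons]
    by_cases h : a ∈ l
    · rw [mul_assoc, ih h fun c hc' => hc c (by simp [hc'])]
    · obtain rfl : a = b := by simpa [h] using ha
      have : Commute a l.prod := by
        apply Commute.list_prod_right
        exact fun c hc' => hc c (by simp [hc'])
      rw [mul_assoc, ← this.eq, ← mul_assoc, hi]

/-- The list of factors of `E_A`. -/
def tieList (A : SetPart n) : List (BT q n) :=
  (List.finRange n ×ˢ List.finRange n).map fun p =>
    if h : p.1 < p.2 ∧ p.2 ∈ A.part p.1 then tie q p.1 p.2 h.1 else 1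

theorem tieProd_eq (A : SetPart n) : tieProd q A = (tieList q A).prod := rfl

theorem mem_tieList {A : SetPart n} {a : BT q n} (h : a ∈ tieList q A) :
    ∃ x y, A.part x = A.part y ∧ a = tieS q x y := by
  rw [tieList, List.mem_map] at h
  obtain ⟨p, -, rfl⟩ := h
  by_cases h : p.1 < p.2 ∧ p.2 ∈ A.part p.1
  · exact ⟨p.1, p.2, (mem_part_iff A).1 h.2, by rw [dif_pos h, tieS, dif_pos h.1]⟩
  · exact ⟨p.1, p.1, rfl, by rw [dif_neg h, tieS_self]⟩

theorem tieS_mem_tieList {A : SetPart n} {x y : Fin n} (hxy : x < y)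
    (h : A.part x = A.part y) : tieS q x y ∈ tieList q A := by
  rw [tieList, List.mem_map]
  refine ⟨(x, y), by simp, ?_⟩
  rw [dif_pos ⟨hxy, (mem_part_iff A).2 h⟩, tieS, dif_pos hxy]

theorem mul_tieProd_eq_self {A : SetPart n} {X : BT q n}
    (h : ∀ x y, A.part x = A.part y → X * tieS q x y = X) : X * tieProd q A = X := by
  apply mul_list_prod_eq_self
  intro a ha
  obtain ⟨x, y, hxy, rfl⟩ := mem_tieList q ha
  exact h x y hxy

theorem tieS_commute_tieProd (A : SetPart n) (x y : Fin n) :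
    Commute (tieS q x y) (tieProd q A) := by
  apply Commute.list_prod_right
  intro a ha
  obtain ⟨z, t, -, rfl⟩ := mem_tieList q ha
  exact tieS_commute q x y z t

theorem tieProd_mul_tieS {A : SetPart n} {x y : Fin n} (h : A.part x = A.part y) :
    tieProd q A * tieS q x y = tieProd q A := by
  have key : ∀ x y, x < y → A.part x = A.part y → tieProd q A * tieS q x y = tieProd q A := by
    intro x y hxy h
    refine list_prod_mul_eq_self (tieS_mem_tieList q hxy h) (fun b hb => ?_) (tieS_idem q x y)
    obtain ⟨z, t, -, rfl⟩ := mem_tieList q hb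
    exact tieS_commute q x y z t
  rcases lt_trichotomy x y with hxy | rfl | hxy
  · exact key x y hxy h
  · rw [tieS_self, mul_one]
  · rw [tieS_comm]; exact key y x hxy h.symm

/-- Both sides are products of commuting ties that absorb each other. The left side absorbs every
tie inside a block of the join, because absorption is transitive along chains of labels
(`tieS_trans`). -/
theorem tieProd_mul_tieS_eq_joinPair (A : SetPart n) (j k : Fin n) :
    tieProd q A * tieS q j k = tieProd q (joinPair A j k) := by
  set C := joinPair A j k
  have hAC : A ≤ C := ((joinPair_le_iff A C j k).1 le_rfl).1
  have hjk : C.part j = C.part k := ((joinPair_le_iff A C j k).1 le_rfl).2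
  set X := tieProd q A * tieS q j k with hX
  have hcomm : ∀ x y, Commute X (tieS q x y) := fun x y =>
    ((tieS_commute_tieProd q A x y).symm).mul_left (tieS_commute q j k x y)
  have absorb : ∀ x y, A.part x = A.part y → X * tieS q x y = X := by
    intro x y h
    rw [hX, mul_assoc, (tieS_commute q j k x y).eq, ← mul_assoc, tieProd_mul_tieS q h]
  have abs_jk : X * tieS q j k = X := by rw [hX, mul_assoc, tieS_idem]
  have chain : ∀ x y z, X * tieS q x y = X → X * tieS q y z = X → X * tieS q x z = X := by
    intro x y z h1 h2
    have h3 : X * (tieS q x y * tieS q y z) = X := by rw [← mul_assoc, h1, h2]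
    rw [← h3, mul_assoc X, tieS_trans]
  have symm : ∀ x y, X * tieS q x y = X → X * tieS q y x = X := fun x y h => by rwa [tieS_comm]
  have hC : ∀ x y, C.part x = C.part y → X * tieS q x y = X := by
    intro x y h
    rw [joinPair_part_eq_iff] at h
    rcases h with h | ⟨h1, h2⟩
    · exact absorb x y h
    have toj : ∀ z, A.part z = A.part j ∨ A.part z = A.part k → X * tieS q z j = X := by
      rintro z (h | h)
      · exact absorb z j h
      · exact chain z k j (absorb z k h) (symm _ _ abs_jk)
    exact chain x j y (toj x h1) (symm _ _ (toj y h2))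
  have e1 : X * tieProd q C = X := mul_tieProd_eq_self q hC
  have e2 : tieProd q C * tieProd q A = tieProd q C :=
    mul_tieProd_eq_self q fun x y h => tieProd_mul_tieS q (setPart_le_iff.1 hAC x y h)
  have e3 : Commute X (tieProd q C) := by
    apply Commute.list_prod_right
    intro a ha
    obtain ⟨z, t, -, rfl⟩ := mem_tieList q ha
    exact hcomm z t
  rw [← e1, e3.eq, hX, ← mul_assoc, e2, tieProd_mul_tieS q hjk]

open Classical in
-- Möbius inversion: after exchanging the sums, the coefficient of each `tieProd q C` is the sum of
-- μ(B, C) over the interval from `A` to `C`.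
theorem sum_idem (A : SetPart n) : ∑ B : SetPart n with A ≤ B, idem q B = tieProd q A := by
  simp only [idem, Finset.sum_filter, zsmul_eq_mul]
  have h1 : ∀ B : SetPart n, (if A ≤ B then ∑ C : SetPart n, (if B ≤ C then
      (((IncidenceAlgebra.mu ℤ : IncidenceAlgebra ℤ (SetPart n)) B C : ℤ) : BT q n) *
        tieProd q C else 0) else 0) =
      ∑ C : SetPart n, ((if A ≤ B ∧ B ≤ C then
        (IncidenceAlgebra.mu ℤ : IncidenceAlgebra ℤ (SetPart n)) B C else 0 : ℤ) : BT q n) *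
        tieProd q C := by
    intro B
    split_ifs with h
    · refine Finset.sum_congr rfl fun C _ => ?_
      by_cases h' : B ≤ C <;> simp [h, h']
    · simp [h]
  rw [Finset.sum_congr rfl fun B _ => h1 B, Finset.sum_comm]
  simp only [← Finset.sum_mul, ← Int.cast_sum]
  have h2 : ∀ C : SetPart n, ∑ B : SetPart n, (if A ≤ B ∧ B ≤ C then
        (IncidenceAlgebra.mu ℤ : IncidenceAlgebra ℤ (SetPart n)) B C else 0) =
      if A = C then 1 else 0 := by
    intro C
    rw [← IncidenceAlgebra.sum_Icc_mu_left (𝕜 := ℤ) A C, ← Finset.sum_filter]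
    congr 1
    ext B; simp
  simp only [h2]
  simp

open Classical in
-- Induction from coarse to fine. If `x` and `y` lie in different blocks of `A`, then multiplying
-- `tieProd q A` by the tie leaves exactly the idempotents of the coarser partitions that join `x`
-- and `y`. By induction the idempotents strictly above `A` contribute the same sum, so nothing
-- remains for `A`.
theorem idem_mul_tieS (A : SetPart n) (x y : Fin n) :
    idem q A * tieS q x y = if A.part x = A.part y then idem q A else 0 := by
  split_ifs with h
  · rw [idem, Finset.sum_mul]
    refine Finset.sum_congr rfl fun B hB => ?_
    rw [smul_mul_assoc, tieProd_mul_tieS q (setPart_le_iff.1 (by simpa using hB) x y h)]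
  · induction A using WellFoundedGT.induction with
    | ind A ih =>
      have h1 : idem q A = tieProd q A - ∑ B : SetPart n with A < B, idem q B := by
        have hs : (Finset.univ.filter fun B : SetPart n => A ≤ B) =
            insert A (Finset.univ.filter fun B => A < B) := by
          ext B; simp [le_iff_eq_or_lt, eq_comm]
        rw [← sum_idem, hs, Finset.sum_insert (by simp)]
        abel
      rw [h1, sub_mul, tieProd_mul_tieS_eq_joinPair, ← sum_idem, Finset.sum_mul, sub_eq_zero]
      have h2 : ∀ B ∈ Finset.univ.filter (fun B : SetPart n => A < B),
          idem q B * tieS q x y = if B.part x = B.part y then idem q B else 0 := by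
        intro B hB
        split_ifs with hB'
        · rw [idem, Finset.sum_mul]
          refine Finset.sum_congr rfl fun C hC => ?_
          rw [smul_mul_assoc, tieProd_mul_tieS q (setPart_le_iff.1 (by simpa using hC) x y hB')]
        · exact ih B (by simpa using hB) hB'
      rw [Finset.sum_congr rfl h2, ← Finset.sum_filter, Finset.filter_filter]
      refine Finset.sum_congr ?_ fun _ _ => rfl
      ext B
      simp only [Finset.mem_filter, Finset.mem_univ, true_and, joinPair_le_iff]
      constructor
      · rintro ⟨h3, h4⟩
        exact ⟨lt_of_le_of_ne h3 (by rintro rfl; exact h h4), h4⟩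
      · rintro ⟨h3, h4⟩
        exact ⟨h3.le, h4⟩

/-- `X E_{x y}` is `X` or `0`, according to whether `x`, `y` are in the same block of `A`. -/
def HasChar (X : BT q n) (A : SetPart n) : Prop :=
  ∀ x y, (A.part x = A.part y → X * tieS q x y = X) ∧ (A.part x ≠ A.part y → X * tieS q x y = 0)

theorem idem_hasChar (A : SetPart n) : HasChar q (idem q A) A := fun x y =>
  ⟨fun h => by rw [idem_mul_tieS, if_pos h], fun h => by rw [idem_mul_tieS, if_neg h]⟩

variable {q}

/-- `HasChar` says that `X` is a joint eigenvector of the commuting idempotent ties; passing the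
ties through `gPerm` permutes their labels. -/
theorem HasChar.mul_gPerm {X : BT q n} {A : SetPart n} (h : HasChar q X A)
    (w : Equiv.Perm (Fin n)) : HasChar q (X * gPerm q w) (permPart A w) := by
  intro x y
  rw [mul_assoc, gPerm_mul_tieS, ← mul_assoc, ne_eq, permPart_part_eq_iff]
  exact ⟨fun h' => by rw [(h _ _).1 h'], fun h' => by rw [(h _ _).2 h', zero_mul]⟩

theorem HasChar.mul_g {X : BT q n} {A : SetPart n} (h : HasChar q X A)
    (i : Fin (n - 1)) : HasChar q (X * g q i) (permPart A (simple i)) := by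
  intro x y
  rw [mul_assoc, g_mul_tieS, ← mul_assoc, ne_eq, permPart_part_eq_iff, simple_symm]
  exact ⟨fun h' => by rw [(h _ _).1 h'], fun h' => by rw [(h _ _).2 h', zero_mul]⟩

theorem HasChar.mul_tieProd {X : BT q n} {A B : SetPart n} (h : HasChar q X A) :
    (B ≤ A → X * tieProd q B = X) ∧ (¬ B ≤ A → X * tieProd q B = 0) := by
  constructor
  · intro hBA
    exact mul_tieProd_eq_self q fun x y hxy => (h x y).1 (setPart_le_iff.1 hBA x y hxy)
  · intro hBA
    rw [setPart_le_iff] at hBA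
    push Not at hBA
    obtain ⟨x, y, h1, h2⟩ := hBA
    rw [← tieProd_mul_tieS q h1, ← (tieS_commute_tieProd q B x y).eq, ← mul_assoc, (h x y).2 h2,
      zero_mul]

/-- On `X` the product `tieProd q C` is 1 or 0 according to whether `C ≤ A`, so the defining sum
collapses to the sum of μ(B, C) over the interval from `B` to `A`. -/
theorem HasChar.mul_idem {X : BT q n} {A B : SetPart n} (h : HasChar q X A) :
    (B = A → X * idem q B = X) ∧ (B ≠ A → X * idem q B = 0) := by
  classical
  have h1 : X * idem q B = ((if B = A then 1 else 0 : ℤ) : BT q n) * X := by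
    rw [idem, Finset.mul_sum, ← IncidenceAlgebra.sum_Icc_mu_right (𝕜 := ℤ) B A, Int.cast_sum,
      Finset.sum_mul, Finset.sum_filter, ← Finset.sum_subset (Finset.subset_univ (Finset.Icc B A))]
    · refine Finset.sum_congr rfl fun C hC => ?_
      rw [Finset.mem_Icc] at hC
      rw [if_pos hC.1, mul_smul_comm, h.mul_tieProd.1 hC.2, zsmul_eq_mul]
    · intro C _ hC
      rw [Finset.mem_Icc, not_and] at hC
      split_ifs with h2
      · rw [mul_smul_comm, h.mul_tieProd.2 (hC h2), zsmul_zero]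
      · rfl
  rw [h1]
  constructor <;> intro h2 <;> simp [h2]

variable (q)

theorem sum_idem_univ : ∑ A : SetPart n, idem q A = 1 := by
  classical
  have h1 := sum_idem q (⊥ : SetPart n)
  simp only [bot_le, Finset.filter_true] at h1
  rw [h1, tieProd_eq]
  apply List.prod_eq_one
  intro a ha
  obtain ⟨x, y, h, rfl⟩ := mem_tieList q ha
  rw [bot_part_eq_iff] at h
  rw [h, tieS_self]

variable {q}

open Classical in
theorem HasChar.mul_idemType {X : BT q n} {A : SetPart n} (h : HasChar q X A) (α : n.Partition) :
    X * idemType q α = if HasType A α then X else 0 := by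
  rw [idemType, Finset.mul_sum, Finset.sum_filter]
  have h1 : ∀ B, (if HasType B α then X * idem q B else 0) =
      if B = A then (if HasType A α then X else 0) else 0 := by
    intro B
    by_cases hB : B = A
    · subst hB; simp [h.mul_idem.1 rfl]
    · simp [hB, h.mul_idem.2 hB]
  rw [Finset.sum_congr rfl fun B _ => h1 B]
  simp

variable (q)

/-- Multiplying by a generator permutes the labels of the set partition and hence preserves its
type; inserting the decomposition of 1 into the idempotents turns this into centrality. -/
theorem idemType_mul_g (α : n.Partition) (i : Fin (n - 1)) :
    idemType q α * g q i = g q i * idemType q α := by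
  classical
  have h1 : ∀ A : SetPart n, idem q A * g q i * idemType q α =
      if HasType A α then idem q A * g q i else 0 := by
    intro A
    rw [((idem_hasChar q A).mul_g i).mul_idemType]
    simp only [hasType_permPart]
  conv_rhs => rw [← one_mul (g q i), ← sum_idem_univ, Finset.sum_mul, Finset.sum_mul]
  rw [Finset.sum_congr rfl fun A _ => h1 A, idemType, Finset.sum_mul, Finset.sum_filter]

theorem idemType_mul_gPerm (α : n.Partition) (w : Equiv.Perm (Fin n)) :
    idemType q α * gPerm q w = gPerm q w * idemType q α := by
  induction w using perm_induction with
  | one => rw [gPerm_refl, one_mul, mul_one]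
  | step w i h ih =>
    rw [gPerm_trans_simple q h, ← mul_assoc, ih, mul_assoc, idemType_mul_g, mul_assoc]

theorem idemType_mul_idem {α : n.Partition} {A : SetPart n} (h : HasType A α) :
    idemType q α * idem q A = idem q A := by
  classical
  rw [idemType, Finset.sum_mul, Finset.sum_eq_single_of_mem A (by simpa using h)]
  · exact ((idem_hasChar q A).mul_idem).1 rfl
  · intro B _ hB
    exact ((idem_hasChar q B).mul_idem).2 hB.symm

theorem bt_induction {P : BT q n → Prop} (scalar : ∀ c : R, P (algebraMap R _ c))
    (hg : ∀ i, P (g q i)) (he : ∀ i, P (e q i)) (add : ∀ a b, P a → P b → P (a + b))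
    (mul : ∀ a b, P a → P b → P (a * b)) (x : BT q n) : P x := by
  obtain ⟨y, rfl⟩ := RingQuot.mkAlgHom_surjective R (Rel q n) x
  induction y using FreeAlgebra.induction with
  | grade0 c => rw [AlgHom.commutes]; exact scalar c
  | grade1 x => cases x with
    | g i => exact hg i
    | e i => exact he i
  | mul a b ha hb => rw [map_mul]; exact mul _ _ ha hb
  | add a b ha hb => rw [map_add]; exact add _ _ ha hb

/-- The span contains 1 and is stable under right multiplication by the generators: an `e_i` acts on
each spanning element by 0 or 1, and at a descent the quadratic relation produces a shorter element
and a multiple of an old one. -/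
theorem mem_span_idem_mul_gPerm (x : BT q n) :
    x ∈ Submodule.span R
      (Set.range fun p : SetPart n × Equiv.Perm (Fin n) => idem q p.1 * gPerm q p.2) := by
  set N := Submodule.span R
      (Set.range fun p : SetPart n × Equiv.Perm (Fin n) => idem q p.1 * gPerm q p.2)
  have hmem : ∀ A w, idem q A * gPerm q w ∈ N := fun A w => Submodule.subset_span ⟨(A, w), rfl⟩
  have he : ∀ (A : SetPart n) w i, idem q A * gPerm q w * e q i = idem q A * gPerm q w ∨
      idem q A * gPerm q w * e q i = 0 := by
    intro A w i
    rw [← tieS_lo_hi]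
    have h := ((idem_hasChar q A).mul_gPerm w) (lo i) (hi i)
    by_cases h' : (permPart A w).part (lo i) = (permPart A w).part (hi i)
    · exact Or.inl (h.1 h')
    · exact Or.inr (h.2 h')
  have ext : ∀ z : BT q n, (∀ A w, idem q A * gPerm q w * z ∈ N) → ∀ y ∈ N, y * z ∈ N := by
    intro z hz y hy
    induction hy using Submodule.span_induction with
    | mem y hy => obtain ⟨p, rfl⟩ := hy; exact hz _ _
    | zero => rw [zero_mul]; exact zero_mem _
    | add a b _ _ ha hb => rw [add_mul]; exact add_mem ha hb
    | smul c a _ ha => rw [smul_mul_assoc]; exact Submodule.smul_mem _ _ ha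
  have hone : (1 : BT q n) ∈ N := by
    rw [← sum_idem_univ]
    refine Submodule.sum_mem _ fun A _ => ?_
    have := hmem A (Equiv.refl _)
    rwa [gPerm_refl, mul_one] at this
  suffices ∀ y ∈ N, y * x ∈ N by simpa using this 1 hone
  induction x using bt_induction with
  | scalar c =>
    intro y hy
    rw [← Algebra.commutes, ← Algebra.smul_def]
    exact Submodule.smul_mem _ _ hy
  | he i =>
    refine ext _ fun A w => ?_
    rcases he A w i with h | h <;> rw [h]
    · exact hmem A w
    · exact zero_mem _
  | hg i =>
    refine ext _ fun A w => ?_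
    rcases ascent_or_descent w i with h | h
    · rw [mul_assoc, ← gPerm_trans_simple q h]; exact hmem _ _
    · have h1 := gPerm_trans_simple q (w := w.trans (simple i)) (i := i)
        (by simpa [simple_lo, simple_hi] using h)
      rw [trans_simple_simple] at h1
      rw [h1, mul_assoc, mul_assoc, ← pow_two, (satisfies_gens q).g_sq, mul_add, mul_add, mul_one,
        ← mul_assoc, mul_smul_comm, ← mul_assoc (idem q A * _)]
      refine add_mem (hmem _ _) (Submodule.smul_mem _ _ ?_)
      rcases he A (w.trans (simple i)) i with h2 | h2
      · rw [h2, mul_assoc, ← h1]; exact hmem _ _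
      · rw [h2, zero_mul]; exact zero_mem _
  | add a b ha hb =>
    intro y hy; rw [mul_add]; exact add_mem (ha y hy) (hb y hy)
  | mul a b ha hb =>
    intro y hy; rw [← mul_assoc]; exact hb _ (ha y hy)

theorem mem_btType_iff {α : n.Partition} {x : BT q n} :
    x ∈ btType q α ↔ idemType q α * x = x := by
  constructor
  · rintro ⟨y, rfl⟩
    have h : idemType q α * idemType q α = idemType q α := by
      classical
      conv_lhs => rhs; rw [idemType]
      rw [Finset.mul_sum]
      conv_rhs => rw [idemType]
      exact Finset.sum_congr rfl fun A hA => idemType_mul_idem q (by simpa using hA)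
    simp only [LinearMap.mulLeft_apply]
    rw [← mul_assoc, h]
  · intro h
    exact ⟨x, h⟩

theorem mem_span_of_mem_btType {α : n.Partition} {x : BT q n} (hx : x ∈ btType q α) :
    x ∈ Submodule.span R (Set.range fun p : {A : SetPart n // HasType A α} × Equiv.Perm (Fin n) =>
      idem q p.1.1 * gPerm q p.2) := by
  rw [mem_btType_iff] at hx
  rw [← hx]
  clear hx
  induction mem_span_idem_mul_gPerm q x using Submodule.span_induction with
  | mem y hy =>
    obtain ⟨⟨A, w⟩, rfl⟩ := hy
    by_cases hA : HasType A α
    · simp only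
      rw [← mul_assoc, idemType_mul_idem q hA]
      exact Submodule.subset_span ⟨(⟨A, hA⟩, w), rfl⟩
    · have : idemType q α * idem q A = 0 := by
        classical
        rw [idemType, Finset.sum_mul]
        refine Finset.sum_eq_zero fun B hB => ((idem_hasChar q B).mul_idem).2 ?_
        rintro rfl
        exact hA (by simpa using hB)
      simp only
      rw [← mul_assoc, this, zero_mul]
      exact zero_mem _
  | zero => rw [mul_zero]; exact zero_mem _
  | add a b _ _ ha hb => rw [mul_add]; exact add_mem ha hb
  | smul c a _ ha => rw [mul_smul_comm]; exact Submodule.smul_mem _ _ ha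

theorem idem_mul_gPerm_mem_btType {α : n.Partition} {A : SetPart n} (hA : HasType A α)
    (x y : BT q n) (hx : idemType q α * x = x * idemType q α) :
    x * idem q A * y ∈ btType q α := by
  rw [mem_btType_iff, ← mul_assoc, ← mul_assoc, hx, mul_assoc x, idemType_mul_idem q hA]

end Idempotents

/-! ### The matrices of the action on the tensor space -/

section Matrices

variable {R : Type*} [CommRing R] (q : Rˣ) {n : ℕ} (N r : ℕ)

/-- The matrix of the action of an element, whose rows are the images of the basis vectors. -/
def rho : BT q n →ₐ[R] Matrix (Fin n → Fin N × Fin r) (Fin n → Fin N × Fin r) R where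
  toFun x := (LinearMap.toMatrixAlgEquiv (tensBasis R n N r) (rightAct q n N r x).unop).transpose
  map_one' := by simp
  map_mul' x y := by simp
  map_zero' := by simp
  map_add' x y := by simp
  commutes' c := by
    rw [AlgHom.commutes, MulOpposite.algebraMap_apply, MulOpposite.unop_op, AlgEquiv.commutes,
      Algebra.algebraMap_eq_smul_one, Matrix.transpose_smul, Matrix.transpose_one]

theorem rho_apply (x : BT q n) (f f' : Fin n → Fin N × Fin r) :
    rho q N r x f f' = (tensBasis R n N r).repr (act q (tensBasis R n N r f) x) f' := by
  change LinearMap.toMatrixAlgEquiv _ _ f' f = _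
  rw [LinearMap.toMatrixAlgEquiv_apply]
  rfl

theorem act_eq_zero_of_rho {x : BT q n} (h : rho q N r x = 0) (v : Tens R n N r) :
    act q v x = 0 := by
  have : (rightAct q n N r x).unop = 0 := by
    refine (tensBasis R n N r).ext fun f => ?_
    apply (tensBasis R n N r).repr.injective
    ext f'
    have := rho_apply q N r x f f'
    rw [h] at this
    rw [← act, ← this]
    simp
  rw [act, this]; rfl

/-- An element of the ideal equals its product with the idempotent on the left, so killing the image
of the idempotent is the same as killing the whole tensor space. -/
theorem mem_annIdeal_iff {α : n.Partition} {x : BT q n} :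
    x ∈ annIdeal q N r α ↔ x ∈ btType q α ∧ rho q N r x = 0 := by
  constructor
  · rintro ⟨h1, h2⟩
    refine ⟨h1, ?_⟩
    ext f f'
    rw [rho_apply]
    have h3 : act q (tensBasis R n N r f) x = 0 := by
      rw [mem_btType_iff] at h1
      conv_lhs => rw [← h1]
      have h4 := h2 (act q (tensBasis R n N r f) (idemType q α)) ⟨tensBasis R n N r f, rfl⟩
      simpa [act] using h4
    rw [h3]; simp
  · rintro ⟨h1, h2⟩
    exact ⟨h1, fun v _ => act_eq_zero_of_rho q N r h2 v⟩

variable {N r}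

theorem rho_g (i : Fin (n - 1)) (f f' : Fin n → Fin N × Fin r) :
    rho q N r (g q i) f f' = cG q (f (lo i)) (f (hi i)) * (if f' = f then 1 else 0) +
      dG R (f (lo i)) (f (hi i)) * (if f' = f ∘ simple i then 1 else 0) := by
  rw [rho_apply, act, rightAct, lift_g, MulOpposite.unop_op, opG_basis]
  simp [Finsupp.single_apply, eq_comm]

theorem rho_e (i : Fin (n - 1)) (f f' : Fin n → Fin N × Fin r) :
    rho q N r (e q i) f f' = (if (f (lo i)).2 = (f (hi i)).2 then (1 : R) else 0) *
      (if f' = f then 1 else 0) := by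
  rw [rho_apply, act, rightAct, lift_e, MulOpposite.unop_op, opE_basis, map_smul,
    Finsupp.smul_apply, Module.Basis.repr_self, Finsupp.single_apply, smul_eq_mul]
  simp only [eq_comm]

theorem rho_mul_apply (x y : BT q n) (f f' : Fin n → Fin N × Fin r) :
    rho q N r (x * y) f f' = ∑ k, rho q N r x f k * rho q N r y k f' := by
  rw [map_mul, Matrix.mul_apply]

theorem rho_mul_of_row {x : BT q n} {f k : Fin n → Fin N × Fin r}
    (h : rho q N r x f = Pi.single k 1) (y : BT q n) : rho q N r (x * y) f = rho q N r y k := by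
  funext f'
  rw [rho_mul_apply, h]
  simp [Pi.single_apply]

theorem rho_mul_of_row_zero {x : BT q n} {f : Fin n → Fin N × Fin r}
    (h : rho q N r x f = 0) (y : BT q n) : rho q N r (x * y) f = 0 := by
  funext f'
  rw [rho_mul_apply, h]
  simp

theorem rho_one_row (f : Fin n → Fin N × Fin r) : rho q N r 1 f = Pi.single f 1 := by
  funext f'
  rw [map_one, Matrix.one_apply, Pi.single_apply]
  simp [eq_comm]

theorem dG_comm (a b : Fin N × Fin r) : dG R a b = dG R b a := by
  unfold dG
  split_ifs <;> simp_all

theorem rho_algebraMap (c : R) (f f' : Fin n → Fin N × Fin r) :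
    rho q N r (algebraMap R _ c) f f' = if f = f' then c else 0 := by
  rw [AlgHom.commutes, Matrix.algebraMap_matrix_apply]; rfl

theorem st_add (a b : BT q n) : st q (a + b) = st q a + st q b := by simp [st]

theorem st_algebraMap (c : R) : st q (algebraMap R (BT q n) c) = algebraMap R (BT q n) c := by
  rw [st, AlgHom.commutes, MulOpposite.algebraMap_apply, MulOpposite.unop_op]

/-- The anti-involution is the transposition. -/
theorem rho_st (x : BT q n) (f f' : Fin n → Fin N × Fin r) :
    rho q N r (st q x) f f' = rho q N r x f' f := by
  -- The generators act by symmetric matrices, and both transposition and the anti-involution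
  -- reverse products.
  induction x using bt_induction generalizing f f' with
  | scalar c => rw [st_algebraMap, rho_algebraMap, rho_algebraMap]; simp [eq_comm]
  | hg i =>
    rw [st_g, rho_g, rho_g]
    congr 1
    · by_cases h : f' = f
      · subst h; rfl
      · simp [h, Ne.symm h]
    · by_cases h : f' = f ∘ simple i
      · subst h
        simp only [comp_simple_simple, if_true, Function.comp_apply, simple_lo, simple_hi]
        rw [dG_comm]
      · rw [if_neg h, if_neg, mul_zero, mul_zero]
        rintro rfl
        exact h (comp_simple_simple i f').symm
  | he i =>
    rw [st_e, rho_e, rho_e]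
    by_cases h : f' = f
    · subst h; rfl
    · simp [h, Ne.symm h]
  | add a b ha hb => rw [st_add, map_add, map_add, Matrix.add_apply, Matrix.add_apply, ha, hb]
  | mul a b ha hb =>
    rw [st_mul, rho_mul_apply, rho_mul_apply]
    exact Finset.sum_congr rfl fun k _ => by rw [ha, hb, mul_comm]

/-- A permutation of the colours. -/
def recolour {X : Type*} (τ : Equiv.Perm (Fin r)) (f : X → Fin N × Fin r) : X → Fin N × Fin r :=
  fun x => ((f x).1, τ (f x).2)

theorem recolour_injective {X : Type*} (τ : Equiv.Perm (Fin r)) :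
    Function.Injective (recolour (N := N) (X := X) τ) := by
  intro f f' h
  funext x
  have := congrFun h x
  simp only [recolour, Prod.mk.injEq, EmbeddingLike.apply_eq_iff_eq] at this
  exact Prod.ext this.1 this.2

theorem recolour_symm_recolour {X : Type*} (τ : Equiv.Perm (Fin r)) (f : X → Fin N × Fin r) :
    recolour τ (recolour τ.symm f) = f := by
  funext x; simp [recolour]

/-- The coefficients of the operators depend on the colours only through equality of colours. -/
theorem rho_recolour (τ : Equiv.Perm (Fin r)) (x : BT q n) (f f' : Fin n → Fin N × Fin r) :
    rho q N r x (recolour τ f) (recolour τ f') = rho q N r x f f' := by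
  have hc : ∀ (a b : Fin N × Fin r), cG q (a.1, τ a.2) (b.1, τ b.2) = cG q a b := by
    intro a b; simp [cG]
  have hd : ∀ (a b : Fin N × Fin r), dG R (a.1, τ a.2) (b.1, τ b.2) = dG R a b := by
    intro a b; simp [dG]
  have he := recolour_injective (N := N) (X := Fin n) τ
  induction x using bt_induction generalizing f f' with
  | scalar c => simp only [rho_algebraMap, he.eq_iff]
  | hg i =>
    rw [rho_g, rho_g]
    have h1 : recolour τ f ∘ simple i = recolour τ (f ∘ simple i) := rfl
    rw [h1]
    simp only [he.eq_iff]
    simp only [recolour, hc, hd]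
  | he i =>
    rw [rho_e, rho_e]
    simp only [he.eq_iff]
    simp only [recolour, EmbeddingLike.apply_eq_iff_eq]
  | add a b ha hb => simp only [map_add, Matrix.add_apply, ha, hb]
  | mul a b ha hb =>
    rw [rho_mul_apply, rho_mul_apply]
    refine (Fintype.sum_bijective (recolour τ) ⟨he, fun f => ⟨_, recolour_symm_recolour τ f⟩⟩ _ _
      fun k => ?_).symm
    rw [ha, hb]

/-- The action only rearranges tensor factors, so it preserves content. Applied to the sequences of
tableaux, this is what compares shapes. -/
theorem exists_perm_of_rho_ne_zero {x : BT q n} {f f' : Fin n → Fin N × Fin r}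
    (h : rho q N r x f f' ≠ 0) : ∃ σ : Equiv.Perm (Fin n), f' = f ∘ σ := by
  induction x using bt_induction generalizing f f' with
  | scalar c =>
    rw [rho_algebraMap] at h
    exact ⟨Equiv.refl _, by by_contra h'; exact h (if_neg fun h'' => h' h''.symm)⟩
  | hg i =>
    rw [rho_g] at h
    by_cases h1 : f' = f
    · exact ⟨Equiv.refl _, h1⟩
    by_cases h2 : f' = f ∘ simple i
    · exact ⟨_, h2⟩
    · simp [h1, h2] at h
  | he i =>
    rw [rho_e] at h
    by_cases h1 : f' = f
    · exact ⟨Equiv.refl _, h1⟩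
    · simp [h1] at h
  | add a b ha hb =>
    rw [map_add, Matrix.add_apply] at h
    by_cases h1 : rho q N r a f f' = 0
    · exact hb (by simpa [h1] using h)
    · exact ha h1
  | mul a b ha hb =>
    rw [rho_mul_apply] at h
    obtain ⟨k, -, hk⟩ := Finset.exists_ne_zero_of_sum_ne_zero h
    obtain ⟨σ, rfl⟩ := ha (left_ne_zero_of_mul hk)
    obtain ⟨σ', rfl⟩ := hb (right_ne_zero_of_mul hk)
    exact ⟨σ'.trans σ, rfl⟩

/-- The diagonal part of the operator occurs only for two equal neighbouring colours, and then the
swap does not change the sequence of colours. -/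
theorem rho_g_mul_tie (i : Fin (n - 1)) (x y : Fin n) (f f' : Fin n → Fin N × Fin r) :
    rho q N r (g q i) f f' * (if (f' x).2 = (f' y).2 then 1 else 0) =
      (if (f (simple i x)).2 = (f (simple i y)).2 then 1 else 0) * rho q N r (g q i) f f' := by
  rw [rho_g]
  by_cases h2 : f' = f ∘ simple i
  · subst h2
    simp only [Function.comp_apply]
    ring
  by_cases h1 : f' = f
  · subst h1
    by_cases h3 : (f' (lo i)).2 = (f' (hi i)).2
    · have h4 : ∀ z, (f' (simple i z)).2 = (f' z).2 := by
        intro z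
        by_cases hz : z = lo i
        · subst hz; rw [simple_lo, h3]
        by_cases hz' : z = hi i
        · subst hz'; rw [simple_hi, h3]
        · rw [simple_of_ne i z hz hz']
      rw [h4, h4]; ring
    · simp [cG, h3, h2]
  · simp [h1, h2]

/-- By `rho_g_mul_tie` the test for equal colours can be moved in front of the generator, after
which the generator cancels against its inverse. -/
theorem rho_tieAux (k : ℕ) : ∀ (i : ℕ) (h : i + k + 1 < n) (f : Fin n → Fin N × Fin r),
    rho q N r (tieAux q k i h) f =
      Pi.single f (if (f ⟨i, by omega⟩).2 = (f ⟨i + k + 1, h⟩).2 then 1 else 0) := by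
  induction k with
  | zero =>
    intro i h f
    funext f'
    have := rho_e q ⟨i, by omega⟩ f f'
    rw [Pi.single_apply]
    refine this.trans ?_
    rw [ite_mul, mul_comm]
    simp only [lo, hi, mul_one, zero_mul]
    split_ifs <;> rfl
  | succ k ih =>
    intro i h f
    have hs : ∀ x : Fin n, (x : ℕ) = i + 1 → simple (⟨i, by omega⟩ : Fin (n - 1)) x =
        ⟨i, by omega⟩ := by
      intro x hx; apply Fin.ext; rw [simple_val]; simp [hx]
    have hs' : ∀ x : Fin n, (x : ℕ) = i + (k + 1) + 1 → simple (⟨i, by omega⟩ : Fin (n - 1)) x =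
        ⟨i + (k + 1) + 1, h⟩ := by
      intro x hx; apply Fin.ext; rw [simple_val]; simp only [hx]; split_ifs <;> omega
    have key : ∀ f f' : Fin n → Fin N × Fin r, rho q N r (g q ⟨i, by omega⟩ *
        tieAux q k (i + 1) (by omega)) f f' = (if (f ⟨i, by omega⟩).2 =
          (f ⟨i + (k + 1) + 1, h⟩).2 then 1 else 0) * rho q N r (g q ⟨i, by omega⟩) f f' := by
      intro f f'
      rw [rho_mul_apply]
      simp only [ih (i + 1) (by omega), Pi.single_apply, mul_ite, mul_zero]
      rw [Finset.sum_ite_eq, if_pos (Finset.mem_univ _)]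
      have := rho_g_mul_tie q ⟨i, by omega⟩ ⟨i + 1, by omega⟩ ⟨i + 1 + k + 1, by omega⟩ f f'
      rw [hs _ rfl, hs' _ (by simp only; omega)] at this
      rw [← this, mul_ite, mul_zero]
    funext f'
    rw [tieAux, rho_mul_apply]
    simp only [key, mul_assoc]
    rw [← Finset.mul_sum, ← rho_mul_apply, (g_mul_gInv q _).1, rho_one_row, Pi.single_apply,
      Pi.single_apply]
    split_ifs <;> simp

theorem rho_tieS (x y : Fin n) (f : Fin n → Fin N × Fin r) :
    rho q N r (tieS q x y) f = Pi.single f (if (f x).2 = (f y).2 then 1 else 0) := by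
  have key : ∀ x y : Fin n, x < y → rho q N r (tieS q x y) f =
      Pi.single f (if (f x).2 = (f y).2 then 1 else 0) := by
    intro x y h
    have hy : (y : ℕ) = x + (y - x - 1) + 1 := by simp only [Fin.lt_def] at h; omega
    rw [tieS_eq_tieAux q (y - x - 1) x (by omega) x y rfl hy, rho_tieAux]
    simp only [← hy]
  rcases lt_trichotomy x y with h | h | h
  · exact key x y h
  · subst h; rw [tieS_self, rho_one_row, if_pos rfl]
  · rw [tieS_comm, key y x h]; simp only [eq_comm]

/-- The set partition given by the colours. -/
def colourPart (f : Fin n → Fin N × Fin r) : SetPart n := kerPart fun x => (f x).2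

open Classical in
theorem rho_tieProd (A : SetPart n) (f : Fin n → Fin N × Fin r) :
    rho q N r (tieProd q A) f = Pi.single f (if A ≤ colourPart f then 1 else 0) := by
  split_ifs with h
  · have key : ∀ l : List (BT q n), (∀ a ∈ l, rho q N r a f = Pi.single f 1) →
        rho q N r l.prod f = Pi.single f 1 := by
      intro l hl
      induction l with
      | nil => exact rho_one_row q f
      | cons a l ih =>
        rw [List.prod_cons, rho_mul_of_row q (hl a (by simp)), ih fun b hb => hl b (by simp [hb])]
    apply key
    intro a ha
    obtain ⟨x, y, hxy, rfl⟩ := mem_tieList q ha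
    rw [rho_tieS, if_pos]
    exact (kerPart_part_eq_iff _).1 (setPart_le_iff.1 h x y hxy)
  · rw [setPart_le_iff] at h
    push Not at h
    obtain ⟨x, y, h1, h2⟩ := h
    rw [← tieProd_mul_tieS q h1, ← (tieS_commute_tieProd q A x y).eq, rho_mul_of_row_zero]
    · simp
    · rw [rho_tieS, if_neg, Pi.single_zero]
      rwa [colourPart, Ne, kerPart_part_eq_iff] at h2

open Classical in
-- A basis vector is fixed by `tieProd q B` if `B` refines its partition into colours and is killed
-- otherwise; the Möbius sum singles out equality.
theorem rho_idem (A : SetPart n) (f : Fin n → Fin N × Fin r) :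
    rho q N r (idem q A) f = Pi.single f (if A = colourPart f then 1 else 0) := by
  funext f'
  have h1 : ∀ B : SetPart n, rho q N r (((IncidenceAlgebra.mu ℤ : IncidenceAlgebra ℤ (SetPart n)) A B
      : ℤ) • tieProd q B) f f' = (if B ≤ colourPart f then
        (((IncidenceAlgebra.mu ℤ : IncidenceAlgebra ℤ (SetPart n)) A B : ℤ) : R) else 0) *
        (if f' = f then 1 else 0) := by
    intro B
    rw [map_zsmul, Matrix.smul_apply, rho_tieProd, Pi.single_apply]
    split_ifs <;> simp
  rw [idem, map_sum, Matrix.sum_apply, Finset.sum_congr rfl fun B _ => h1 B, ← Finset.sum_mul,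
    ← Finset.sum_filter, Finset.filter_filter]
  have h2 : (Finset.univ.filter fun B : SetPart n => A ≤ B ∧ B ≤ colourPart f) =
      Finset.Icc A (colourPart f) := by ext B; simp
  rw [h2, ← Int.cast_sum, IncidenceAlgebra.sum_Icc_mu_right, Pi.single_apply]
  split_ifs <;> simp

/-- If the inversions of `w` only affect different colours or increasing values, then `g_w`
acts by permuting the factors. -/
theorem rho_gPerm_of_inversions (w : Equiv.Perm (Fin n)) (f : Fin n → Fin N × Fin r)
    (h : ∀ x y, x < y → w y < w x → (f x).2 ≠ (f y).2 ∨ (f x).1 < (f y).1) :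
    rho q N r (gPerm q w) f = Pi.single (f ∘ w.symm) 1 := by
  induction w using perm_induction with
  | one => rw [gPerm_refl, rho_one_row]; rfl
  | step w i hi' ih =>
    have hinv := inversions_trans_simple hi'
    have h1 : ∀ p ∈ inversions (w.trans (simple i)),
        (f p.1).2 ≠ (f p.2).2 ∨ (f p.1).1 < (f p.2).1 := by
      intro p hp
      rw [mem_inversions] at hp
      exact h p.1 p.2 hp.1 hp.2
    rw [hinv] at h1
    have h2 := h1 _ (Finset.mem_insert_self _ _)
    rw [gPerm_trans_simple q hi', rho_mul_of_row q (ih fun x y hx hy => h1 (x, y)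
      (Finset.mem_insert_of_mem (mem_inversions.2 ⟨hx, hy⟩)))]
    funext f'
    have h3 : cG q (f (w.symm (lo i))) (f (w.symm (hi i))) = 0 := by
      unfold cG
      rcases h2 with h2 | h2
      · rw [if_pos h2]
      · split_ifs with h4 h5
        · rfl
        · exact absurd h5 h2.ne
        · rfl
    have h4 : dG R (f (w.symm (lo i))) (f (w.symm (hi i))) = 1 := by
      unfold dG
      rcases h2 with h2 | h2
      · rw [if_pos h2]
      · split_ifs with h4 h5
        · rfl
        · exact absurd h5 h2.ne
        · rfl
    rw [rho_g, Function.comp_apply, Function.comp_apply, h3, h4, Pi.single_apply]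
    simp only [zero_mul, zero_add, one_mul]
    rfl

end Matrices

/-! ### The antisymmetriser of a multipartition -/

section Antisymmetriser

theorem Node.lt_iff {k : ℕ} {lam : Fin k → YoungDiagram} (x y : Node lam) :
    x < y ↔ x.comp < y.comp ∨ (x.comp = y.comp ∧ (x.row < y.row ∨ (x.row = y.row ∧ x.col < y.col))) := by
  change (toLex (x.comp, toLex (x.row, x.col)) : Fin k ×ₗ ℕ ×ₗ ℕ) <
    toLex (y.comp, toLex (y.row, y.col)) ↔ _
  rw [Prod.Lex.toLex_lt_toLex, Prod.Lex.toLex_lt_toLex]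

theorem Node.ext' {k : ℕ} {lam : Fin k → YoungDiagram} {x y : Node lam} (h1 : x.comp = y.comp)
    (h2 : x.row = y.row) (h3 : x.col = y.col) : x = y :=
  Subtype.ext (Prod.ext h1 (Prod.ext h2 h3))

theorem Node.mem {k : ℕ} {lam : Fin k → YoungDiagram} (x : Node lam) :
    (x.row, x.col) ∈ lam x.comp := x.2

variable {k n : ℕ} {lam : Fin k → YoungDiagram} (h : ∑ i, (lam i).card = n)

theorem initTab_lt_iff {x y : Fin n} : initTab h x < initTab h y ↔ x < y :=
  (Fintype.orderIsoFinOfCardEq (Node lam) ((Node.card_eq lam).trans h)).lt_iff_lt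

theorem eq_initTab_of_strictMono {t : Fin n ≃ Node lam} (ht : StrictMono t) : t = initTab h := by
  have : ht.orderIsoOfSurjective t t.surjective =
      Fintype.orderIsoFinOfCardEq (Node lam) ((Node.card_eq lam).trans h) := Subsingleton.elim _ _
  ext x
  exact congrArg (fun e : Fin n ≃o Node lam => e x) this

/-- The component and the row of a label in `𝔱^λ`. -/
def rowKey (x : Fin n) : Fin k × ℕ := ((initTab h x).comp, (initTab h x).row)

theorem comp_eq_of_rowKey_eq {x y : Fin n} (hxy : rowKey h x = rowKey h y) :
    (initTab h x).comp = (initTab h y).comp := (Prod.ext_iff.1 hxy).1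

theorem mem_young {w : Equiv.Perm (Fin n)} : w ∈ young h ↔ ∀ x, rowKey h (w x) = rowKey h x := by
  simp [young, rowKey, Prod.ext_iff]

theorem refl_mem_young : Equiv.refl _ ∈ young h := by simp [mem_young]

theorem trans_mem_young {v w : Equiv.Perm (Fin n)} (hv : v ∈ young h) (hw : w ∈ young h) :
    v.trans w ∈ young h := by
  rw [mem_young] at *
  intro x
  rw [Equiv.trans_apply, hw, hv]

theorem symm_mem_young {w : Equiv.Perm (Fin n)} (hw : w ∈ young h) : w.symm ∈ young h := by
  rw [mem_young] at *
  intro x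
  rw [← hw (w.symm x), Equiv.apply_symm_apply]

theorem rowKey_of_between {x y z : Fin n} (hxy : x ≤ y) (hyz : y ≤ z)
    (hxz : rowKey h x = rowKey h z) : rowKey h y = rowKey h x := by
  rcases hxy.eq_or_lt with rfl | hxy
  · rfl
  rcases hyz.eq_or_lt with rfl | hyz
  · exact hxz.symm
  rw [← initTab_lt_iff h, Node.lt_iff] at hxy hyz
  simp only [rowKey, Prod.mk.injEq] at hxz ⊢
  have h1 : (initTab h y).comp = (initTab h x).comp := by
    apply le_antisymm
    · rw [hxz.1]; rcases hyz with h2 | h2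
      · exact h2.le
      · exact h2.1.le
    · rcases hxy with h2 | h2
      · exact h2.le
      · exact h2.1.le
  refine ⟨h1, ?_⟩
  rw [h1, hxz.1] at hyz
  rw [h1] at hxy
  simp only [lt_irrefl, false_or, true_and] at hyz hxy
  omega

theorem lt_of_rowKey_ne {x y x' y' : Fin n} (hx : rowKey h x' = rowKey h x)
    (hy : rowKey h y' = rowKey h y) (hne : rowKey h x ≠ rowKey h y) (hxy : x < y) : x' < y' := by
  rw [← initTab_lt_iff h, Node.lt_iff] at hxy ⊢
  simp only [rowKey, Prod.mk.injEq] at hx hy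
  rw [hx.1, hx.2, hy.1, hy.2]
  rcases hxy with h1 | ⟨h1, h2 | h2⟩
  · exact Or.inl h1
  · exact Or.inr ⟨h1, Or.inl h2⟩
  · exact absurd (by simp only [rowKey, h1, h2.1]) hne

theorem rowKey_eq_of_inversion {w : Equiv.Perm (Fin n)} (hw : w ∈ young h) {x y : Fin n}
    (hxy : x < y) (hwxy : w y < w x) : rowKey h x = rowKey h y := by
  by_contra hne
  rw [mem_young] at hw
  exact absurd (lt_of_rowKey_ne h (hw x) (hw y) hne hxy) hwxy.not_gt

theorem simple_mem_young {i : Fin (n - 1)} (hi' : rowKey h (lo i) = rowKey h (hi i)) :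
    simple i ∈ young h := by
  rw [mem_young]
  intro x
  by_cases h1 : x = lo i
  · rw [h1, simple_lo, hi']
  by_cases h2 : x = hi i
  · rw [h2, simple_hi, hi']
  · rw [simple_of_ne i x h1 h2]

/-- Induction over the row stabiliser. -/
theorem young_induction {P : Equiv.Perm (Fin n) → Prop} (one : P (Equiv.refl _))
    (step : ∀ w i, w ∈ young h → w.symm (lo i) < w.symm (hi i) →
      rowKey h (lo i) = rowKey h (hi i) → P w → P (w.trans (simple i)))
    (w) (hw : w ∈ young h) : P w := by
  induction w using perm_induction with
  | one => exact one
  | step w i hi' ih =>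
    have h1 := rowKey_eq_of_inversion h hw hi'
      (by simpa [simple_lo, simple_hi] using lo_lt_hi i)
    have h0 := hw
    rw [mem_young] at hw
    have h2 := hw (w.symm (lo i))
    have h3 := hw (w.symm (hi i))
    simp only [Equiv.trans_apply, Equiv.apply_symm_apply, simple_lo, simple_hi] at h2 h3
    have h4 : rowKey h (lo i) = rowKey h (hi i) := by rw [h2, h3, h1]
    have h5 : w ∈ young h := by
      rw [← trans_simple_simple w i]
      exact trans_mem_young h h0 (simple_mem_young h h4)
    exact step w i h5 hi' h4 (ih h5)

variable {R : Type*} [CommRing R] (q : Rˣ)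

/-- The coefficient `(-q)^{-ℓ(w)}`. -/
def sgnCoeff (w : Equiv.Perm (Fin n)) : R := (((-q) ^ (-(len w : ℤ)) : Rˣ) : R)

theorem sgnCoeff_refl : sgnCoeff q (Equiv.refl (Fin n)) = 1 := by simp [sgnCoeff, len_refl]

theorem sgnCoeff_of_len {w w' : Equiv.Perm (Fin n)} (hl : len w' = len w + 1) :
    sgnCoeff q w' = -((q⁻¹ : Rˣ) : R) * sgnCoeff q w := by
  rw [sgnCoeff, sgnCoeff, hl, Nat.cast_add, neg_add, add_comm, zpow_add, Units.val_mul]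
  simp

/-- `∑_{w ∈ 𝔖_λ} (-q)^{-ℓ(w)} g_w`. -/
def antisym : BT q n := ∑ w ∈ young h, sgnCoeff q w • gPerm q w

/-- The row stabiliser is a union of pairs `w`, `s_i w` with `w` the shorter element, and within a
pair the coefficient changes by `-q⁻¹`. All vanishing and sign rules for the antisymmetriser come
from this factor. -/
theorem exists_antisym_eq {i : Fin (n - 1)} (hi' : rowKey h (lo i) = rowKey h (hi i)) :
    ∃ y, antisym h q = (1 - ((q⁻¹ : Rˣ) : R) • g q i) * y := by
  classical
  refine ⟨∑ w ∈ (young h).filter (fun w => w (lo i) < w (hi i)), sgnCoeff q w • gPerm q w, ?_⟩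
  have hs := simple_mem_young h hi'
  rw [antisym, ← Finset.sum_filter_add_sum_filter_not (young h) (fun w => w (lo i) < w (hi i)),
    sub_mul, one_mul, sub_eq_add_neg, Finset.mul_sum, ← Finset.sum_neg_distrib]
  congr 1
  symm
  refine Finset.sum_bij (fun w _ => (simple i).trans w) ?_ ?_ ?_ ?_
  · intro w hw
    rw [Finset.mem_filter] at hw ⊢
    refine ⟨trans_mem_young h hs hw.1, ?_⟩
    simp only [Equiv.trans_apply, simple_lo, simple_hi]
    exact hw.2.not_gt
  · intro w _ w' _ hww
    have := congrArg (fun u => (simple i).trans u) hww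
    simpa [← Equiv.trans_assoc, simple] using this
  · intro w hw
    rw [Finset.mem_filter] at hw
    refine ⟨(simple i).trans w, ?_, ?_⟩
    · rw [Finset.mem_filter]
      refine ⟨trans_mem_young h hs hw.1, ?_⟩
      simp only [Equiv.trans_apply, simple_lo, simple_hi]
      exact lt_of_le_of_ne (not_lt.1 hw.2) fun h' => lo_ne_hi i (w.injective h').symm
    · ext x; simp
  · intro w hw
    rw [Finset.mem_filter] at hw
    rw [gPerm_simple_trans q hw.2, sgnCoeff_of_len q (len_simple_trans hw.2)]
    simp only [smul_mul_assoc, mul_smul_comm, smul_smul, neg_mul]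
    rw [mul_comm]
    exact (neg_smul _ _).symm

variable {N : ℕ}

/-- The colours are constant along the rows of `𝔱^λ`. -/
def RowColoured (f : Fin n → Fin N × Fin k) : Prop :=
  ∀ x y, rowKey h x = rowKey h y → (f x).2 = (f y).2

/-- The values increase along the rows of `𝔱^λ`. -/
def RowIncr (f : Fin n → Fin N × Fin k) : Prop :=
  ∀ x y, x < y → rowKey h x = rowKey h y → (f x).1 < (f y).1

variable {h}

theorem RowColoured.comp {f : Fin n → Fin N × Fin k} (hf : RowColoured h f)
    {w : Equiv.Perm (Fin n)} (hw : w ∈ young h) : RowColoured h (f ∘ w) := by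
  rw [mem_young] at hw
  intro x y hxy
  apply hf
  rw [hw, hw, hxy]

/-- On equal neighbouring entries `g_i` acts by `q`, which is annihilated by the factor `1 - q⁻¹
g_i`. -/
theorem rho_antisym_eq_zero_of_adjacent {f : Fin n → Fin N × Fin k} {i : Fin (n - 1)}
    (hi' : rowKey h (lo i) = rowKey h (hi i)) (hf : f (lo i) = f (hi i)) :
    rho q N k (antisym h q) f = 0 := by
  obtain ⟨y, hy⟩ := exists_antisym_eq h q hi'
  rw [hy]
  apply rho_mul_of_row_zero
  funext f'
  rw [map_sub, map_smul, map_one, Matrix.sub_apply, Matrix.smul_apply, rho_g, hf]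
  have : f ∘ simple i = f := by
    funext x
    by_cases h1 : x = lo i
    · rw [h1, Function.comp_apply, simple_lo, hf]
    by_cases h2 : x = hi i
    · rw [h2, Function.comp_apply, simple_hi, hf]
    · rw [Function.comp_apply, simple_of_ne i x h1 h2]
  rw [this, Matrix.one_apply]
  simp [cG, dG, eq_comm]

/-- On the span of a basis vector and its swap the factor `1 - q⁻¹ g_i` has proportional rows, with
ratio `-q⁻¹`. -/
theorem rho_antisym_comp_simple {f : Fin n → Fin N × Fin k} {i : Fin (n - 1)}
    (hi' : rowKey h (lo i) = rowKey h (hi i)) (hc : (f (lo i)).2 = (f (hi i)).2)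
    (hf : (f (lo i)).1 < (f (hi i)).1) :
    rho q N k (antisym h q) (f ∘ simple i) = -((q⁻¹ : Rˣ) : R) • rho q N k (antisym h q) f := by
  obtain ⟨y, hy⟩ := exists_antisym_eq h q hi'
  have hq : (q : R) * ((q⁻¹ : Rˣ) : R) = 1 := by simp
  have key : ∀ f', rho q N k (1 - ((q⁻¹ : Rˣ) : R) • g q i) (f ∘ simple i) f' =
      -((q⁻¹ : Rˣ) : R) * rho q N k (1 - ((q⁻¹ : Rˣ) : R) • g q i) f f' := by
    intro f'
    rw [map_sub, map_smul, map_one, Matrix.sub_apply, Matrix.smul_apply, rho_g, Matrix.sub_apply,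
      Matrix.smul_apply, rho_g, comp_simple_simple, Matrix.one_apply, Matrix.one_apply]
    simp only [Function.comp_apply, simple_lo, simple_hi, cG, dG, hc, hf.ne, hf.ne', hf, hf.not_gt,
      ne_eq, not_true_eq_false, if_false, if_true, smul_eq_mul, @eq_comm _ _ f']
    split_ifs <;> first | linear_combination (-1 : R) * hq | ring
  funext f'
  rw [hy, rho_mul_apply, Pi.smul_apply, rho_mul_apply, smul_eq_mul, Finset.mul_sum]
  exact Finset.sum_congr rfl fun j _ => by rw [key, mul_assoc]

/-- The left one of the two equal entries is moved towards the right one by swaps inside the row;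
each swap multiplies the row of the matrix by a unit, and for neighbours it vanishes. -/
theorem rho_antisym_eq_zero {f : Fin n → Fin N × Fin k} (hc : RowColoured h f) {x y : Fin n}
    (hxy : x < y) (hr : rowKey h x = rowKey h y) (hf : (f x).1 = (f y).1) :
    rho q N k (antisym h q) f = 0 := by
  induction hd : (y : ℕ) - x using Nat.strong_induction_on generalizing x f with
  | _ d ih =>
  have hlt : (x : ℕ) < y := hxy
  obtain ⟨i, rfl⟩ : ∃ i : Fin (n - 1), x = lo i := ⟨⟨x, by omega⟩, rfl⟩
  have hiy : hi i ≤ y := by simp only [lo, hi, Fin.le_def] at hlt ⊢; omega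
  have hr' : rowKey h (hi i) = rowKey h (lo i) :=
    rowKey_of_between h (by simp [lo, hi, Fin.le_def]) hiy hr
  have hcol : (f (lo i)).2 = (f (hi i)).2 := hc _ _ hr'.symm
  rcases hiy.eq_or_lt with rfl | hiy
  · exact rho_antisym_eq_zero_of_adjacent q hr'.symm (Prod.ext hf hcol)
  have h0 : rho q N k (antisym h q) (f ∘ simple i) = 0 := by
    refine ih ((y : ℕ) - hi i) ?_ (hc.comp (simple_mem_young h hr'.symm)) hiy
      (hr'.trans hr) ?_ rfl
    · simp only [lo, hi, Fin.lt_def] at *; omega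
    · rw [Function.comp_apply, Function.comp_apply, simple_hi,
        simple_of_ne i y hxy.ne' hiy.ne', hf]
  -- The swap rule is stated for an increasing pair. In the increasing case it is inverted, which is
  -- possible since `-q⁻¹` is a unit; in the decreasing case it is applied to the swapped sequence.
  rcases lt_trichotomy (f (lo i)).1 (f (hi i)).1 with h1 | h1 | h1
  · rw [rho_antisym_comp_simple q hr'.symm hcol h1] at h0
    have := congrArg (fun v => (-(q : R)) • v) h0
    simpa [smul_smul] using this
  · exact rho_antisym_eq_zero_of_adjacent q hr'.symm (Prod.ext h1 hcol)
  · have := rho_antisym_comp_simple q (f := f ∘ simple i) hr'.symm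
      (by simpa [simple_lo, simple_hi] using hcol.symm) (by simpa [simple_lo, simple_hi] using h1)
    rw [comp_simple_simple] at this
    rw [this, h0, smul_zero]

/-- Inversions of an element of the row stabiliser stay inside rows, where the values increase, so
only the pure swap case of the operators occurs. -/
theorem rho_gPerm_rowIncr {f : Fin n → Fin N × Fin k} (hf : RowIncr h f)
    {w : Equiv.Perm (Fin n)} (hw : w ∈ young h) :
    rho q N k (gPerm q w) f = Pi.single (f ∘ w.symm) 1 :=
  rho_gPerm_of_inversions q w f fun x y hxy hwxy =>
    Or.inr (hf x y hxy (rowKey_eq_of_inversion h hw hxy hwxy))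

theorem rho_antisym_rowIncr {f : Fin n → Fin N × Fin k} (hf : RowIncr h f)
    (f' : Fin n → Fin N × Fin k) : rho q N k (antisym h q) f f' =
      ∑ w ∈ young h, sgnCoeff q w * (if f' = f ∘ w.symm then 1 else 0) := by
  rw [antisym, map_sum, Matrix.sum_apply]
  refine Finset.sum_congr rfl fun w hw => ?_
  rw [map_smul, Matrix.smul_apply, rho_gPerm_rowIncr q hf hw, Pi.single_apply, smul_eq_mul]

theorem RowIncr.injOn {f : Fin n → Fin N × Fin k} (hf : RowIncr h f) {x y : Fin n}
    (hr : rowKey h x = rowKey h y) (hxy : (f x).1 = (f y).1) : x = y := by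
  rcases lt_trichotomy x y with h1 | h1 | h1
  · exact absurd hxy (hf x y h1 hr).ne
  · exact h1
  · exact absurd hxy (hf y x h1 hr.symm).ne'

theorem RowIncr.comp_symm_inj {f : Fin n → Fin N × Fin k} (hf : RowIncr h f)
    {w w' : Equiv.Perm (Fin n)} (hw : w ∈ young h) (hw' : w' ∈ young h)
    (hww : f ∘ w.symm = f ∘ w'.symm) : w = w' := by
  have h1 : w.symm = w'.symm := by
    ext x
    congr 1
    refine hf.injOn ?_ (congrArg Prod.fst (congrFun hww x))
    rw [(mem_young h).1 (symm_mem_young h hw), (mem_young h).1 (symm_mem_young h hw')]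
  rw [← Equiv.symm_symm w, h1, Equiv.symm_symm]

theorem RowIncr.eq_of_comp {f f' : Fin n → Fin N × Fin k} (hf : RowIncr h f) (hf' : RowIncr h f')
    {u : Equiv.Perm (Fin n)} (hu : u ∈ young h) (he : f' = f ∘ u) : u = Equiv.refl _ := by
  apply perm_eq_refl_of_strictMono
  have hu' := (mem_young h).1 hu
  intro x y hxy
  by_cases hr : rowKey h x = rowKey h y
  · have h1 := hf' x y hxy hr
    rw [he] at h1
    rcases lt_trichotomy (u x) (u y) with h2 | h2 | h2
    · exact h2
    · exact absurd (u.injective h2) hxy.ne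
    · exact absurd (hf _ _ h2 (by rw [hu', hu', hr])) h1.not_gt
  · exact lt_of_rowKey_ne h (hu' x) (hu' y) hr hxy

theorem rho_antisym_rowIncr_apply {f : Fin n → Fin N × Fin k} (hf : RowIncr h f)
    {w : Equiv.Perm (Fin n)} (hw : w ∈ young h) :
    rho q N k (antisym h q) f (f ∘ w.symm) = sgnCoeff q w := by
  rw [rho_antisym_rowIncr q hf, Finset.sum_eq_single_of_mem w hw]
  · simp
  · intro w' hw' hne
    rw [if_neg, mul_zero]
    exact fun he => hne (hf.comp_symm_inj hw hw' he).symm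

theorem exists_of_rho_antisym_ne_zero {f f' : Fin n → Fin N × Fin k} (hf : RowIncr h f)
    (hne : rho q N k (antisym h q) f f' ≠ 0) : ∃ w ∈ young h, f' = f ∘ w.symm := by
  rw [rho_antisym_rowIncr q hf] at hne
  obtain ⟨w, hw, h1⟩ := Finset.exists_ne_zero_of_sum_ne_zero hne
  exact ⟨w, hw, by by_contra h2; simp [h2] at h1⟩

theorem rho_antisym_comp_symm {f : Fin n → Fin N × Fin k} (hc : RowColoured h f) (hf : RowIncr h f)
    {w : Equiv.Perm (Fin n)} (hw : w ∈ young h) :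
    rho q N k (antisym h q) (f ∘ w.symm) = sgnCoeff q w • rho q N k (antisym h q) f := by
  refine young_induction h (P := fun w => rho q N k (antisym h q) (f ∘ w.symm) =
    sgnCoeff q w • rho q N k (antisym h q) f) ?_ ?_ w hw
  · rw [sgnCoeff_refl, one_smul]; rfl
  · intro w i hw hi' hr ih
    have h1 : rowKey h (w.symm (lo i)) = rowKey h (w.symm (hi i)) := by
      have := (mem_young h).1 (symm_mem_young h hw)
      rw [this, this, hr]
    have h2 := rho_antisym_comp_simple q (f := f ∘ w.symm) hr (hc _ _ h1) (hf _ _ hi' h1)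
    rw [sgnCoeff_of_len q (len_trans_simple hi'), mul_smul, ← ih, ← h2]
    rfl

theorem exists_adjacent_of_not_rowIncr {f : Fin n → Fin N × Fin k} (hf : ¬ RowIncr h f) :
    ∃ i, rowKey h (lo i) = rowKey h (hi i) ∧ (f (hi i)).1 ≤ (f (lo i)).1 := by
  by_contra hcon
  push Not at hcon
  apply hf
  intro x y hxy hr
  induction hd : (y : ℕ) - x using Nat.strong_induction_on generalizing x with
  | _ d ih =>
  have hlt : (x : ℕ) < y := hxy
  obtain ⟨i, rfl⟩ : ∃ i : Fin (n - 1), x = lo i := ⟨⟨x, by omega⟩, rfl⟩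
  have hiy : hi i ≤ y := by simp only [lo, hi, Fin.le_def] at hlt ⊢; omega
  have hr' : rowKey h (hi i) = rowKey h (lo i) :=
    rowKey_of_between h (by simp [lo, hi, Fin.le_def]) hiy hr
  rcases hiy.eq_or_lt with rfl | hiy
  · exact hcon i hr
  · refine (hcon i hr'.symm).trans (ih ((y : ℕ) - hi i) ?_ _ hiy (hr'.trans hr) rfl)
    simp only [lo, hi, Fin.lt_def] at *; omega

theorem exists_young_rowIncr (f : Fin n → Fin N × Fin k)
    (hf : ∀ x y, x ≠ y → rowKey h x = rowKey h y → (f x).1 ≠ (f y).1) :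
    ∃ w ∈ young h, RowIncr h (f ∘ w) := by
  -- The lexicographically least rearrangement within the rows is increasing, since any descent
  -- inside a row could be swapped to make it smaller.
  obtain ⟨w, hw, hmin⟩ := Finset.exists_min_image (young h)
    (fun w => (toLex fun x => (f (w x)).1 : Lex (Fin n → Fin N))) ⟨_, refl_mem_young h⟩
  refine ⟨w, hw, ?_⟩
  by_contra hcon
  obtain ⟨i, hr, hle⟩ := exists_adjacent_of_not_rowIncr hcon
  have hw' := (mem_young h).1 hw
  have hlt : (f (w (hi i))).1 < (f (w (lo i))).1 :=
    lt_of_le_of_ne hle (hf _ _ (fun e => lo_ne_hi i (w.injective e).symm) (by rw [hw', hw', hr]))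
  refine absurd (hmin ((simple i).trans w) (trans_mem_young h (simple_mem_young h hr) hw)) ?_
  rw [not_le]
  refine ⟨lo i, fun x hx => ?_, ?_⟩
  · change (f (w (simple i x))).1 = (f (w x)).1
    rw [simple_of_ne i x hx.ne (hx.trans (by simp [lo, hi, Fin.lt_def])).ne]
  · change (f (w (simple i (lo i)))).1 < (f (w (lo i))).1
    rwa [simple_lo]

variable (h)

/-- The idempotent of the set partition of a multipartition. -/
def eBlock : BT q n := idem q (blockPart h)

open Classical in
theorem blockPart_part_eq_iff {x y : Fin n} :
    (blockPart h).part x = (blockPart h).part y ↔ (initTab h x).comp = (initTab h y).comp := by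
  unfold blockPart
  exact @ofSetoid_part_eq_iff n _ _ x y

/-- The functions whose colours are the components of `𝔱^λ`, up to a permutation of the colours. -/
def Coloured (f : Fin n → Fin N × Fin k) : Prop := blockPart h = colourPart f

variable {h}

theorem coloured_iff {f : Fin n → Fin N × Fin k} : Coloured h f ↔
    ∀ x y, (initTab h x).comp = (initTab h y).comp ↔ (f x).2 = (f y).2 := by
  rw [Coloured]
  constructor
  · intro e x y
    rw [← blockPart_part_eq_iff h, e, colourPart, kerPart_part_eq_iff]
  · intro e
    exact setPart_ext fun x y => by
      rw [blockPart_part_eq_iff h, colourPart, kerPart_part_eq_iff, e]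

theorem Coloured.rowColoured {f : Fin n → Fin N × Fin k} (hf : Coloured h f) : RowColoured h f :=
  fun x y hxy => (coloured_iff.1 hf x y).1 (comp_eq_of_rowKey_eq h hxy)

theorem Coloured.comp {f : Fin n → Fin N × Fin k} (hf : Coloured h f)
    {w : Equiv.Perm (Fin n)} (hw : w ∈ young h) : Coloured h (f ∘ w) := by
  rw [coloured_iff] at hf ⊢
  intro x y
  have hw' : ∀ x, (initTab h (w x)).comp = (initTab h x).comp := fun x =>
    comp_eq_of_rowKey_eq h ((mem_young h).1 hw x)
  rw [Function.comp_apply, Function.comp_apply, ← hf, hw', hw']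

theorem rho_eBlock_mul {f : Fin n → Fin N × Fin k} (hf : Coloured h f) (x : BT q n) :
    rho q N k (eBlock h q * x) f = rho q N k x f := by
  apply rho_mul_of_row
  rw [eBlock, rho_idem, if_pos (show blockPart h = colourPart f from hf)]

theorem rho_eBlock_mul_of_not {f : Fin n → Fin N × Fin k} (hf : ¬ Coloured h f) (x : BT q n) :
    rho q N k (eBlock h q * x) f = 0 := by
  apply rho_mul_of_row_zero
  rw [eBlock, rho_idem, if_neg (show ¬ blockPart h = colourPart f from hf), Pi.single_zero]

open Classical in
/-- The matrix of `𝔼_λ y_λ` as a sum of matrices of rank one. -/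
theorem rho_eBlock_antisym (f f' : Fin n → Fin N × Fin k) :
    rho q N k (eBlock h q * antisym h q) f f' =
      ∑ f₀ : Fin n → Fin N × Fin k with Coloured h f₀ ∧ RowIncr h f₀,
        rho q N k (eBlock h q * antisym h q) f₀ f * rho q N k (eBlock h q * antisym h q) f₀ f' := by
  have h0 : ∀ f₀ : Fin n → Fin N × Fin k, Coloured h f₀ ∧ RowIncr h f₀ →
      rho q N k (eBlock h q * antisym h q) f₀ f ≠ 0 → ∃ w ∈ young h, f = f₀ ∘ w.symm := by
    intro f₀ hf₀ hne
    rw [rho_eBlock_mul q hf₀.1] at hne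
    exact exists_of_rho_antisym_ne_zero q hf₀.2 hne
  -- A coloured sequence without repetitions in its rows is a rearrangement of exactly one
  -- increasing sequence `f ∘ w`. Its row of the matrix is `sgnCoeff q w` times that of `f ∘ w`, and
  -- the same number is the entry at `f ∘ w`, `f`. In all other cases both sides vanish.
  by_cases hf : Coloured h f ∧ ∀ x y, x ≠ y → rowKey h x = rowKey h y → (f x).1 ≠ (f y).1
  · obtain ⟨w, hw, hincr⟩ := exists_young_rowIncr f hf.2
    have hfw : f = (f ∘ w) ∘ w.symm := by funext x; simp
    have hcol := hf.1.comp hw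
    rw [Finset.sum_eq_single_of_mem (f ∘ w) (by simpa using ⟨hcol, hincr⟩)]
    · rw [rho_eBlock_mul q hcol, rho_eBlock_mul q hf.1]
      conv_lhs => rw [hfw, rho_antisym_comp_symm q hcol.rowColoured hincr hw]
      conv_rhs => lhs; rw [hfw]
      have := rho_antisym_rowIncr_apply q hincr hw
      rw [← hfw] at this ⊢
      rw [this, Pi.smul_apply, smul_eq_mul]
    · intro f₁ hf₁ hne
      rw [Finset.mem_filter] at hf₁
      by_contra hcon
      obtain ⟨w', hw', he⟩ := h0 f₁ hf₁.2 (left_ne_zero_of_mul hcon)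
      have h1 := RowIncr.eq_of_comp (f := f₁) (f' := f ∘ w) hf₁.2.2 hincr (u := w.trans w'.symm)
        (trans_mem_young h hw (symm_mem_young h hw')) (by rw [he]; rfl)
      apply hne
      rw [he]
      funext x
      have := congrArg (fun u : Equiv.Perm (Fin n) => u x) h1
      simp only [Equiv.trans_apply, Equiv.refl_apply] at this
      simp [this]
  · have h1 : rho q N k (eBlock h q * antisym h q) f = 0 := by
      by_cases hc : Coloured h f
      · rw [rho_eBlock_mul q hc]
        have : ¬ ∀ x y, x ≠ y → rowKey h x = rowKey h y → (f x).1 ≠ (f y).1 :=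
          fun h' => hf ⟨hc, h'⟩
        push Not at this
        obtain ⟨x, y, hxy, hr, he⟩ := this
        rcases lt_or_gt_of_ne hxy with h' | h'
        · exact rho_antisym_eq_zero q hc.rowColoured h' hr he
        · exact rho_antisym_eq_zero q hc.rowColoured h' hr.symm he.symm
      · exact rho_eBlock_mul_of_not q hc _
    rw [h1, Pi.zero_apply]
    symm
    refine Finset.sum_eq_zero fun f₁ hf₁ => ?_
    rw [Finset.mem_filter] at hf₁
    by_contra hcon
    obtain ⟨w', hw', he⟩ := h0 f₁ hf₁.2 (left_ne_zero_of_mul hcon)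
    apply hf
    rw [he]
    refine ⟨hf₁.2.1.comp (symm_mem_young h hw'), fun x y hxy hr he' => hxy ?_⟩
    have hm := (mem_young h).1 (symm_mem_young h hw')
    have := hf₁.2.2.injOn (by rw [hm, hm, hr]) he'
    exact w'.symm.injective this

open Classical in
-- With D the projection to the coloured increasing sequences, the preceding decomposition reads Y =
-- Yᵀ D Y. As the anti-involution acts by transposition, the product with `st q a` and `b` has the
-- matrix (Y a)ᵀ D (Y b).
theorem rho_sandwich (a b : BT q n) (f f' : Fin n → Fin N × Fin k) :
    rho q N k (st q a * (eBlock h q * antisym h q) * b) f f' =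
      ∑ f₀ : Fin n → Fin N × Fin k with Coloured h f₀ ∧ RowIncr h f₀,
        rho q N k (eBlock h q * antisym h q * a) f₀ f *
          rho q N k (eBlock h q * antisym h q * b) f₀ f' := by
  set D : Matrix (Fin n → Fin N × Fin k) (Fin n → Fin N × Fin k) R :=
    Matrix.diagonal fun f₀ => if Coloured h f₀ ∧ RowIncr h f₀ then 1 else 0
  set Y := rho q N k (eBlock h q * antisym h q)
  have hD : ∀ (A B : Matrix (Fin n → Fin N × Fin k) (Fin n → Fin N × Fin k) R) (f f'),
      (A.transpose * D * B) f f' =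
        ∑ f₀ : Fin n → Fin N × Fin k with Coloured h f₀ ∧ RowIncr h f₀, A f₀ f * B f₀ f' := by
    intro A B f f'
    rw [Matrix.mul_apply, Finset.sum_filter]
    refine Finset.sum_congr rfl fun f₀ _ => ?_
    rw [Matrix.mul_diagonal, Matrix.transpose_apply]
    split_ifs <;> simp
  have hY : Y = Y.transpose * D * Y := by
    ext f f'
    rw [hD]
    exact rho_eBlock_antisym q f f'
  have hst : rho q N k (st q a) = (rho q N k a).transpose := by
    ext f f'
    exact rho_st q a f f'
  have hYm : ∀ c : BT q n, rho q N k (eBlock h q * antisym h q * c) = Y * rho q N k c :=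
    fun c => map_mul _ _ _
  rw [map_mul, map_mul (rho q N k) (st q a), hst, hYm, hYm, ← hD, Matrix.transpose_mul]
  change ((rho q N k a).transpose * Y * rho q N k b) f f' = _
  conv_lhs => rw [hY]
  simp only [Matrix.mul_assoc]

/-- If some component has more than `N` columns, then `𝔼_λ y_λ` acts by zero. -/
theorem rho_eBlock_antisym_eq_zero (hwide : ∃ i, N < (lam i).rowLen 0) :
    rho q N k (eBlock h q * antisym h q) = 0 := by
  funext f
  change rho q N k (eBlock h q * antisym h q) f = 0
  by_cases hc : Coloured h f
  · rw [rho_eBlock_mul q hc]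
    obtain ⟨i, hi'⟩ := hwide
    have hmem : ∀ c : Fin (N + 1), ((0 : ℕ), (c : ℕ)) ∈ lam i := fun c =>
      YoungDiagram.mem_iff_lt_rowLen.2 (lt_of_lt_of_le c.2 hi')
    let node : Fin (N + 1) → Node lam := fun c => ⟨(i, 0, c), hmem c⟩
    -- Pigeonhole: the first `N + 1` cells of the top row carry only `N` possible values.
    obtain ⟨c, c', hne, he⟩ := Fintype.exists_ne_map_eq_of_card_lt
      (fun c => (f ((initTab h).symm (node c))).1) (by simp)
    have hr : rowKey h ((initTab h).symm (node c)) = rowKey h ((initTab h).symm (node c')) := by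
      simp only [rowKey, Equiv.apply_symm_apply]
      rfl
    have hxy : (initTab h).symm (node c) ≠ (initTab h).symm (node c') := by
      intro e
      exact hne (Fin.ext (congrArg Node.col ((initTab h).symm.injective e)))
    rcases lt_or_gt_of_ne hxy with h' | h'
    · exact rho_antisym_eq_zero q hc.rowColoured h' hr he
    · exact rho_antisym_eq_zero q hc.rowColoured h' hr.symm he.symm
  · exact rho_eBlock_mul_of_not q hc _

end Antisymmetriser

/-! ### Triangularity of the action on standard sequences -/

section PrefixOrder

variable {n : ℕ} {X : Type*} [LinearOrder X]

/-- The number of the first `p` values of `F` that are at least `k`. -/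
def prefixCount (F : Fin n → X) (p : ℕ) (k : X) : ℕ :=
  (Finset.univ.filter fun x : Fin n => (x : ℕ) < p ∧ k ≤ F x).card

/-- The comparison of all the prefix counts. -/
def PrefixLe (F G : Fin n → X) : Prop := ∀ p k, prefixCount F p k ≤ prefixCount G p k

theorem PrefixLe.refl (F : Fin n → X) : PrefixLe F F := fun _ _ => le_rfl

theorem PrefixLe.trans {F G H : Fin n → X} (h1 : PrefixLe F G) (h2 : PrefixLe G H) :
    PrefixLe F H := fun p k => (h1 p k).trans (h2 p k)

theorem prefixCount_succ (F : Fin n → X) (x : Fin n) (k : X) :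
    prefixCount F (x + 1) k = prefixCount F x k + if k ≤ F x then 1 else 0 := by
  unfold prefixCount
  split_ifs with h
  · rw [← Finset.card_insert_of_notMem (a := x) (by simp)]
    congr 1
    ext y
    simp only [Finset.mem_filter, Finset.mem_univ, true_and, Finset.mem_insert, Fin.ext_iff]
    constructor
    · rintro ⟨h1, h2⟩
      rcases Nat.lt_succ_iff_lt_or_eq.1 h1 with h3 | h3
      · exact Or.inr ⟨h3, h2⟩
      · exact Or.inl h3
    · rintro (h1 | h1)
      · have : y = x := Fin.ext h1
        subst this
        exact ⟨Nat.lt_succ_self _, h⟩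
      · exact ⟨h1.1.trans (Nat.lt_succ_self _), h1.2⟩
  · rw [add_zero]
    congr 1
    ext y
    simp only [Finset.mem_filter, Finset.mem_univ, true_and]
    refine and_congr_left fun h2 => ?_
    have : (y : ℕ) ≠ x := fun e => h (Fin.ext e ▸ h2)
    omega

theorem prefixCount_comp_simple (F : Fin n → X) (i : Fin (n - 1)) {p : ℕ} (hp : p ≠ i + 1) (k : X) :
    prefixCount (F ∘ simple i) p k = prefixCount F p k := by
  unfold prefixCount
  refine Finset.card_equiv (simple i) fun x => ?_
  simp only [Finset.mem_filter, Finset.mem_univ, true_and, Function.comp_apply, simple_val]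
  refine and_congr_left fun _ => ?_
  split_ifs <;> omega

theorem prefixCount_comp_simple_succ (F : Fin n → X) (i : Fin (n - 1)) (k : X) :
    prefixCount (F ∘ simple i) (i + 1) k =
      prefixCount F i k + if k ≤ F (hi i) then 1 else 0 := by
  have := prefixCount_succ (F ∘ simple i) (lo i) k
  rw [Function.comp_apply, simple_lo] at this
  rw [← prefixCount_comp_simple F i (p := i) (by omega) k]
  exact this

theorem prefixLe_comp_simple {F : Fin n → X} {i : Fin (n - 1)} (hF : F (lo i) ≤ F (hi i)) :
    PrefixLe F (F ∘ simple i) := by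
  intro p k
  by_cases hp : p = i + 1
  · subst hp
    rw [prefixCount_comp_simple_succ]
    have := prefixCount_succ F (lo i) k
    refine (show prefixCount F (i + 1) k = _ from this).trans_le ?_
    change prefixCount F i k + _ ≤ _
    gcongr
    split_ifs with h1 h2
    · exact le_rfl
    · exact absurd (h1.trans hF) h2
    · exact Nat.zero_le _
    · exact le_rfl
  · rw [prefixCount_comp_simple F i hp]

theorem comp_simple_prefixLe {F : Fin n → X} {i : Fin (n - 1)} (hF : F (hi i) ≤ F (lo i)) :
    PrefixLe (F ∘ simple i) F := by
  have := prefixLe_comp_simple (F := F ∘ simple i) (i := i)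
    (by simpa [simple_lo, simple_hi] using hF)
  rwa [comp_simple_simple] at this

/-- A lifting property as for the Bruhat order; only the count of the first `i + 1` entries changes.
In the critical case `k ≤ F (hi i)` but `G (hi i) < k`, both entries of `G` are below `k`. Then the
count of `G` stays constant over the two steps while that of `F` grows, which leaves room for the
extra entry. -/
theorem PrefixLe.comp_simple {F G : Fin n → X} (hFG : PrefixLe F G) {i : Fin (n - 1)}
    (hG : G (lo i) < G (hi i)) : PrefixLe (F ∘ simple i) (G ∘ simple i) := by
  intro p k
  by_cases hp : p = i + 1
  · subst hp
    rw [prefixCount_comp_simple_succ, prefixCount_comp_simple_succ]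
    have h0 := hFG i k
    by_cases h1 : k ≤ F (hi i)
    · by_cases h2 : k ≤ G (hi i)
      · rw [if_pos h1, if_pos h2]; omega
      · have h3 := hFG (i + 1 + 1) k
        have e1 : prefixCount F (i + 1 + 1) k = prefixCount F (i + 1) k + _ :=
          prefixCount_succ F (hi i) k
        have e2 : prefixCount G (i + 1 + 1) k = prefixCount G (i + 1) k + _ :=
          prefixCount_succ G (hi i) k
        have e3 : prefixCount F (i + 1) k = prefixCount F i k + _ := prefixCount_succ F (lo i) k
        have e4 : prefixCount G (i + 1) k = prefixCount G i k + _ := prefixCount_succ G (lo i) k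
        have h4 : ¬ k ≤ G (lo i) := fun h => h2 (h.trans hG.le)
        rw [if_neg h2] at e2 ⊢
        rw [if_neg h4] at e4
        rw [if_pos h1] at e1 ⊢
        split_ifs at e3 <;> omega
    · rw [if_neg h1]; omega
  · rw [prefixCount_comp_simple F i hp, prefixCount_comp_simple G i hp]
    exact hFG p k

/-- At the first place where the sequences differ, the prefix count for the value of `F` there
decides which one is larger. -/
theorem PrefixLe.toLex_le {F G : Fin n → X} (hFG : PrefixLe F G) : toLex F ≤ toLex G := by
  by_contra hcon
  rw [not_le] at hcon
  obtain ⟨p, h1, h2⟩ := hcon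
  have h1' : ∀ x < p, G x = F x := h1
  have h2' : G p < F p := h2
  have h3 := hFG (p + 1) (F p)
  rw [prefixCount_succ, prefixCount_succ, if_pos le_rfl, if_neg h2'.not_ge] at h3
  have h4 : prefixCount F p (F p) = prefixCount G p (F p) := by
    unfold prefixCount
    congr 1
    ext y
    simp only [Finset.mem_filter, Finset.mem_univ, true_and]
    refine and_congr_right fun hy => ?_
    rw [h1' y hy]
  omega

theorem PrefixLe.antisymm {F G : Fin n → X} (h1 : PrefixLe F G) (h2 : PrefixLe G F) : F = G :=
  toLex.injective (le_antisymm h1.toLex_le h2.toLex_le)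

end PrefixOrder

/-! ### Sequences of standard multitableaux and their unitriangularity -/

section StandardSequences

variable {k n : ℕ} {lam : Fin k → YoungDiagram} (h : ∑ i, (lam i).card = n)

theorem Node.col_lt {N : ℕ} (hN : ∀ i, (lam i).rowLen 0 ≤ N) (x : Node lam) : x.col < N :=
  (YoungDiagram.mem_iff_lt_rowLen.1
    ((lam x.comp).up_left_mem (Nat.zero_le _) le_rfl x.mem)).trans_le (hN _)

/-- The sequence of the columns and the components of the labels of a multitableau. -/
def tabFun {N : ℕ} (hN : ∀ i, (lam i).rowLen 0 ≤ N) (t : Fin n ≃ Node lam) :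
    Fin n → Fin N × Fin k := fun x => (⟨(t x).col, (t x).col_lt hN⟩, (t x).comp)

/-- The value order: by colours, then decreasingly by indices. -/
def valKey {N k : ℕ} (v : Fin N × Fin k) : ℕ ×ₗ ℕᵒᵈ :=
  toLex ((v.2 : ℕ), OrderDual.toDual (v.1 : ℕ))

theorem valKey_injective {N k : ℕ} : Function.Injective (valKey (N := N) (k := k)) := by
  intro v w hvw
  have h1 := Prod.ext_iff.1 (toLex.injective hvw)
  exact Prod.ext (Fin.ext h1.2) (Fin.ext h1.1)

theorem valKey_le_iff {N k : ℕ} {v w : Fin N × Fin k} :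
    valKey v ≤ valKey w ↔ v.2 < w.2 ∨ (v.2 = w.2 ∧ w.1 ≤ v.1) := by
  rw [valKey, valKey, Prod.Lex.toLex_le_toLex]
  exact or_congr Iff.rfl (and_congr Fin.ext_iff.symm Iff.rfl)

theorem valKey_lt_iff {N k : ℕ} {v w : Fin N × Fin k} :
    valKey v < valKey w ↔ v.2 < w.2 ∨ (v.2 = w.2 ∧ w.1 < v.1) := by
  rw [valKey, valKey, Prod.Lex.toLex_lt_toLex]
  exact or_congr Iff.rfl (and_congr Fin.ext_iff.symm Iff.rfl)

variable {N : ℕ} (hN : ∀ i, (lam i).rowLen 0 ≤ N)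

/-- In a standard tableau every column is filled from top to bottom, so the row of a label is
determined by its column, its component and the positions of the smaller labels. -/
theorem tabFun_injOn {t t' : Fin n ≃ Node lam} (ht : IsStd t) (ht' : IsStd t')
    (he : tabFun hN t = tabFun hN t') : t = t' := by
  have key : ∀ x, ∀ s s' : Fin n ≃ Node lam, IsStd s → IsStd s' → tabFun hN s = tabFun hN s' →
      (∀ y < x, s y = s' y) → ¬ (s x).row < (s' x).row := by
    intro x s s' _ hs' he hy hlt
    have e := congrFun he x
    simp only [tabFun, Prod.mk.injEq, Fin.mk.injEq] at e
    have hmem : ((s x).row, (s x).col) ∈ lam (s' x).comp := by rw [← e.2]; exact (s x).mem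
    obtain ⟨y, hyx⟩ := s'.surjective (s x)
    have h1 : y < x := hs'.2 y x (by rw [hyx, e.2]) (by rw [hyx, e.1]) (by rw [hyx]; exact hlt)
    have h2 := hy y h1
    rw [hyx] at h2
    exact h1.ne (s.injective h2)
  ext x
  induction x using WellFoundedLT.induction with
  | _ x ih =>
    have e := congrFun he x
    simp only [tabFun, Prod.mk.injEq, Fin.mk.injEq] at e
    refine Node.ext' e.2 (le_antisymm ?_ ?_) e.1
    · exact not_lt.1 (key x t' t ht' ht he.symm fun y hy => (ih y hy).symm)
    · exact not_lt.1 (key x t t' ht ht' he ih)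

/-- Swapping two consecutive labels destroys standardness only if they are in one row or one column,
and there the smaller label would come first in the reading order. -/
theorem isStd_simple_trans {t : Fin n ≃ Node lam} (ht : IsStd t) {i : Fin (n - 1)}
    (hi' : t (hi i) < t (lo i)) : IsStd ((simple i).trans t) := by
  have key : ∀ x y, simple i x < simple i y → ¬ x < y → x = hi i ∧ y = lo i := by
    intro x y h1 h2
    have e1 := simple_val i x
    have e2 := simple_val i y
    simp only [Fin.ext_iff, Fin.lt_def, hi, lo] at *
    split_ifs at e1 e2 <;> omega
  constructor
  · intro x y h1 h2 h3
    by_contra hcon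
    obtain ⟨rfl, rfl⟩ := key x y (ht.1 _ _ h1 h2 h3) hcon
    simp only [Equiv.trans_apply, simple_lo, simple_hi] at h1 h2 h3
    rw [Node.lt_iff, h1, h2] at hi'
    simp [h3.not_gt] at hi'
  · intro x y h1 h2 h3
    by_contra hcon
    obtain ⟨rfl, rfl⟩ := key x y (ht.2 _ _ h1 h2 h3) hcon
    simp only [Equiv.trans_apply, simple_lo, simple_hi] at h1 h2 h3
    rw [Node.lt_iff, h1, h2] at hi'
    simp [h3.not_gt, h3.ne'] at hi'

/-- If the larger label sits in a higher row of the same component, then it sits strictly further to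
the right. Otherwise the cell in its row and in the column of the smaller label would carry a label
squeezed between two consecutive labels. -/
theorem tabFun_valKey_lt {t : Fin n ≃ Node lam} (ht : IsStd t) {i : Fin (n - 1)}
    (hi' : t (hi i) < t (lo i)) : valKey (tabFun hN t (hi i)) < valKey (tabFun hN t (lo i)) := by
  rw [valKey_lt_iff]
  rw [Node.lt_iff] at hi'
  rcases hi' with h1 | ⟨h1, h2 | ⟨h2, h3⟩⟩
  · exact Or.inl h1
  · refine Or.inr ⟨h1, ?_⟩
    change (t (lo i)).col < (t (hi i)).col
    by_contra hcon
    rw [not_lt] at hcon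
    have hmem : ((t (hi i)).row, (t (lo i)).col) ∈ lam (t (lo i)).comp :=
      (lam _).up_left_mem h2.le le_rfl (t (lo i)).mem
    obtain ⟨y, hy⟩ := t.surjective ⟨((t (lo i)).comp, (t (hi i)).row, (t (lo i)).col), hmem⟩
    have h4 : y < lo i := ht.2 _ _ (by rw [hy]; rfl) (by rw [hy]; rfl) (by rw [hy]; exact h2)
    have h5 : hi i ≤ y := by
      rcases hcon.eq_or_lt with h6 | h6
      · refine le_of_eq (t.injective ?_)
        rw [hy]
        exact Node.ext' h1 rfl h6
      · exact (ht.1 _ _ (by rw [hy]; exact h1) (by rw [hy]; rfl) (by rw [hy]; exact h6)).le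
    exact absurd (lo_lt_hi i) (h5.trans h4.le).not_gt
  · exact absurd (ht.1 _ _ h1 h2 h3) (lo_lt_hi i).not_gt

theorem tabFun_simple_trans (t : Fin n ≃ Node lam) (i : Fin (n - 1)) :
    tabFun hN ((simple i).trans t) = tabFun hN t ∘ simple i := rfl

theorem dPerm_trans_simple (t : Fin n ≃ Node lam) (i : Fin (n - 1)) :
    (dPerm h t).trans (simple i) = dPerm h ((simple i).trans t) := by
  ext x
  simp [dPerm]

/-- Every standard multitableau is obtained from the initial one by successive ascents. -/
theorem isStd_induction {P : (Fin n ≃ Node lam) → Prop} (init : P (initTab h))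
    (step : ∀ t i, IsStd t → t (hi i) < t (lo i) → P ((simple i).trans t) → P t) (t)
    (ht : IsStd t) : P t := by
  induction hd : len (dPerm h t) using Nat.strong_induction_on generalizing t with
  | _ d ih =>
    by_cases hm : StrictMono t
    · rw [eq_initTab_of_strictMono h hm]; exact init
    · obtain ⟨i, hi'⟩ := exists_hi_lt_lo t.injective hm
      refine step t i ht hi' (ih _ ?_ _ (isStd_simple_trans ht hi') rfl)
      have h1 : len ((dPerm h ((simple i).trans t)).trans (simple i)) = _ :=
        len_trans_simple (w := dPerm h ((simple i).trans t)) (i := i) (by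
          rw [← initTab_lt_iff h]
          simpa [dPerm, simple_lo, simple_hi] using hi')
      rw [← dPerm_trans_simple, trans_simple_simple, dPerm_trans_simple] at h1
      omega

theorem rowIncr_initTab : RowIncr h (tabFun hN (initTab h)) := by
  intro x y hxy hr
  simp only [rowKey, Prod.mk.injEq] at hr
  rw [← initTab_lt_iff h, Node.lt_iff, hr.1, hr.2] at hxy
  have : ((initTab h) x).col < ((initTab h) y).col := by simpa using hxy
  exact this

theorem coloured_initTab : Coloured h (tabFun hN (initTab h)) :=
  coloured_iff.2 fun _ _ => Iff.rfl

variable {R : Type*} [CommRing R] (q : Rˣ)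

/-- Along a row of the initial tableau the columns increase and the keys decrease, so the larger
keys come first and any rearrangement within rows lowers the prefix counts. -/
theorem prefixLe_comp_symm_of_mem_young {w : Equiv.Perm (Fin n)} (hw : w ∈ young h) :
    PrefixLe (valKey ∘ tabFun hN (initTab h) ∘ w.symm) (valKey ∘ tabFun hN (initTab h)) := by
  refine young_induction h (P := fun w => PrefixLe (valKey ∘ tabFun hN (initTab h) ∘ w.symm)
    (valKey ∘ tabFun hN (initTab h))) (PrefixLe.refl _) ?_ w hw
  intro w i hw hi' hr ih
  refine PrefixLe.trans ?_ ih
  have h1 : rowKey h (w.symm (lo i)) = rowKey h (w.symm (hi i)) := by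
    have := (mem_young h).1 (symm_mem_young h hw)
    rw [this, this, hr]
  refine comp_simple_prefixLe (F := valKey ∘ tabFun hN (initTab h) ∘ w.symm) (i := i) ?_
  simp only [Function.comp_apply]
  rw [valKey_le_iff]
  exact Or.inr ⟨(comp_eq_of_rowKey_eq h h1).symm, (rowIncr_initTab h hN _ _ hi' h1).le⟩

/-- In the image of the initial sequence, the sequence of `t` is the largest term in the prefix
order and has coefficient 1. The induction runs along ascents: a generator sends a term to itself
and its swap, and both stay below the new sequence. -/
theorem rho_antisym_gPerm_dPerm {t : Fin n ≃ Node lam} (ht : IsStd t) :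
    (∀ f, rho q N k (antisym h q * gPerm q (dPerm h t)) (tabFun hN (initTab h)) f ≠ 0 →
      PrefixLe (valKey ∘ f) (valKey ∘ tabFun hN t)) ∧
    rho q N k (antisym h q * gPerm q (dPerm h t)) (tabFun hN (initTab h)) (tabFun hN t) = 1 := by
  refine isStd_induction h (P := fun t => (∀ f, rho q N k (antisym h q * gPerm q (dPerm h t))
    (tabFun hN (initTab h)) f ≠ 0 → PrefixLe (valKey ∘ f) (valKey ∘ tabFun hN t)) ∧
    rho q N k (antisym h q * gPerm q (dPerm h t)) (tabFun hN (initTab h)) (tabFun hN t) = 1)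
    ?_ ?_ t ht
  · have hd : dPerm h (initTab h) = Equiv.refl _ := by ext x; simp [dPerm]
    rw [hd, gPerm_refl, mul_one]
    constructor
    · intro f hf
      obtain ⟨w, hw, rfl⟩ := exists_of_rho_antisym_ne_zero q (rowIncr_initTab h hN) hf
      exact prefixLe_comp_symm_of_mem_young h hN hw
    · exact (rho_antisym_rowIncr_apply q (rowIncr_initTab h hN) (refl_mem_young h)).trans
        (sgnCoeff_refl q)
  · intro t i ht hi' ⟨ih1, ih2⟩
    have hlt := tabFun_valKey_lt hN ht hi'
    set s := (simple i).trans t with hs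
    have hts : tabFun hN t = tabFun hN s ∘ simple i := by
      rw [hs, tabFun_simple_trans, comp_simple_simple]
    have hG : (valKey ∘ tabFun hN s) (lo i) < (valKey ∘ tabFun hN s) (hi i) := by
      rw [hs, tabFun_simple_trans]
      simpa [simple_lo, simple_hi] using hlt
    have hd : gPerm q (dPerm h t) = gPerm q (dPerm h s) * g q i := by
      rw [← gPerm_trans_simple, dPerm_trans_simple]
      · congr 1; rw [hs, ← Equiv.trans_assoc]; ext x; simp [dPerm]
      · rw [← initTab_lt_iff h]
        simpa [hs, dPerm, simple_lo, simple_hi] using hi'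
    have hle : PrefixLe (valKey ∘ tabFun hN s) (valKey ∘ tabFun hN t) := by
      rw [hts]; exact prefixLe_comp_simple hG.le
    rw [hd, ← mul_assoc]
    constructor
    · intro f hf
      rw [rho_mul_apply] at hf
      obtain ⟨f₁, -, h1⟩ := Finset.exists_ne_zero_of_sum_ne_zero hf
      have h2 := ih1 f₁ (left_ne_zero_of_mul h1)
      have h3 := right_ne_zero_of_mul h1
      rw [rho_g] at h3
      by_cases e1 : f = f₁
      · rw [e1]; exact h2.trans hle
      · by_cases e2 : f = f₁ ∘ simple i
        · rw [e2, hts]; exact h2.comp_simple hG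
        · simp [e1, e2] at h3
    -- The new sequence is strictly above the old one and so has not occurred before. Its
    -- coefficient therefore comes only from swapping the old top term, whose two entries differ and
    -- give the factor 1.
    · have h0 : rho q N k (antisym h q * gPerm q (dPerm h s)) (tabFun hN (initTab h))
          (tabFun hN t) = 0 := by
        by_contra hne
        have h1 := (ih1 _ hne).antisymm hle
        have h2 := congrFun h1 (lo i)
        rw [hts] at h2
        simp only [Function.comp_apply, simple_lo] at h2 hG
        exact hG.ne' h2
      have hne : tabFun hN s ≠ tabFun hN t := fun e => by rw [← e, ih2] at h0; exact hG.ne (by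
        have h2 := congrFun (hts.symm.trans e.symm) (lo i)
        simp only [Function.comp_apply, simple_lo] at h2 ⊢
        rw [h2])
      rw [rho_mul_apply, Finset.sum_eq_single_of_mem (tabFun hN s) (Finset.mem_univ _)]
      · rw [ih2, one_mul, rho_g, if_neg hne.symm, if_pos hts, mul_zero, zero_add, mul_one, dG]
        split_ifs with h1 h2
        · rfl
        · rw [not_not] at h1
          exact absurd (congrArg valKey (Prod.ext h2 h1)) hG.ne
        · rfl
      · intro f₁ _ hf₁
        rw [rho_g]
        by_cases e1 : tabFun hN t = f₁
        · rw [← e1, h0, zero_mul]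
        · rw [if_neg e1, if_neg, mul_zero, mul_zero, add_zero, mul_zero]
          intro e2
          apply hf₁
          rw [hts] at e2
          have := congrArg (fun f => f ∘ simple i) e2
          simp only [comp_simple_simple] at this
          exact this.symm

end StandardSequences

/-! ### The permutations of the blocks -/

section BlockPermutations

variable {k n : ℕ} {lam : Fin k → YoungDiagram} (h : ∑ i, (lam i).card = n)

/-- The permutation of the nodes induced by a permutation of equal components. -/
def nodePerm {w : Equiv.Perm (Fin k)} (hw : ∀ i, lam (w i) = lam i) : Equiv.Perm (Node lam) where
  toFun x := ⟨(w x.comp, x.row, x.col), by change (x.row, x.col) ∈ lam (w x.comp); rw [hw]; exact x.mem⟩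
  invFun x := ⟨(w.symm x.comp, x.row, x.col), by
    change (x.row, x.col) ∈ lam (w.symm x.comp)
    rw [← hw, Equiv.apply_symm_apply]; exact x.mem⟩
  left_inv x := Node.ext' (Equiv.symm_apply_apply _ _) rfl rfl
  right_inv x := Node.ext' (Equiv.apply_symm_apply _ _) rfl rfl

theorem comp_mono {x y : Fin n} (hxy : x ≤ y) : (initTab h x).comp ≤ (initTab h y).comp := by
  rcases hxy.eq_or_lt with rfl | hxy
  · rfl
  · rw [← initTab_lt_iff h, Node.lt_iff] at hxy
    rcases hxy with h1 | h1
    · exact h1.le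
    · exact h1.1.le

/-- If only equal components are permuted, moving the nodes along keeps the order inside the blocks;
this is the characterisation of the stable sort in the definition of `blockPerm`. -/
theorem blockPerm_eq {w : Equiv.Perm (Fin k)} (hw : ∀ i, lam (w i) = lam i) :
    blockPerm h w = (initTab h).trans ((nodePerm hw).trans (initTab h).symm) := by
  have : ((initTab h).trans ((nodePerm hw).trans (initTab h).symm)).symm =
      Tuple.sort fun x => w (initTab h x).comp := by
    rw [Tuple.eq_sort_iff]
    have key : ∀ x, w (initTab h
        (((initTab h).trans ((nodePerm hw).trans (initTab h).symm)).symm x)).comp =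
          (initTab h x).comp := by
      intro x
      simp only [Equiv.symm_trans_apply, Equiv.symm_symm, Equiv.apply_symm_apply]
      exact Equiv.apply_symm_apply _ _
    constructor
    · intro x y hxy
      simp only [Function.comp_apply, key]
      exact comp_mono h hxy
    · intro x y hxy he
      simp only [key] at he
      rw [← initTab_lt_iff h, Node.lt_iff] at hxy ⊢
      simp only [Equiv.symm_trans_apply, Equiv.symm_symm, Equiv.apply_symm_apply]
      refine Or.inr ⟨congrArg w.symm he, ?_⟩
      rw [he] at hxy
      simp only [lt_irrefl, true_and, false_or] at hxy
      exact hxy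
  rw [blockPerm, ← this, Equiv.symm_symm]

theorem initTab_blockPerm {w : Equiv.Perm (Fin k)} (hw : ∀ i, lam (w i) = lam i) (x : Fin n) :
    (initTab h (blockPerm h w x)).comp = w (initTab h x).comp ∧
      (initTab h (blockPerm h w x)).row = (initTab h x).row ∧
      (initTab h (blockPerm h w x)).col = (initTab h x).col := by
  rw [blockPerm_eq h hw]
  simp only [Equiv.trans_apply, Equiv.apply_symm_apply]
  exact ⟨rfl, rfl, rfl⟩

theorem symm_fixes {w : Equiv.Perm (Fin k)} (hw : ∀ i, lam (w i) = lam i) (i : Fin k) :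
    lam (w.symm i) = lam i := by rw [← hw, Equiv.apply_symm_apply]

theorem mul_fixes {v w : Equiv.Perm (Fin k)} (hv : ∀ i, lam (v i) = lam i)
    (hw : ∀ i, lam (w i) = lam i) (i : Fin k) : lam ((v * w) i) = lam i := by
  rw [Equiv.Perm.mul_apply, hv, hw]

theorem blockPerm_mul {v w : Equiv.Perm (Fin k)} (hv : ∀ i, lam (v i) = lam i)
    (hw : ∀ i, lam (w i) = lam i) : blockPerm h (v * w) = blockPerm h v * blockPerm h w := by
  ext x
  congr 1
  apply (initTab h).injective
  obtain ⟨a1, a2, a3⟩ := initTab_blockPerm h (mul_fixes hv hw) x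
  obtain ⟨b1, b2, b3⟩ := initTab_blockPerm h hw x
  obtain ⟨c1, c2, c3⟩ := initTab_blockPerm h hv (blockPerm h w x)
  apply Node.ext'
  · rw [a1, Equiv.Perm.mul_apply, Equiv.Perm.mul_apply, c1, b1]
  · rw [a2, Equiv.Perm.mul_apply, c2, b2]
  · rw [a3, Equiv.Perm.mul_apply, c3, b3]

theorem blockPerm_symm {w : Equiv.Perm (Fin k)} (hw : ∀ i, lam (w i) = lam i) :
    blockPerm h w.symm = (blockPerm h w).symm := by
  have h1 := blockPerm_mul h hw (symm_fixes hw)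
  have h2 : w * w.symm = 1 := by ext x; simp
  have h3 : blockPerm h (1 : Equiv.Perm (Fin k)) = 1 := by
    ext x
    congr 1
    apply (initTab h).injective
    obtain ⟨a1, a2, a3⟩ := initTab_blockPerm h (w := 1) (fun _ => rfl) x
    exact Node.ext' a1 a2 a3
  rw [h2, h3] at h1
  exact (eq_inv_of_mul_eq_one_right h1.symm)

theorem blockPerm_lt {w : Equiv.Perm (Fin k)} (hw : ∀ i, lam (w i) = lam i) {x y : Fin n}
    (he : (initTab h x).comp = (initTab h y).comp) :
    blockPerm h w x < blockPerm h w y ↔ x < y := by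
  obtain ⟨a1, a2, a3⟩ := initTab_blockPerm h hw x
  obtain ⟨b1, b2, b3⟩ := initTab_blockPerm h hw y
  rw [← initTab_lt_iff h, ← initTab_lt_iff h, Node.lt_iff, Node.lt_iff, a1, a2, a3, b1, b2, b3, he]
  simp

theorem rowKey_blockPerm {w : Equiv.Perm (Fin k)} (hw : ∀ i, lam (w i) = lam i) {x y : Fin n} :
    rowKey h (blockPerm h w x) = rowKey h (blockPerm h w y) ↔ rowKey h x = rowKey h y := by
  obtain ⟨a1, a2, -⟩ := initTab_blockPerm h hw x
  obtain ⟨b1, b2, -⟩ := initTab_blockPerm h hw y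
  simp only [rowKey, Prod.mk.injEq, a1, a2, b1, b2, w.injective.eq_iff]

/-- The conjugate of a permutation by a permutation of the blocks. -/
def blockConj (w : Equiv.Perm (Fin k)) (v : Equiv.Perm (Fin n)) : Equiv.Perm (Fin n) :=
  blockPerm h w * v * (blockPerm h w)⁻¹

theorem blockConj_apply (w : Equiv.Perm (Fin k)) (v : Equiv.Perm (Fin n)) (x : Fin n) :
    blockConj h w v (blockPerm h w x) = blockPerm h w (v x) := by
  simp [blockConj]

theorem blockConj_mem_young {w : Equiv.Perm (Fin k)} (hw : ∀ i, lam (w i) = lam i)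
    {v : Equiv.Perm (Fin n)} : blockConj h w v ∈ young h ↔ v ∈ young h := by
  rw [mem_young, mem_young, ← (blockPerm h w).forall_congr_right]
  simp only [blockConj_apply, rowKey_blockPerm h hw]

/-- Inversions of an element of the row stabiliser lie inside rows, and the block permutation is
increasing there, so it carries inversions to inversions. -/
theorem len_blockConj {w : Equiv.Perm (Fin k)} (hw : ∀ i, lam (w i) = lam i)
    {v : Equiv.Perm (Fin n)} (hv : v ∈ young h) : len (blockConj h w v) = len v := by
  rw [len_eq_card_inversions, len_eq_card_inversions]
  symm
  have hv' := (mem_young h).1 hv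
  refine Finset.card_equiv ((blockPerm h w).prodCongr (blockPerm h w)) fun p => ?_
  rw [mem_inversions, mem_inversions]
  simp only [Equiv.prodCongr_apply, Prod.map_fst, Prod.map_snd, blockConj_apply]
  by_cases hr : rowKey h p.1 = rowKey h p.2
  · rw [blockPerm_lt h hw (comp_eq_of_rowKey_eq h hr),
      blockPerm_lt h hw (comp_eq_of_rowKey_eq h (by rw [hv', hv', hr]))]
  · refine iff_of_false (fun h' => hr (rowKey_eq_of_inversion h hv h'.1 h'.2)) fun h' => hr ?_
    rw [← rowKey_blockPerm h hw]
    refine rowKey_eq_of_inversion h ((blockConj_mem_young h hw).2 hv) h'.1 ?_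
    rw [blockConj_apply, blockConj_apply]
    exact h'.2

variable {R : Type*} [CommRing R] (q : Rˣ) {N : ℕ} {h}

theorem Coloured.comp_blockPerm {f : Fin n → Fin N × Fin k} (hf : Coloured h f)
    {w : Equiv.Perm (Fin k)} (hw : ∀ i, lam (w i) = lam i) : Coloured h (f ∘ blockPerm h w) := by
  rw [coloured_iff] at hf ⊢
  intro x y
  rw [Function.comp_apply, Function.comp_apply, ← hf, (initTab_blockPerm h hw x).1,
    (initTab_blockPerm h hw y).1, w.injective.eq_iff]

theorem RowIncr.comp_blockPerm {f : Fin n → Fin N × Fin k} (hf : RowIncr h f)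
    {w : Equiv.Perm (Fin k)} (hw : ∀ i, lam (w i) = lam i) : RowIncr h (f ∘ blockPerm h w) := by
  intro x y hxy hr
  exact hf _ _ ((blockPerm_lt h hw (comp_eq_of_rowKey_eq h hr)).2 hxy) ((rowKey_blockPerm h hw).2 hr)

variable (h)

/-- The image of a permutation of equal components. -/
def blockElt (w : Equiv.Perm (Fin k)) : BT q n := eBlock h q * gPerm q (blockPerm h w)

variable {h}

/-- A block permutation inverts only labels of different blocks. On coloured sequences these have
different colours, so it acts by plain place permutation. -/
theorem rho_blockElt {f : Fin n → Fin N × Fin k} (hf : Coloured h f)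
    {w : Equiv.Perm (Fin k)} (hw : ∀ i, lam (w i) = lam i) :
    rho q N k (blockElt h q w) f = Pi.single (f ∘ blockPerm h w.symm) 1 := by
  rw [blockElt, rho_eBlock_mul q hf, blockPerm_symm h hw]
  refine rho_gPerm_of_inversions q _ f fun x y hxy hwxy => Or.inl fun he => ?_
  exact hwxy.not_gt ((blockPerm_lt h hw ((coloured_iff.1 hf x y).2 he)).2 hxy)

theorem comp_blockPerm_symm {X : Type*} (f : Fin n → X) {w : Equiv.Perm (Fin k)}
    (hw : ∀ i, lam (w i) = lam i) : (f ∘ blockPerm h w) ∘ blockPerm h w.symm = f := by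
  rw [blockPerm_symm h hw]; funext x; simp

theorem comp_blockPerm_symm' {X : Type*} (f : Fin n → X) {w : Equiv.Perm (Fin k)}
    (hw : ∀ i, lam (w i) = lam i) : (f ∘ blockPerm h w.symm) ∘ blockPerm h w = f := by
  rw [blockPerm_symm h hw]; funext x; simp

theorem rho_st_blockElt {f : Fin n → Fin N × Fin k} (hf : Coloured h f)
    {w : Equiv.Perm (Fin k)} (hw : ∀ i, lam (w i) = lam i) :
    rho q N k (st q (blockElt h q w)) f = Pi.single (f ∘ blockPerm h w) 1 := by
  funext f'
  rw [rho_st]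
  by_cases hf' : Coloured h f'
  · rw [rho_blockElt q hf' hw, Pi.single_apply, Pi.single_apply]
    congr 1
    refine propext ⟨fun e => ?_, fun e => ?_⟩
    · rw [e, comp_blockPerm_symm' f' hw]
    · rw [e, comp_blockPerm_symm f hw]
  · rw [blockElt, rho_eBlock_mul_of_not q hf', Pi.zero_apply, Pi.single_apply, if_neg]
    rintro rfl
    exact hf' (hf.comp_blockPerm hw)

theorem rho_mul_congr_row {x x' : BT q n} {f f' : Fin n → Fin N × Fin k}
    (he : rho q N k x f = rho q N k x' f') (z : BT q n) :
    rho q N k (x * z) f = rho q N k (x' * z) f' := by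
  funext f''
  rw [rho_mul_apply, rho_mul_apply, he]

/-- The antisymmetriser commutes with the permutations of the blocks. -/
theorem rho_antisym_mul_of_block {f : Fin n → Fin N × Fin k} (hc : Coloured h f)
    (hf : RowIncr h f) {w : Equiv.Perm (Fin k)} (hw : ∀ i, lam (w i) = lam i) {x : BT q n}
    (hx : ∀ f : Fin n → Fin N × Fin k, Coloured h f →
      rho q N k x f = Pi.single (f ∘ blockPerm h w) 1) (z : BT q n) :
    rho q N k (eBlock h q * antisym h q * (x * z)) f =
      rho q N k (eBlock h q * antisym h q * z) (f ∘ blockPerm h w) := by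
  rw [← mul_assoc]
  apply rho_mul_congr_row
  funext f'
  rw [mul_assoc, rho_eBlock_mul q hc, rho_eBlock_mul q (hc.comp_blockPerm hw),
    rho_antisym_rowIncr q (hf.comp_blockPerm hw), rho_mul_apply]
  simp only [rho_antisym_rowIncr q hf, Finset.sum_mul]
  rw [Finset.sum_comm]
  symm
  -- Conjugation by the block permutation is a length preserving bijection of the row stabiliser, so
  -- the signs match.
  refine Finset.sum_bij (fun v _ => blockConj h w v) ?_ ?_ ?_ ?_
  · intro v hv
    exact (blockConj_mem_young h hw).2 hv
  · intro v _ v' _ he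
    simpa [blockConj] using he
  · intro v hv
    refine ⟨(blockPerm h w)⁻¹ * v * blockPerm h w, ?_, by simp [blockConj, mul_assoc]⟩
    rw [← blockConj_mem_young h hw]
    simpa [blockConj, mul_assoc] using hv
  · intro v hv
    have hcv := hc.comp (symm_mem_young h ((blockConj_mem_young h hw).2 hv))
    rw [Finset.sum_eq_single_of_mem (f ∘ (blockConj h w v).symm) (Finset.mem_univ _)]
    · rw [if_pos rfl, mul_one, hx _ hcv, Pi.single_apply, sgnCoeff, sgnCoeff, len_blockConj h hw hv]
      have : (f ∘ (blockConj h w v).symm) ∘ blockPerm h w = (f ∘ blockPerm h w) ∘ v.symm := by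
        funext x
        simp only [Function.comp_apply]
        congr 1
        rw [Equiv.symm_apply_eq, blockConj_apply, Equiv.apply_symm_apply]
      rw [this]
    · intro f'' _ hne
      rw [if_neg hne, mul_zero, zero_mul]

theorem rho_antisym_mul_blockElt {f : Fin n → Fin N × Fin k} (hc : Coloured h f)
    (hf : RowIncr h f) {w : Equiv.Perm (Fin k)} (hw : ∀ i, lam (w i) = lam i) (z : BT q n) :
    rho q N k (eBlock h q * antisym h q * (blockElt h q w * z)) f =
      rho q N k (eBlock h q * antisym h q * z) (f ∘ blockPerm h w.symm) :=
  rho_antisym_mul_of_block q hc hf (symm_fixes hw) (fun _ hc' => rho_blockElt q hc' hw) z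

theorem rho_antisym_mul_st_blockElt {f : Fin n → Fin N × Fin k} (hc : Coloured h f)
    (hf : RowIncr h f) {w : Equiv.Perm (Fin k)} (hw : ∀ i, lam (w i) = lam i) (z : BT q n) :
    rho q N k (eBlock h q * antisym h q * (st q (blockElt h q w) * z)) f =
      rho q N k (eBlock h q * antisym h q * z) (f ∘ blockPerm h w) :=
  rho_antisym_mul_of_block q hc hf hw (fun _ hc' => rho_st_blockElt q hc' hw) z

end BlockPermutations

/-! ### Content and dominance -/

section Dominance

variable {k n : ℕ} {lam : Fin k → YoungDiagram}

/-- The node in the component `i`, the row `j` and the column `c`. -/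
def Node.of {i : Fin k} {j c : ℕ} (hc : (j, c) ∈ lam i) : Node lam := ⟨(i, (j, c)), hc⟩

theorem card_comp (t : Fin n ≃ Node lam) (i : Fin k) :
    (Finset.univ.filter fun x => (t x).comp = i).card = (lam i).card := by
  refine Finset.card_bij (fun x _ => ((t x).row, (t x).col)) ?_ ?_ ?_
  · intro x hx
    rw [Finset.mem_filter] at hx
    exact hx.2 ▸ (t x).mem
  · intro x hx y hy he
    rw [Finset.mem_filter] at hx hy
    rw [Prod.mk.injEq] at he
    exact t.injective (Node.ext' (hx.2.trans hy.2.symm) he.1 he.2)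
  · intro c hc
    obtain ⟨x, hx⟩ := t.surjective (Node.of hc)
    refine ⟨x, ?_, ?_⟩
    · rw [Finset.mem_filter, hx]
      exact ⟨Finset.mem_univ _, rfl⟩
    · rw [hx]
      rfl

theorem card_comp_row (t : Fin n ≃ Node lam) (i : Fin k) (j : ℕ) :
    (Finset.univ.filter fun x => (t x).comp = i ∧ (t x).row = j).card = (lam i).rowLen j := by
  rw [← Finset.card_range ((lam i).rowLen j)]
  refine Finset.card_bij (fun x _ => (t x).col) ?_ ?_ ?_
  · intro x hx
    rw [Finset.mem_filter] at hx
    rw [Finset.mem_range, ← YoungDiagram.mem_iff_lt_rowLen, ← hx.2.1, ← hx.2.2]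
    exact (t x).mem
  · intro x hx y hy he
    rw [Finset.mem_filter] at hx hy
    exact t.injective (Node.ext' (hx.2.1.trans hy.2.1.symm) (hx.2.2.trans hy.2.2.symm) he)
  · intro c hc
    rw [Finset.mem_range, ← YoungDiagram.mem_iff_lt_rowLen] at hc
    obtain ⟨x, hx⟩ := t.surjective (Node.of hc)
    refine ⟨x, ?_, ?_⟩
    · rw [Finset.mem_filter, hx]
      exact ⟨Finset.mem_univ _, rfl, rfl⟩
    · rw [hx]
      rfl

theorem card_comp_col (t : Fin n ≃ Node lam) (i : Fin k) (c K : ℕ) :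
    (Finset.univ.filter fun x => ((t x).comp = i ∧ (t x).col = c) ∧ (t x).row < K).card =
      min K ((lam i).colLen c) := by
  rw [← Finset.card_range (min K ((lam i).colLen c))]
  refine Finset.card_bij (fun x _ => (t x).row) ?_ ?_ ?_
  · intro x hx
    rw [Finset.mem_filter] at hx
    rw [Finset.mem_range, lt_min_iff, ← YoungDiagram.mem_iff_lt_colLen, ← hx.2.1.1, ← hx.2.1.2]
    exact ⟨hx.2.2, (t x).mem⟩
  · intro x hx y hy he
    rw [Finset.mem_filter] at hx hy
    exact t.injective (Node.ext' (hx.2.1.1.trans hy.2.1.1.symm) he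
      (hx.2.1.2.trans hy.2.1.2.symm))
  · intro j hj
    rw [Finset.mem_range, lt_min_iff, ← YoungDiagram.mem_iff_lt_colLen] at hj
    obtain ⟨x, hx⟩ := t.surjective (Node.of hj.2)
    refine ⟨x, ?_, ?_⟩
    · rw [Finset.mem_filter, hx]
      exact ⟨Finset.mem_univ _, ⟨rfl, rfl⟩, hj.1⟩
    · rw [hx]
      rfl

theorem card_comp_col_all (t : Fin n ≃ Node lam) (i : Fin k) (c : ℕ) :
    (Finset.univ.filter fun x => (t x).comp = i ∧ (t x).col = c).card = (lam i).colLen c := by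
  have := card_comp_col t i c ((lam i).colLen c)
  rw [min_self] at this
  rw [← this]
  congr 1
  ext x
  simp only [Finset.mem_filter, Finset.mem_univ, true_and]
  refine ⟨fun hx => ⟨hx, ?_⟩, fun hx => hx.1⟩
  rw [← YoungDiagram.mem_iff_lt_colLen, ← hx.1, ← hx.2]
  exact (t x).mem

theorem sum_rowLen (t : Fin n ≃ Node lam) (i : Fin k) (K : ℕ) :
    ∑ j ∈ Finset.range K, (lam i).rowLen j =
      (Finset.univ.filter fun x => (t x).comp = i ∧ (t x).row < K).card := by
  rw [Finset.card_eq_sum_card_fiberwise (f := fun x => (t x).row) (t := Finset.range K)]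
  · refine Finset.sum_congr rfl fun j hj => ?_
    rw [← card_comp_row t i j, Finset.filter_filter]
    congr 1
    ext x
    simp only [Finset.mem_filter, Finset.mem_univ, true_and]
    rw [Finset.mem_range] at hj
    constructor
    · rintro ⟨h1, rfl⟩; exact ⟨⟨h1, hj⟩, rfl⟩
    · rintro ⟨⟨h1, -⟩, h2⟩; exact ⟨h1, h2⟩
  · intro x hx
    simpa using (Finset.mem_filter.1 hx).2.2

variable {lam' : Fin k → YoungDiagram} {N : ℕ} {h : ∑ i, (lam i).card = n}
  (hN' : ∀ i, (lam' i).rowLen 0 ≤ N)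

/-- A sequence which increases along the rows of `λ` and which has the content of a tableau of
shape `λ'` forces a dominance relation. -/
theorem dominated_of_rowIncr {f : Fin n → Fin N × Fin k} (hf : RowIncr h f)
    {τ : Equiv.Perm (Fin k)} (hτ : ∀ x, (f x).2 = τ (initTab h x).comp) {t' : Fin n ≃ Node lam'}
    {σ : Equiv.Perm (Fin n)} (hσ : tabFun hN' t' = f ∘ σ) (i : Fin k) :
    (lam i).card = (lam' (τ i)).card ∧ Dominated (lam i) (lam' (τ i)) := by
  constructor
  · rw [← card_comp (initTab h) i, ← card_comp t' (τ i)]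
    symm
    refine Finset.card_equiv σ fun x => ?_
    have e : (t' x).comp = τ (initTab h (σ x)).comp :=
      (Prod.ext_iff.1 (congrFun hσ x)).2.trans (hτ _)
    simp only [Finset.mem_filter, Finset.mem_univ, true_and]
    rw [e, τ.injective.eq_iff]
  · intro K
    rw [sum_rowLen (initTab h), sum_rowLen t',
      Finset.card_eq_sum_card_fiberwise (f := fun x => (f x).1) (t := Finset.univ)
        (fun _ _ => by simp),
      Finset.card_eq_sum_card_fiberwise (s := Finset.univ.filter fun x =>
        (t' x).comp = τ i ∧ (t' x).row < K) (f := fun x => (tabFun hN' t' x).1) (t := Finset.univ)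
        (fun _ _ => by simp)]
    refine Finset.sum_le_sum fun c _ => ?_
    have h1 : (Finset.filter (fun x => (tabFun hN' t' x).1 = c)
        (Finset.univ.filter fun x => (t' x).comp = τ i ∧ (t' x).row < K)).card =
          min K ((lam' (τ i)).colLen c) := by
      rw [← card_comp_col t', Finset.filter_filter]
      congr 1
      ext x
      simp only [Finset.mem_filter, Finset.mem_univ, true_and, tabFun, Fin.ext_iff]
      tauto
    rw [h1, Finset.filter_filter]
    -- Among the first `K` rows of the component, the value `c` occurs at most once per row and at
    -- most as often as in the whole sequence, where it fills the column `c` of the other diagram.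
    -- Summing over `c` gives dominance.
    refine le_min ?_ ?_
    · rw [← Finset.card_range K]
      refine Finset.card_le_card_of_injOn (fun x => (initTab h x).row) ?_ ?_
      · intro x hx
        simpa using (Finset.mem_filter.1 hx).2.1.2
      · intro x hx y hy he
        simp only [Finset.coe_filter, Finset.mem_univ, true_and, Set.mem_ofPred_eq] at hx hy
        refine hf.injOn ?_ (hx.2.trans hy.2.symm)
        simp only [rowKey, Prod.mk.injEq]
        exact ⟨hx.1.1.trans hy.1.1.symm, he⟩
    · rw [← card_comp_col_all t']
      refine Finset.card_le_card_of_injOn σ.symm ?_ (σ.symm.injective.injOn)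
      intro x hx
      simp only [Finset.coe_filter, Finset.mem_univ, true_and, Set.mem_ofPred_eq] at hx ⊢
      have h2 := congrFun hσ (σ.symm x)
      rw [Function.comp_apply, Equiv.apply_symm_apply, Prod.ext_iff, hτ, hx.1.1, hx.2] at h2
      exact ⟨h2.2, congrArg Fin.val h2.1⟩

/-- Values that strictly increase along a row are at least the column index, which starts at 0. -/
theorem RowIncr.col_le {f : Fin n → Fin N × Fin k} (hf : RowIncr h f) (x : Fin n) :
    (initTab h x).col ≤ (f x).1 := by
  induction hc : (initTab h x).col generalizing x with
  | zero => exact Nat.zero_le _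
  | succ c ih =>
    have hmem : ((initTab h x).row, c) ∈ lam (initTab h x).comp :=
      (lam _).up_left_mem le_rfl (by omega) (initTab h x).mem
    obtain ⟨y, hy⟩ := (initTab h).surjective ⟨((initTab h x).comp, (initTab h x).row, c), hmem⟩
    have hr : rowKey h y = rowKey h x := by rw [rowKey, hy]; rfl
    have h1 : y < x := by
      rw [← initTab_lt_iff h, Node.lt_iff, hy]
      exact Or.inr ⟨rfl, Or.inr ⟨rfl, by rw [hc]; exact Nat.lt_succ_self c⟩⟩
    have h2 := ih y (by rw [hy]; rfl)
    have h3 : ((f y).1 : ℕ) < (f x).1 := hf y x h1 hr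
    omega

/-- A sequence which increases along the rows of `λ` and which has the content of a tableau of
shape `λ` is the initial one, up to a permutation of the colours. -/
theorem eq_recolour_initTab {f : Fin n → Fin N × Fin k} (hN : ∀ i, (lam i).rowLen 0 ≤ N)
    (hf : RowIncr h f)
    {τ : Equiv.Perm (Fin k)} (hτ : ∀ x, (f x).2 = τ (initTab h x).comp) {t' : Fin n ≃ Node lam}
    {σ : Equiv.Perm (Fin n)} (hσ : tabFun hN t' = f ∘ σ) :
    f = recolour τ (tabFun hN (initTab h)) := by
  -- Equal contents give equal sums, so each of the inequalities `RowIncr.col_le` is an equality.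
  have h1 : ∑ x, (initTab h x).col = ∑ x, ((f x).1 : ℕ) := by
    rw [(initTab h).sum_comp (fun z => z.col), ← Equiv.sum_comp σ (fun x => ((f x).1 : ℕ)),
      ← t'.sum_comp]
    refine Finset.sum_congr rfl fun x _ => ?_
    exact congrArg (fun z => (z.1 : ℕ)) (congrFun hσ x)
  have h2 := (Finset.sum_eq_sum_iff_of_le fun x _ => hf.col_le x).1 h1
  funext x
  exact Prod.ext (Fin.ext (h2 x (Finset.mem_univ x)).symm) (hτ x)

/-- The inequalities can be followed around a cycle of the permutation back to the starting point.
-/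
theorem eq_of_le_perm {X : Type*} [PartialOrder X] {F : Fin k → X} {τ : Equiv.Perm (Fin k)}
    (hF : ∀ i, F i ≤ F (τ i)) (i : Fin k) : F (τ i) = F i := by
  have h1 : ∀ (m : ℕ) i, F i ≤ F ((τ ^ m) i) := by
    intro m
    induction m with
    | zero => intro i; simp
    | succ m ih =>
      intro i
      rw [pow_succ, Equiv.Perm.mul_apply]
      exact (hF i).trans (ih _)
  refine le_antisymm ?_ (hF i)
  have h2 := h1 (orderOf τ - 1) (τ i)
  rwa [← Equiv.Perm.mul_apply, ← pow_succ, Nat.sub_add_cancel (orderOf_pos τ), pow_orderOf_eq_one,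
    Equiv.Perm.one_apply] at h2

/-- If `F' i < F i`, then the permutation would map all indices from `i` on into the indices
strictly after `i`. -/
theorem le_of_le_perm {X : Type*} [LinearOrder X] {F F' : Fin k → X} (h1 : Monotone F)
    (h2 : Monotone F') {τ : Equiv.Perm (Fin k)} (hF : ∀ i, F i ≤ F' (τ i)) (i : Fin k) :
    F i ≤ F' i := by
  by_contra hcon
  rw [not_le] at hcon
  have h3 : ((Finset.Ici i).map τ.toEmbedding) ⊆ Finset.Ioi i := by
    intro y hy
    rw [Finset.mem_map] at hy
    obtain ⟨j, hj, rfl⟩ := hy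
    rw [Finset.mem_Ici] at hj
    rw [Finset.mem_Ioi]
    by_contra hle
    exact absurd ((h1 hj).trans ((hF j).trans (h2 (not_lt.1 hle)))) hcon.not_ge
  have h4 := Finset.card_le_card h3
  rw [Finset.card_map, Fin.card_Ici, Fin.card_Ioi] at h4
  omega

/-- The colours of a coloured sequence are a permutation of the components. -/
theorem Coloured.exists_perm {f : Fin n → Fin N × Fin k} (hf : Coloured h f)
    (hs : Function.Surjective fun x => (initTab h x).comp) :
    ∃ τ : Equiv.Perm (Fin k), ∀ x, (f x).2 = τ (initTab h x).comp := by
  rw [coloured_iff] at hf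
  choose x hx using hs
  have hinj : Function.Injective fun i => (f (x i)).2 := by
    intro i j hij
    have := (hf _ _).2 hij
    exact (hx i).symm.trans (this.trans (hx j))
  refine ⟨Equiv.ofBijective _ (Finite.injective_iff_bijective.1 hinj), fun y => ?_⟩
  exact (hf _ _).1 (hx _).symm

end Dominance

/-! ### The pairing of the dual cellular basis with the tensor space -/

section ShapeOrder

variable {le : YoungDiagram → YoungDiagram → Prop}

/-- The Young diagrams with the given total order. -/
def OrdShape (_ : ExtendsDominance le) : Type := YoungDiagram

open Classical in
instance (hle : ExtendsDominance le) : LinearOrder (OrdShape hle) where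
  le a b := le a b
  le_refl := hle.refl
  le_trans := hle.trans
  le_antisymm := hle.antisymm
  le_total := hle.total
  toDecidableLE := Classical.decRel _

/-- A Young diagram as an element of the totally ordered set of the Young diagrams. -/
def toOrd (hle : ExtendsDominance le) (μ : YoungDiagram) : OrdShape hle := μ

theorem toOrd_le {hle : ExtendsDominance le} {μ ν : YoungDiagram} :
    toOrd hle μ ≤ toOrd hle ν ↔ le μ ν := Iff.rfl

theorem toOrd_injective (hle : ExtendsDominance le) : Function.Injective (toOrd hle) :=
  fun _ _ h => h

end ShapeOrder

/-! ### The effect of permuting equal components on the key of a tableau -/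

section SeqKey

variable {k n : ℕ} {lam : Fin k → YoungDiagram}

/-- The sequence of the components and the columns of the labels of a multitableau, in the
lexicographic order. -/
def seqKey (t : Fin n ≃ Node lam) : Lex (Fin n → ℕ ×ₗ ℕᵒᵈ) :=
  toLex fun x => toLex (((t x).comp : ℕ), OrderDual.toDual (t x).col)

variable {N : ℕ} (hN : ∀ i, (lam i).rowLen 0 ≤ N)

theorem seqKey_eq (t : Fin n ≃ Node lam) : seqKey t = toLex (valKey ∘ tabFun hN t) := rfl

theorem seqKey_injOn {t t' : Fin n ≃ Node lam} (ht : IsStd t) (ht' : IsStd t')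
    (he : seqKey t = seqKey t') : t = t' := by
  -- The key does not involve the number of values, so any common bound for the rows will do.
  have hN : ∀ i, (lam i).rowLen 0 ≤ ∑ i, (lam i).rowLen 0 := fun i =>
    Finset.single_le_sum (f := fun i => (lam i).rowLen 0) (fun _ _ => Nat.zero_le _)
      (Finset.mem_univ i)
  refine tabFun_injOn hN ht ht' ?_
  rw [seqKey_eq hN, seqKey_eq hN] at he
  funext x
  exact valKey_injective (congrFun (toLex.injective he) x)

/-- A permutation of equal components increases the key of a tableau in which equal components
are ordered by their least labels. -/
theorem seqKey_lt_recolour {t : Fin n ≃ Node lam}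
    (hincr : ∀ i j, lam i = lam j → (i < j ↔ minLabel t i < minLabel t j))
    (hs : Function.Surjective fun x => (t x).comp) {τ : Equiv.Perm (Fin k)}
    (hτ : ∀ i, lam (τ i) = lam i) (hne : τ ≠ 1) :
    seqKey t < toLex (valKey ∘ recolour τ (tabFun hN t)) := by
  have hex : ∃ x, τ (t x).comp ≠ (t x).comp := by
    by_contra hcon
    push Not at hcon
    apply hne
    ext i
    obtain ⟨x, rfl⟩ := hs i
    simp [hcon x]
  -- At the first label whose component is moved, the new component contains no earlier label,
  -- because the components of earlier labels are fixed. So its least label is later, and the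
  -- ordering of equal components makes it the larger component.
  obtain ⟨x, hx, hmin⟩ := WellFounded.has_min (wellFounded_lt (α := Fin n))
    {x | τ (t x).comp ≠ (t x).comp} hex
  have hmin' : ∀ y < x, τ (t y).comp = (t y).comp := fun y hy => by
    by_contra hcon
    exact hmin y hcon hy
  refine ⟨x, fun y hy => ?_, ?_⟩
  · change valKey (tabFun hN t y) = valKey (recolour τ (tabFun hN t) y)
    congr 1
    exact Prod.ext rfl (hmin' y hy).symm
  · change valKey (tabFun hN t x) < valKey (recolour τ (tabFun hN t) x)
    rw [valKey_lt_iff]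
    left
    change (t x).comp < τ (t x).comp
    rw [hincr _ _ (hτ _).symm]
    obtain ⟨z, hz⟩ := hs (τ (t x).comp)
    obtain ⟨y, hy⟩ := Finset.min_of_nonempty
      (s := Finset.univ.filter fun y => (t y).comp = τ (t x).comp)
      ⟨z, Finset.mem_filter.2 ⟨Finset.mem_univ _, hz⟩⟩
    have hy' := Finset.mem_of_min hy
    rw [Finset.mem_filter] at hy'
    have h1 : minLabel t (t x).comp ≤ x := Finset.min_le (by simp)
    refine h1.trans_lt ?_
    rw [minLabel, hy, WithTop.coe_lt_coe]
    rcases lt_trichotomy x y with h2 | h2 | h2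
    · exact h2
    · subst h2; exact absurd hy'.2.symm hx
    · have := hmin' y h2
      rw [hy'.2] at this
      exact absurd (τ.injective this) hx

theorem seqKey_le_recolour {t : Fin n ≃ Node lam}
    (hincr : ∀ i j, lam i = lam j → (i < j ↔ minLabel t i < minLabel t j))
    (hs : Function.Surjective fun x => (t x).comp) {τ : Equiv.Perm (Fin k)}
    (hτ : ∀ i, lam (τ i) = lam i) :
    seqKey t ≤ toLex (valKey ∘ recolour τ (tabFun hN t)) := by
  by_cases hne : τ = 1
  · subst hne; exact le_rfl
  · exact (seqKey_lt_recolour hN hincr hs hτ hne).le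

end SeqKey

/-! ### Pairing of elements with the same multipartition -/

section SameShape

variable {le : YoungDiagram → YoungDiagram → Prop} {k n : ℕ} {lam : Fin k → YoungDiagram}
  {h : ∑ i, (lam i).card = n} {N : ℕ} (hN : ∀ i, (lam i).rowLen 0 ≤ N)
  {R : Type*} [CommRing R] (q : Rˣ)

theorem comp_surjective {t t' : Fin n ≃ Node lam}
    (hs : Function.Surjective fun x => (t x).comp) : Function.Surjective fun x => (t' x).comp := by
  intro i
  obtain ⟨x, hx⟩ := hs i
  obtain ⟨y, hy⟩ := t'.surjective (t x)
  exact ⟨y, by change (t' y).comp = i; rw [hy]; exact hx⟩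

variable (h) in
/-- The element `𝔼_λ y_λ g_{d(t)}`. -/
def stdElt (t : Fin n ≃ Node lam) : BT q n :=
  eBlock h q * antisym h q * gPerm q (dPerm h t)

theorem recolour_mul {X : Type*} {r : ℕ} (τ ρ : Equiv.Perm (Fin r)) (f : X → Fin N × Fin r) :
    recolour (τ * ρ) f = recolour τ (recolour ρ f) := rfl

theorem rho_stdElt_self {t : Fin n ≃ Node lam} (ht : IsStd t) (τ : Equiv.Perm (Fin k)) :
    rho q N k (stdElt h q t) (recolour τ (tabFun hN (initTab h))) (recolour τ (tabFun hN t)) =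
      1 := by
  rw [rho_recolour, stdElt, mul_assoc, rho_eBlock_mul q (coloured_initTab h hN)]
  exact (rho_antisym_gPerm_dPerm h hN q ht).2

/-- After the common recolouring is removed, the entry is nonzero only below the sequence of `t`. A
remaining recolouring strictly raises the key of `t'`, so equality of the keys leaves none. -/
theorem seqKey_of_rho_stdElt {t t' : Fin n ≃ Node lam} (ht : IsStd t)
    (hincr : ∀ i j, lam i = lam j → (i < j ↔ minLabel t' i < minLabel t' j))
    (hs : Function.Surjective fun x => (t' x).comp) {τ ρ : Equiv.Perm (Fin k)}
    (hτ : ∀ i, lam (τ i) = lam i) (hρ : ∀ i, lam (ρ i) = lam i)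
    (hne : rho q N k (stdElt h q t) (recolour τ (tabFun hN (initTab h)))
      (recolour ρ (tabFun hN t')) ≠ 0) :
    seqKey t' ≤ seqKey t ∧ (seqKey t' = seqKey t → τ = ρ) := by
  have e : ρ = τ * (τ⁻¹ * ρ) := by simp
  rw [e, recolour_mul, rho_recolour, stdElt, mul_assoc,
    rho_eBlock_mul q (coloured_initTab h hN)] at hne
  have h1 := ((rho_antisym_gPerm_dPerm h hN q ht).1 _ hne).toLex_le
  rw [← seqKey_eq] at h1
  have hfix : ∀ i, lam ((τ⁻¹ * ρ) i) = lam i := mul_fixes (symm_fixes hτ) hρ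
  refine ⟨(seqKey_le_recolour hN hincr hs hfix).trans h1, fun he => ?_⟩
  by_contra hcon
  refine absurd ((seqKey_lt_recolour hN hincr hs hfix ?_).trans_le h1) he.not_lt
  intro e'
  exact hcon (inv_mul_eq_one.1 e')

/-- Dominance gives inequalities between each component and its image under a permutation of the
components, which must all be equalities. An increasing sequence with the content of its own shape
is then the initial one. -/
theorem exists_recolour_of_rho_stdElt (hle : ExtendsDominance le) {t t' : Fin n ≃ Node lam}
    (hs : Function.Surjective fun x => (t' x).comp) {f₀ : Fin n → Fin N × Fin k}
    (hc : Coloured h f₀) (hf : RowIncr h f₀)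
    (hne : rho q N k (stdElt h q t) f₀ (tabFun hN t') ≠ 0) :
    ∃ τ : Equiv.Perm (Fin k), (∀ i, lam (τ i) = lam i) ∧
      f₀ = recolour τ (tabFun hN (initTab h)) := by
  obtain ⟨τ, hτ⟩ := hc.exists_perm (comp_surjective hs)
  obtain ⟨σ, hσ⟩ := exists_perm_of_rho_ne_zero q hne
  refine ⟨τ, fun i => ?_, eq_recolour_initTab hN hf hτ hσ⟩
  refine toOrd_injective hle (eq_of_le_perm (F := fun i => toOrd hle (lam i)) (fun i => ?_) i)
  obtain ⟨h1, h2⟩ := dominated_of_rowIncr hN hf hτ hσ i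
  exact hle.extends_dominance _ _ h1 h2

theorem recolour_comp_blockPerm {τ π : Equiv.Perm (Fin k)} (hπ : ∀ i, lam (π i) = lam i) :
    recolour τ (tabFun hN (initTab h)) ∘ blockPerm h π =
      recolour (τ * π) (tabFun hN (initTab h)) := by
  funext x
  obtain ⟨h1, -, h3⟩ := initTab_blockPerm h hπ x
  exact Prod.ext (Fin.ext h3) (by simp [recolour, tabFun, h1])

open Classical in
theorem pairing_ne_zero (hle : ExtendsDominance le) {ι : Type*} {W : Finset ι} {c : ι → R}
    {π : ι → Equiv.Perm (Fin k)} (hπ : ∀ w ∈ W, ∀ i, lam (π w i) = lam i)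
    {x : BT q n} {t₁ t₂ t₁' t₂' : Fin n ≃ Node lam} (h₁ : IsStd t₁) (h₂ : IsStd t₂)
    (hx : ∀ f f', rho q N k x f f' =
      ∑ f₀ : Fin n → Fin N × Fin k with Coloured h f₀ ∧ RowIncr h f₀,
        rho q N k (stdElt h q t₁) f₀ f *
          ∑ w ∈ W, c w * rho q N k (stdElt h q t₂) (f₀ ∘ blockPerm h (π w)) f')
    (hincr₁ : ∀ i j, lam i = lam j → (i < j ↔ minLabel t₁' i < minLabel t₁' j))
    (hincr₂ : ∀ i j, lam i = lam j → (i < j ↔ minLabel t₂' i < minLabel t₂' j))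
    (hs : Function.Surjective fun x => (initTab h x).comp) {σ : Equiv.Perm (Fin k)}
    (hσ : ∀ i, lam (σ i) = lam i)
    (hne : rho q N k x (tabFun hN t₁') (recolour σ (tabFun hN t₂')) ≠ 0) :
    seqKey t₁' ≤ seqKey t₁ ∧ seqKey t₂' ≤ seqKey t₂ := by
  rw [hx] at hne
  obtain ⟨f₀, hf₀, h3⟩ := Finset.exists_ne_zero_of_sum_ne_zero hne
  rw [Finset.mem_filter] at hf₀
  have h4 := left_ne_zero_of_mul h3
  obtain ⟨w, hw, h5⟩ := Finset.exists_ne_zero_of_sum_ne_zero (right_ne_zero_of_mul h3)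
  have h6 := right_ne_zero_of_mul h5
  obtain ⟨τ, hτ, rfl⟩ := exists_recolour_of_rho_stdElt hN q hle (comp_surjective hs) hf₀.2.1
    hf₀.2.2 h4
  rw [recolour_comp_blockPerm hN (hπ w hw)] at h6
  refine ⟨(seqKey_of_rho_stdElt hN q h₁ hincr₁ (comp_surjective hs) (τ := τ) (ρ := 1) hτ
    (fun _ => rfl) h4).1, (seqKey_of_rho_stdElt hN q h₂ hincr₂ (comp_surjective hs)
      (mul_fixes hτ (hπ w hw)) hσ h6).1⟩

open Classical in
-- In the first factor only the initial sequence survives, with its colours unchanged; in the second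
-- factor the colours then force `π w = σ`.
theorem pairing_self (hle : ExtendsDominance le) {ι : Type*} {W : Finset ι} {c : ι → R}
    {π : ι → Equiv.Perm (Fin k)} (hπ : ∀ w ∈ W, ∀ i, lam (π w i) = lam i)
    {x : BT q n} {t₁ t₂ : Fin n ≃ Node lam} (h₁ : IsStd t₁) (h₂ : IsStd t₂)
    (hx : ∀ f f', rho q N k x f f' =
      ∑ f₀ : Fin n → Fin N × Fin k with Coloured h f₀ ∧ RowIncr h f₀,
        rho q N k (stdElt h q t₁) f₀ f *
          ∑ w ∈ W, c w * rho q N k (stdElt h q t₂) (f₀ ∘ blockPerm h (π w)) f')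
    (hincr₁ : ∀ i j, lam i = lam j → (i < j ↔ minLabel t₁ i < minLabel t₁ j))
    (hincr₂ : ∀ i j, lam i = lam j → (i < j ↔ minLabel t₂ i < minLabel t₂ j))
    (hs : Function.Surjective fun x => (initTab h x).comp) {σ : Equiv.Perm (Fin k)}
    (hσ : ∀ i, lam (σ i) = lam i) :
    rho q N k x (tabFun hN t₁) (recolour σ (tabFun hN t₂)) =
      ∑ w ∈ W, if π w = σ then c w else 0 := by
  rw [hx, Finset.sum_eq_single_of_mem (tabFun hN (initTab h))]
  · have h3 : rho q N k (stdElt h q t₁) (tabFun hN (initTab h)) (tabFun hN t₁) = 1 :=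
      rho_stdElt_self hN q h₁ 1
    rw [h3, one_mul]
    refine Finset.sum_congr rfl fun w hw => ?_
    have h4 : tabFun hN (initTab h) ∘ blockPerm h (π w) =
        recolour (π w) (tabFun hN (initTab h)) := recolour_comp_blockPerm hN (τ := 1) (hπ w hw)
    rw [h4]
    split_ifs with h5
    · rw [← h5, rho_stdElt_self hN q h₂, mul_one]
    · by_contra hne
      exact h5 ((seqKey_of_rho_stdElt hN q h₂ hincr₂ (comp_surjective hs) (hπ w hw) hσ
        (right_ne_zero_of_mul hne)).2 rfl)
  · rw [Finset.mem_filter]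
    exact ⟨Finset.mem_univ _, coloured_initTab h hN, rowIncr_initTab h hN⟩
  · intro f₀ hf₀ hne
    rw [Finset.mem_filter] at hf₀
    by_contra h3
    have h4 := left_ne_zero_of_mul h3
    obtain ⟨τ, hτ, rfl⟩ := exists_recolour_of_rho_stdElt hN q hle (comp_surjective hs) hf₀.2.1
      hf₀.2.2 h4
    apply hne
    have := (seqKey_of_rho_stdElt hN q h₁ hincr₁ (comp_surjective hs) (τ := τ) (ρ := 1) hτ
      (fun _ => rfl) h4).2 rfl
    rw [this]
    rfl

end SameShape

/-! ### The signed sums for the tableaux of μ, via the parameter 1 -/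

section SignedSum

variable {le : YoungDiagram → YoungDiagram → Prop} {k n : ℕ} {mu mu' : Fin k → YoungDiagram}
  {h : ∑ i, (mu i).card = n} {h' : ∑ i, (mu' i).card = n} {N : ℕ}
  (hN : ∀ i, (mu i).rowLen 0 ≤ N) (hN' : ∀ i, (mu' i).rowLen 0 ≤ N) (R : Type*) [CommRing R]

/-- For the parameter 1 the diagonal coefficient vanishes unless the two entries coincide, and then
the swap is trivial. -/
theorem rho_gPerm_one (w : Equiv.Perm (Fin n)) (f : Fin n → Fin N × Fin k) :
    rho (1 : Rˣ) N k (gPerm 1 w) f = Pi.single (f ∘ w.symm) 1 := by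
  induction w using perm_induction with
  | one => rw [gPerm_refl, rho_one_row]; rfl
  | step w i hi' ih =>
    rw [gPerm_trans_simple _ hi', rho_mul_of_row _ ih]
    funext f'
    rw [rho_g, Pi.single_apply]
    generalize hF : f ∘ w.symm = F
    have hF' : f ∘ (w.trans (simple i)).symm = F ∘ simple i := by rw [← hF]; rfl
    rw [hF']
    by_cases e : F (lo i) = F (hi i)
    · have : F ∘ simple i = F := by
        funext x
        by_cases h1 : x = lo i
        · rw [h1, Function.comp_apply, simple_lo, e]
        by_cases h2 : x = hi i
        · rw [h2, Function.comp_apply, simple_hi, e]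
        · rw [Function.comp_apply, simple_of_ne i x h1 h2]
      rw [this, e]
      simp [cG, dG]
    · have h1 : cG (1 : Rˣ) (F (lo i)) (F (hi i)) = 0 := by
        simp only [cG, Units.val_one, inv_one, sub_self]
        split_ifs with h1 h2
        · rfl
        · exact absurd (Prod.ext h2 (not_not.1 h1)) e
        · rfl
        · rfl
      have h2 : dG R (F (lo i)) (F (hi i)) = 1 := by
        simp only [dG]
        split_ifs with h1 h2
        · rfl
        · exact absurd (Prod.ext h2 (not_not.1 h1)) e
        · rfl
      rw [h1, h2]
      simp

theorem sgnCoeff_one (w : Equiv.Perm (Fin n)) : sgnCoeff (1 : Rˣ) w = (-1) ^ len w := by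
  rw [sgnCoeff, zpow_neg, zpow_natCast, ← inv_pow, inv_neg, inv_one]
  simp

open Classical in
/-- The pairing of the signed sums over Young subgroups with a pair of tableaux. -/
def signedSum (h : ∑ i, (mu i).card = n) (hN' : ∀ i, (mu' i).rowLen 0 ≤ N)
    (u₁ u₂ : Fin n ≃ Node mu) (u₁' u₂' : Fin n ≃ Node mu') : R :=
  ∑ w ∈ young h, if tabFun hN' u₁' ∘ (dPerm h u₁ * w⁻¹ * (dPerm h u₂)⁻¹ : Equiv.Perm (Fin n)) =
    tabFun hN' u₂' then (-1) ^ len w else 0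

variable {u₁ u₂ : Fin n ≃ Node mu} {u₁' u₂' : Fin n ≃ Node mu'}

theorem comp_dPerm {u : Fin n ≃ Node mu} (hu : ∀ i, (u i).comp = (initTab h i).comp) (x : Fin n) :
    (initTab h (dPerm h u x)).comp = (initTab h x).comp := by
  rw [← hu, dPerm, Equiv.trans_apply, Equiv.apply_symm_apply]

open Classical in
-- For the parameter 1 the signed sum is an entry of the antisymmetriser of μ between two
-- permutations. Hence `rho_sandwich` applies, and the arguments for the tableaux of λ can be
-- repeated for those of μ.
theorem signedSum_eq (hγ : ∀ x, (initTab h x).comp = (initTab h' x).comp)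
    (hu₁ : ∀ i, (u₁ i).comp = (initTab h i).comp)
    (hu₁' : ∀ i, (u₁' i).comp = (initTab h' i).comp) :
    signedSum R h hN' u₁ u₂ u₁' u₂' =
      ∑ f₀ : Fin n → Fin N × Fin k with Coloured h f₀ ∧ RowIncr h f₀,
        rho 1 N k (stdElt h (1 : Rˣ) u₁) f₀ (tabFun hN' u₁') *
          rho 1 N k (stdElt h (1 : Rˣ) u₂) f₀ (tabFun hN' u₂') := by
  have key := rho_sandwich (h := h) (N := N) (1 : Rˣ) (gPerm 1 (dPerm h u₁))
    (gPerm 1 (dPerm h u₂)) (tabFun hN' u₁') (tabFun hN' u₂')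
  refine Eq.trans ?_ key
  have hc : Coloured h (tabFun hN' u₁' ∘ dPerm h u₁) := coloured_iff.2 fun x y => by
    simp only [Function.comp_apply, tabFun, hu₁', ← hγ, comp_dPerm hu₁]
  rw [st_gPerm, mul_assoc, rho_mul_of_row _ (rho_gPerm_one R _ _), Equiv.symm_symm, mul_assoc,
    rho_eBlock_mul _ hc, antisym, Finset.sum_mul, map_sum, Matrix.sum_apply, signedSum]
  refine Finset.sum_congr rfl fun w hw => ?_
  rw [smul_mul_assoc, map_smul, Matrix.smul_apply, rho_mul_of_row _ (rho_gPerm_one R _ _),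
    rho_gPerm_one, Pi.single_apply, sgnCoeff_one, smul_eq_mul, mul_ite, mul_one, mul_zero]
  congr 1
  exact propext eq_comm

/-- Tableaux of the initial kind keep every label in its component, so here the colours are
determined exactly and not only up to a permutation. -/
theorem colour_of_rho_stdElt (hγ : ∀ x, (initTab h x).comp = (initTab h' x).comp)
    {u : Fin n ≃ Node mu} {u' : Fin n ≃ Node mu'}
    (hu : ∀ i, (u i).comp = (initTab h i).comp) (hu' : ∀ i, (u' i).comp = (initTab h' i).comp)
    {f₀ : Fin n → Fin N × Fin k} (hc : Coloured h f₀) (hf : RowIncr h f₀)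
    (hne : rho 1 N k (stdElt h (1 : Rˣ) u) f₀ (tabFun hN' u') ≠ 0) (x : Fin n) :
    (f₀ x).2 = (1 : Equiv.Perm (Fin k)) (initTab h x).comp := by
  rw [stdElt, mul_assoc, rho_eBlock_mul _ hc, rho_mul_apply] at hne
  obtain ⟨f, -, h1⟩ := Finset.exists_ne_zero_of_sum_ne_zero hne
  obtain ⟨w, hw, rfl⟩ := exists_of_rho_antisym_ne_zero _ hf (left_ne_zero_of_mul h1)
  have h2 := right_ne_zero_of_mul h1
  rw [rho_gPerm_one, Pi.single_apply] at h2
  have h3 : tabFun hN' u' = (f₀ ∘ w.symm) ∘ (dPerm h u).symm := by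
    by_contra hcon; simp [hcon] at h2
  have h4 := congrArg Prod.snd (congrFun h3 (dPerm h u (w x)))
  simp only [Function.comp_apply, Equiv.symm_apply_apply] at h4
  rw [← h4]
  change (u' _).comp = (initTab h x).comp
  rw [hu', ← hγ, comp_dPerm hu, comp_eq_of_rowKey_eq h ((mem_young h).1 hw x)]

open Classical in
theorem le_of_signedSum_ne_zero (hle : ExtendsDominance le)
    (hγ : ∀ x, (initTab h x).comp = (initTab h' x).comp)
    (hu₁ : ∀ i, (u₁ i).comp = (initTab h i).comp)
    (hu₁' : ∀ i, (u₁' i).comp = (initTab h' i).comp)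
    (hne : signedSum R h hN' u₁ u₂ u₁' u₂' ≠ 0) (i : Fin k) : le (mu i) (mu' i) := by
  rw [signedSum_eq hN' R hγ hu₁ hu₁'] at hne
  obtain ⟨f₀, hf₀, h1⟩ := Finset.exists_ne_zero_of_sum_ne_zero hne
  rw [Finset.mem_filter] at hf₀
  have h2 := left_ne_zero_of_mul h1
  obtain ⟨σ, hσ⟩ := exists_perm_of_rho_ne_zero _ h2
  obtain ⟨h3, h4⟩ := dominated_of_rowIncr hN' hf₀.2.2
    (colour_of_rho_stdElt hN' R hγ hu₁ hu₁' hf₀.2.1 hf₀.2.2 h2) hσ i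
  exact hle.extends_dominance _ _ h3 h4

theorem eq_initTab_of_rho_stdElt {u u' : Fin n ≃ Node mu}
    (hu : ∀ i, (u i).comp = (initTab h i).comp) (hu' : ∀ i, (u' i).comp = (initTab h i).comp)
    {f₀ : Fin n → Fin N × Fin k} (hc : Coloured h f₀) (hf : RowIncr h f₀)
    (hne : rho 1 N k (stdElt h (1 : Rˣ) u) f₀ (tabFun hN u') ≠ 0) :
    f₀ = tabFun hN (initTab h) := by
  obtain ⟨σ, hσ⟩ := exists_perm_of_rho_ne_zero _ hne
  exact eq_recolour_initTab hN hf
    (colour_of_rho_stdElt hN R (fun _ => rfl) hu hu' hc hf hne) hσ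

theorem seqKey_of_rho_initTab {u u' : Fin n ≃ Node mu} (hu : IsStd u)
    (hne : rho 1 N k (stdElt h (1 : Rˣ) u) (tabFun hN (initTab h)) (tabFun hN u') ≠ 0) :
    seqKey u' ≤ seqKey u := by
  rw [stdElt, mul_assoc, rho_eBlock_mul _ (coloured_initTab h hN)] at hne
  exact ((rho_antisym_gPerm_dPerm h hN _ hu).1 _ hne).toLex_le

open Classical in
theorem seqKey_le_of_signedSum_ne_zero {u₁ u₂ u₁' u₂' : Fin n ≃ Node mu}
    (h₁ : IsStd u₁) (h₂ : IsStd u₂) (hu₁ : ∀ i, (u₁ i).comp = (initTab h i).comp)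
    (hu₁' : ∀ i, (u₁' i).comp = (initTab h i).comp)
    (hne : signedSum R h hN u₁ u₂ u₁' u₂' ≠ 0) :
    seqKey u₁' ≤ seqKey u₁ ∧ seqKey u₂' ≤ seqKey u₂ := by
  rw [signedSum_eq hN R (fun _ => rfl) hu₁ hu₁'] at hne
  obtain ⟨f₀, hf₀, h1⟩ := Finset.exists_ne_zero_of_sum_ne_zero hne
  rw [Finset.mem_filter] at hf₀
  have h2 := left_ne_zero_of_mul h1
  have h3 := right_ne_zero_of_mul h1
  have h4 := eq_initTab_of_rho_stdElt hN R hu₁ hu₁' hf₀.2.1 hf₀.2.2 h2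
  subst h4
  constructor
  · exact seqKey_of_rho_initTab hN R h₁ h2
  · exact seqKey_of_rho_initTab hN R h₂ h3

open Classical in
theorem signedSum_self {u₁ u₂ : Fin n ≃ Node mu}
    (h₁ : IsStd u₁) (h₂ : IsStd u₂) (hu₁ : ∀ i, (u₁ i).comp = (initTab h i).comp) :
    signedSum R h hN u₁ u₂ u₁ u₂ = 1 := by
  have hself : ∀ u : Fin n ≃ Node mu, IsStd u →
      rho 1 N k (stdElt h (1 : Rˣ) u) (tabFun hN (initTab h)) (tabFun hN u) = 1 :=
    fun u hu => rho_stdElt_self hN (1 : Rˣ) hu (1 : Equiv.Perm (Fin k))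
  rw [signedSum_eq hN R (fun _ => rfl) hu₁ hu₁,
    Finset.sum_eq_single_of_mem (tabFun hN (initTab h))]
  · rw [hself u₁ h₁, hself u₂ h₂, mul_one]
  · rw [Finset.mem_filter]
    exact ⟨Finset.mem_univ _, coloured_initTab h hN, rowIncr_initTab h hN⟩
  · intro f₀ hf₀ hne
    rw [Finset.mem_filter] at hf₀
    by_contra h3
    have h4 := left_ne_zero_of_mul h3
    exact hne (eq_initTab_of_rho_stdElt hN R hu₁ hu₁ hf₀.2.1 hf₀.2.2 h4)

end SignedSum

/-! ### The triangularity of the dual cellular basis -/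

section MonotoneFibres

theorem mem_iff_lt_card_of_lower {r : ℕ} {A : Finset (Fin r)}
    (hA : ∀ i j, i ≤ j → j ∈ A → i ∈ A) (i : Fin r) : i ∈ A ↔ (i : ℕ) < A.card := by
  constructor
  · intro hi'
    have h1 : Finset.Iic i ⊆ A := fun j hj => hA j i (Finset.mem_Iic.1 hj) hi'
    have h2 := Finset.card_le_card h1
    rw [Fin.card_Iic] at h2
    omega
  · intro hlt
    by_contra hi'
    have h1 : A ⊆ Finset.Iio i := fun j hj => by
      rw [Finset.mem_Iio]
      by_contra hle
      exact hi' (hA i j (not_lt.1 hle) hj)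
    have h2 := Finset.card_le_card h1
    rw [Fin.card_Iio] at h2
    omega

/-- Two monotone maps with fibres of the same sizes agree. -/
theorem eq_of_monotone_of_card_fiber {r s : ℕ} {F G : Fin r → Fin s} (hF : Monotone F)
    (hG : Monotone G) (hFG : ∀ j, (Finset.univ.filter fun i => F i = j).card =
      (Finset.univ.filter fun i => G i = j).card) : F = G := by
  have key : ∀ {H : Fin r → Fin s}, Monotone H → ∀ i j, H i < j ↔
      (i : ℕ) < ∑ b ∈ Finset.Iio j, (Finset.univ.filter fun i => H i = b).card := by
    intro H hH i j
    have h1 := mem_iff_lt_card_of_lower (A := Finset.univ.filter fun i => H i < j)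
      (fun a b hab hb => by
        rw [Finset.mem_filter] at hb ⊢
        exact ⟨Finset.mem_univ _, (hH hab).trans_lt hb.2⟩) i
    rw [Finset.mem_filter, and_iff_right (Finset.mem_univ _)] at h1
    rw [h1, Finset.card_eq_sum_card_fiberwise (f := H) (t := Finset.Iio j)
      (fun x hx => by simpa using hx)]
    refine Iff.of_eq (congrArg _ (Finset.sum_congr rfl fun b hb => ?_))
    rw [Finset.filter_filter]
    congr 1
    ext x
    simp only [Finset.mem_filter, Finset.mem_univ, true_and, Finset.mem_Iio] at hb ⊢
    constructor
    · exact fun h => h.2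
    · rintro rfl; exact ⟨hb, rfl⟩
  have key2 : ∀ i j, F i < j ↔ G i < j := fun i j => by
    rw [key hF, key hG]
    simp only [hFG]
  funext i
  refine le_antisymm ?_ ?_
  · by_contra h
    exact absurd ((key2 i (F i)).2 (not_le.1 h)) (lt_irrefl _)
  · by_contra h
    exact absurd ((key2 i (G i)).1 (not_le.1 h)) (lt_irrefl _)

end MonotoneFibres

/-! ### The multiplicities of a shape and the matrix of a dual cellular element -/

section ShapeFacts

variable {le : YoungDiagram → YoungDiagram → Prop} {n r : ℕ} {α : n.Partition}

/-- The component of `𝔱^μ` which contains a label, i.e. the index of the value of a component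
of `λ`. -/
def Shape.gamma (Λ : Shape le r α) (i : Fin r) : Fin Λ.s := (initTab Λ.mu_size i).comp

/-- The set partition of λ has one block for each nonempty component and has `r` blocks by its type,
so no component is empty. -/
theorem Shape.comp_surjective (hα : Multiset.card α.parts = r) (Λ : Shape le r α) :
    Function.Surjective fun x => (initTab Λ.lam_size x).comp := by
  classical
  set B := blockPart Λ.lam_size
  have h1 : B.parts.card = r := by
    rw [← hα, ← Λ.lam_type, Multiset.card_map]
    rfl
  have h2 : ∀ P ∈ B.parts, ∃ x, B.part x = P := fun P hP => by
    obtain ⟨x, hx⟩ := B.nonempty_of_mem_parts hP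
    exact ⟨x, B.part_eq_of_mem hP hx⟩
  choose x hx using h2
  have h3 : Finset.univ ⊆ Finset.univ.image fun x => (initTab Λ.lam_size x).comp := by
    have h4 : (B.parts.attach.image fun P : {P // P ∈ B.parts} => (initTab Λ.lam_size (x P P.2)).comp) ⊆
        Finset.univ.image fun x => (initTab Λ.lam_size x).comp := by
      intro i
      simp only [Finset.mem_image, Finset.mem_univ, true_and]
      rintro ⟨P, -, rfl⟩
      exact ⟨_, rfl⟩
    have h5 : (B.parts.attach.image fun P : {P // P ∈ B.parts} => (initTab Λ.lam_size (x P P.2)).comp).card = r := by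
      rw [Finset.card_image_of_injective, Finset.card_attach, h1]
      intro P Q he
      apply Subtype.ext
      rw [← hx P P.2, ← hx Q Q.2]
      exact (blockPart_part_eq_iff Λ.lam_size).2 he
    rw [Finset.eq_univ_of_card _ (h5.trans (Fintype.card_fin r).symm)] at h4
    exact h4
  intro i
  have := h3 (Finset.mem_univ i)
  simpa using this

/-- The distinct components of `λ`, in increasing order. -/
theorem Shape.exists_val (Λ : Shape le r α) (hle : ExtendsDominance le) : ∃ val : Fin Λ.s → YoungDiagram,
    StrictMono (fun j => toOrd hle (val j)) ∧ Set.range val = Set.range Λ.lam ∧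
      ∀ i, Λ.lam i = val (Λ.gamma i) := by
  classical
  obtain ⟨val, h1, h2, h3⟩ := Λ.mu_mult
  have hmono : StrictMono (fun j => toOrd hle (val j)) := fun i j hij =>
    lt_of_le_of_ne (h1 i j hij).1 (h1 i j hij).2
  refine ⟨val, hmono, h2, ?_⟩
  have h4 : ∀ i, ∃ j, val j = Λ.lam i := fun i => by
    have : Λ.lam i ∈ Set.range val := h2 ▸ ⟨i, rfl⟩
    exact this
  choose δ hδ using h4
  -- Both maps are weakly increasing, and their fibres have the same sizes by the condition on the
  -- multiplicities.
  have h5 : δ = Λ.gamma := by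
    apply eq_of_monotone_of_card_fiber
    · intro i j hij
      rw [← hmono.le_iff_le]
      change le (val (δ i)) (val (δ j))
      rw [hδ, hδ]
      exact Λ.lam_incr i j hij
    · intro i j hij
      exact comp_mono Λ.mu_size hij
    · intro j
      rw [show (Finset.univ.filter fun i => Λ.gamma i = j).card = (Λ.mu j).card from
        card_comp (initTab Λ.mu_size) j, h3, Nat.card_eq_fintype_card, Fintype.card_subtype]
      congr 1
      ext i
      simp only [Finset.mem_filter, Finset.mem_univ, true_and]
      rw [← hδ]
      exact ⟨fun h => h ▸ rfl, fun h => hmono.injective h⟩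
  intro i
  rw [← h5, hδ]

theorem Shape.lam_eq_iff (Λ : Shape le r α) (hle : ExtendsDominance le) {i j : Fin r} :
    Λ.lam i = Λ.lam j ↔ Λ.gamma i = Λ.gamma j := by
  obtain ⟨val, h1, -, h3⟩ := Λ.exists_val hle
  rw [h3 i, h3 j]
  exact ⟨fun h => h1.injective h, fun h => h ▸ rfl⟩

theorem Shape.gamma_surjective (Λ : Shape le r α) (hle : ExtendsDominance le) : Function.Surjective Λ.gamma := by
  obtain ⟨val, h1, h2, h3⟩ := Λ.exists_val hle
  intro j
  have : val j ∈ Set.range Λ.lam := h2 ▸ ⟨j, rfl⟩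
  obtain ⟨i, hi'⟩ := this
  exact ⟨i, h1.injective ((h3 i).symm.trans hi')⟩

open Classical in
theorem Shape.s_eq (Λ : Shape le r α) (hle : ExtendsDominance le) : Λ.s = (Finset.univ.image Λ.lam).card := by
  obtain ⟨val, h1, h2, h3⟩ := Λ.exists_val hle
  have : Finset.univ.image Λ.lam = Finset.univ.image val := by
    ext ν
    have := Set.ext_iff.1 h2 ν
    simpa using this.symm
  rw [this, Finset.card_image_of_injective _ (show Function.Injective val from h1.injective),
    Finset.card_univ, Fintype.card_fin]

open Classical in
-- This description involves λ alone. So two shapes with the same λ also share `s` and `gamma`,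
-- although these are part of the data or depend on μ.
theorem Shape.gamma_val (Λ : Shape le r α) (hle : ExtendsDominance le) (i : Fin r) : (Λ.gamma i : ℕ) =
    ((Finset.univ.image Λ.lam).filter fun ν => toOrd hle ν < toOrd hle (Λ.lam i)).card := by
  obtain ⟨val, h1, h2, h3⟩ := Λ.exists_val hle
  have : (Finset.univ.image Λ.lam).filter (fun ν => toOrd hle ν < toOrd hle (Λ.lam i)) =
      (Finset.Iio (Λ.gamma i)).image val := by
    ext ν
    have h4 := Set.ext_iff.1 h2 ν
    simp only [Finset.mem_filter, Finset.mem_image, Finset.mem_univ, true_and, Finset.mem_Iio]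
    change ν ∈ Set.range Λ.lam ∧ _ ↔ _
    rw [← h4, h3 i]
    constructor
    · rintro ⟨⟨j, rfl⟩, h5⟩
      exact ⟨j, h1.lt_iff_lt.1 h5, rfl⟩
    · rintro ⟨j, h5, rfl⟩
      exact ⟨⟨j, rfl⟩, h1 h5⟩
  rw [this, Finset.card_image_of_injective _ (show Function.Injective val from h1.injective),
    Fin.card_Iio]

theorem gamma_dPerm {Λ : Shape le r α} (a : StdTab Λ) (x : Fin r) :
    Λ.gamma (dPerm Λ.mu_size a.u x) = Λ.gamma x := comp_dPerm a.u_init x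

theorem Shape.fixes_of_gamma (Λ : Shape le r α) (hle : ExtendsDominance le) {π : Equiv.Perm (Fin r)}
    (hπ : ∀ i, Λ.gamma (π i) = Λ.gamma i) (i : Fin r) : Λ.lam (π i) = Λ.lam i :=
  (Λ.lam_eq_iff hle).2 (hπ i)

theorem Shape.gamma_of_mem_young (Λ : Shape le r α) {w : Equiv.Perm (Fin r)}
    (hw : w ∈ young Λ.mu_size) (i : Fin r) : Λ.gamma (w i) = Λ.gamma i :=
  comp_eq_of_rowKey_eq _ ((mem_young _).1 hw i)

variable {R : Type*} [CommRing R] (q : Rˣ) {N : ℕ}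

/-- The permutation `d(u) w⁻¹ d(v)⁻¹`. -/
def twist {Λ : Shape le r α} (a b : StdTab Λ) (w : Equiv.Perm (Fin r)) : Equiv.Perm (Fin r) :=
  dPerm Λ.mu_size a.u * w⁻¹ * (dPerm Λ.mu_size b.u)⁻¹

theorem gamma_symm {s : ℕ} {γ : Fin r → Fin s} {π : Equiv.Perm (Fin r)}
    (hπ : ∀ i, γ (π i) = γ i) (i : Fin r) : γ (π.symm i) = γ i := by
  rw [← hπ, Equiv.apply_symm_apply]

theorem twist_fixes (hle : ExtendsDominance le) {Λ : Shape le r α} (a b : StdTab Λ) {w : Equiv.Perm (Fin r)}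
    (hw : w ∈ young Λ.mu_size) (i : Fin r) : Λ.lam (twist a b w i) = Λ.lam i := by
  refine Λ.fixes_of_gamma hle (fun i => ?_) i
  rw [twist, Equiv.Perm.mul_apply, Equiv.Perm.mul_apply, gamma_dPerm]
  exact (gamma_symm (Λ.gamma_of_mem_young hw) _).trans (gamma_symm (gamma_dPerm b) _)

open Classical in
-- `rho_sandwich` splits off the outer factors. The antisymmetriser commutes with the three block
-- permutations, which are thereby moved onto the row index `f₀` and combine to `twist`.
theorem rho_nElt (hle : ExtendsDominance le) {Λ : Shape le r α} (a b : StdTab Λ) (f f' : Fin n → Fin N × Fin r) :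
    rho q N r (nElt q Λ a b) f f' =
      ∑ f₀ : Fin n → Fin N × Fin r with Coloured Λ.lam_size f₀ ∧ RowIncr Λ.lam_size f₀,
        rho q N r (stdElt Λ.lam_size q a.t) f₀ f * ∑ w ∈ young Λ.mu_size, (-1) ^ len w *
          rho q N r (stdElt Λ.lam_size q b.t) (f₀ ∘ blockPerm Λ.lam_size (twist a b w)) f' := by
  have e : nElt q Λ a b = st q (gPerm q (dPerm Λ.lam_size a.t)) *
      (eBlock Λ.lam_size q * antisym Λ.lam_size q) *
      (st q (blockElt Λ.lam_size q (dPerm Λ.mu_size a.u)) * ((∑ w ∈ young Λ.mu_size,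
        ((-1 : R) ^ len w) • blockElt Λ.lam_size q w) *
          (blockElt Λ.lam_size q (dPerm Λ.mu_size b.u) * gPerm q (dPerm Λ.lam_size b.t)))) := by
    rw [nElt]
    simp only [mul_assoc]
    rfl
  rw [e, rho_sandwich]
  refine Finset.sum_congr rfl fun f₀ hf₀ => ?_
  rw [Finset.mem_filter] at hf₀
  obtain ⟨-, hc, hf⟩ := hf₀
  have ha := Λ.fixes_of_gamma hle (gamma_dPerm a)
  have hb := Λ.fixes_of_gamma hle (gamma_dPerm b)
  congr 1
  rw [rho_antisym_mul_st_blockElt q hc hf ha, Finset.sum_mul, Finset.mul_sum, map_sum,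
    Matrix.sum_apply]
  refine Finset.sum_congr rfl fun w hw => ?_
  have hw' := Λ.fixes_of_gamma hle (Λ.gamma_of_mem_young hw)
  have hca := hc.comp_blockPerm ha
  have hfa := hf.comp_blockPerm ha
  rw [smul_mul_assoc, mul_smul_comm, map_smul, Matrix.smul_apply, smul_eq_mul,
    rho_antisym_mul_blockElt q hca hfa hw',
    rho_antisym_mul_blockElt q (hca.comp_blockPerm (symm_fixes hw'))
      (hfa.comp_blockPerm (symm_fixes hw')) hb]
  have e2 : blockPerm Λ.lam_size (twist a b w) = blockPerm Λ.lam_size (dPerm Λ.mu_size a.u) *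
      blockPerm Λ.lam_size w.symm * blockPerm Λ.lam_size (dPerm Λ.mu_size b.u).symm := by
    rw [← blockPerm_mul _ ha (symm_fixes hw'), ← blockPerm_mul _ (mul_fixes ha (symm_fixes hw'))
      (symm_fixes hb)]
    rfl
  rw [e2]
  rfl

end ShapeFacts

/-! ### The ordering of the indices and the pairing functionals -/

section Triangularity

variable {le : YoungDiagram → YoungDiagram → Prop} {n r : ℕ} {α : n.Partition}

/-- The sequences of the keys. -/
abbrev TabKey (n : ℕ) : Type := (Lex (Fin n → ℕ ×ₗ ℕᵒᵈ))ᵒᵈ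

/-- The sequences of Young diagrams in the lexicographic order. -/
abbrev ShapeSeq (hle : ExtendsDominance le) (r : ℕ) : Type := Lex (Fin r → OrdShape hle)

/-- The key of a triple `(μ, u, v)`. -/
def innerKey (hle : ExtendsDominance le) (Λ : Shape le r α) (u v : Fin r ≃ Node Λ.mu) :
    ShapeSeq hle r ×ₗ TabKey r ×ₗ TabKey r :=
  toLex (toLex fun i => toOrd hle (Λ.mu (Λ.gamma i)),
    toLex (OrderDual.toDual (seqKey u), OrderDual.toDual (seqKey v)))

/-- The key of an index of the dual cellular basis. -/
def fullKey (hle : ExtendsDominance le) {Λ : Shape le r α} (a b : StdTab Λ) :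
    ShapeSeq hle r ×ₗ TabKey n ×ₗ TabKey n ×ₗ (ShapeSeq hle r ×ₗ TabKey r ×ₗ TabKey r) :=
  toLex (toLex fun i => toOrd hle (Λ.lam i), toLex (OrderDual.toDual (seqKey a.t),
    toLex (OrderDual.toDual (seqKey b.t), innerKey hle Λ a.u b.u)))

/-- λ determines `s` and `gamma`; as `gamma` is onto, the sequence of diagrams in the inner key
determines μ. The standard tableaux are recovered by `seqKey_injOn`. -/
theorem fullKey_injective (hle : ExtendsDominance le) :
    Function.Injective fun x : (Σ Λ : Shape le r α, StdTab Λ × StdTab Λ) =>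
      fullKey hle x.2.1 x.2.2 := by
  classical
  rintro ⟨Λ, a, b⟩ ⟨Λ', a', b'⟩ he
  simp only [fullKey, innerKey, EmbeddingLike.apply_eq_iff_eq, Prod.mk.injEq] at he
  obtain ⟨h1, h2, h3, h4, h5, h6⟩ := he
  have hlam : Λ.lam = Λ'.lam := funext fun i => toOrd_injective hle (congrFun h1 i)
  have hs : Λ.s = Λ'.s := by rw [Λ.s_eq hle, Λ'.s_eq hle, hlam]
  have hγ : ∀ i, (Λ.gamma i : ℕ) = Λ'.gamma i := fun i => by
    rw [Λ.gamma_val hle, Λ'.gamma_val hle, hlam]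
  have hsurj := Λ.gamma_surjective hle
  obtain ⟨lam, lam_size, lam_type, lam_incr, s, mu, mu_size, mu_mult⟩ := Λ
  obtain ⟨lam', lam_size', lam_type', lam_incr', s', mu', mu_size', mu_mult'⟩ := Λ'
  obtain ⟨t, ht, hincr, u, hu, hui⟩ := a
  obtain ⟨t', ht', hincr', u', hu', hui'⟩ := a'
  obtain ⟨v, hv, hvincr, z, hz, hzi⟩ := b
  obtain ⟨v', hv', hvincr', z', hz', hzi'⟩ := b'
  dsimp only at hlam hs hγ h1 h2 h3 h4 h5 h6 hsurj t t' u u' v v' z z'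
  subst hlam hs
  have hγ' : ∀ i, Shape.gamma ⟨lam, lam_size, lam_type, lam_incr, s, mu, mu_size, mu_mult⟩ i =
      Shape.gamma ⟨lam, lam_size', lam_type', lam_incr', s, mu', mu_size', mu_mult'⟩ i :=
    fun i => Fin.ext (hγ i)
  have hmu : mu = mu' := by
    funext j
    obtain ⟨i, rfl⟩ := hsurj j
    have := toOrd_injective hle (congrFun h4 i)
    rw [← hγ' i] at this
    exact this
  subst hmu
  obtain rfl := seqKey_injOn ht ht' h2
  obtain rfl := seqKey_injOn hv hv' h3
  obtain rfl := seqKey_injOn hu hu' h5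
  obtain rfl := seqKey_injOn hz hz' h6
  rfl

theorem rowLen_le_of_sum {k m : ℕ} {mu : Fin k → YoungDiagram} (h : ∑ i, (mu i).card = m)
    (i : Fin k) : (mu i).rowLen 0 ≤ m := by
  rw [← h]
  refine le_trans ?_ (Finset.single_le_sum (f := fun i => (mu i).card) (fun _ _ => Nat.zero_le _)
    (Finset.mem_univ i))
  rw [YoungDiagram.rowLen_eq_card]
  exact Finset.card_le_card (Finset.filter_subset _ _)

variable {R : Type*} [CommRing R] (q : Rˣ) {N : ℕ}

/-- A matrix coefficient of the action on the tensor space. -/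
def rhoEntry (f f' : Fin n → Fin N × Fin r) : BT q n →ₗ[R] R :=
  Matrix.entryLinearMap R R f f' ∘ₗ (rho q N r).toLinearMap

open Classical in
/-- The functional on the algebra dual to an element of the dual cellular basis, up to a
unitriangular change. -/
def pairing {Λ : Shape le r α} (hN : ∀ i, (Λ.lam i).rowLen 0 ≤ N) (a b : StdTab Λ) :
    BT q n →ₗ[R] R :=
  ∑ σ ∈ Finset.univ.filter fun σ : Equiv.Perm (Fin r) =>
    tabFun (rowLen_le_of_sum Λ.mu_size) a.u ∘ σ = tabFun (rowLen_le_of_sum Λ.mu_size) b.u,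
      rhoEntry q (tabFun hN a.t) (recolour σ (tabFun hN b.t))

/-- Dominance holds up to a permutation of the components, and this permutation can be dropped
because both multipartitions are weakly increasing. -/
theorem le_lam_of_rho_nElt (hle : ExtendsDominance le) (hα : Multiset.card α.parts = r) {Λ Λ' : Shape le r α}
    (hN' : ∀ i, (Λ'.lam i).rowLen 0 ≤ N) {a b : StdTab Λ} {t' : Fin n ≃ Node Λ'.lam}
    {f : Fin n → Fin N × Fin r} (hne : rho q N r (nElt q Λ a b) (tabFun hN' t') f ≠ 0)
    (i : Fin r) : le (Λ.lam i) (Λ'.lam i) := by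
  classical
  rw [rho_nElt q hle] at hne
  obtain ⟨f₀, hf₀, h1⟩ := Finset.exists_ne_zero_of_sum_ne_zero hne
  rw [Finset.mem_filter] at hf₀
  obtain ⟨τ, hτ⟩ := hf₀.2.1.exists_perm (Λ.comp_surjective hα)
  obtain ⟨σ, hσ⟩ := exists_perm_of_rho_ne_zero q (left_ne_zero_of_mul h1)
  refine le_of_le_perm (F := fun i => toOrd hle (Λ.lam i)) (F' := fun i => toOrd hle (Λ'.lam i))
    (fun i j hij => Λ.lam_incr i j hij) (fun i j hij => Λ'.lam_incr i j hij) (τ := τ)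
    (fun i => ?_) i
  obtain ⟨h2, h3⟩ := dominated_of_rowIncr hN' hf₀.2.2 hτ hσ i
  exact hle.extends_dominance _ _ h2 h3

end Triangularity

/-! ### Unitriangularity of the pairing -/

section Unitriangular

variable {le : YoungDiagram → YoungDiagram → Prop} {n r : ℕ} {α : n.Partition}
  {R : Type*} [CommRing R] (q : Rˣ) {N : ℕ}

open Classical in
theorem pairing_apply {Λ : Shape le r α} (hN : ∀ i, (Λ.lam i).rowLen 0 ≤ N) (a b : StdTab Λ)
    (x : BT q n) : pairing q hN a b x =
      ∑ σ ∈ Finset.univ.filter fun σ : Equiv.Perm (Fin r) =>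
        tabFun (rowLen_le_of_sum Λ.mu_size) a.u ∘ σ = tabFun (rowLen_le_of_sum Λ.mu_size) b.u,
          rho q N r x (tabFun hN a.t) (recolour σ (tabFun hN b.t)) := by
  rw [pairing, LinearMap.sum_apply]
  rfl

theorem fixes_of_tabFun (hle : ExtendsDominance le) {Λ : Shape le r α} {a b : StdTab Λ}
    {σ : Equiv.Perm (Fin r)} (hσ : tabFun (rowLen_le_of_sum Λ.mu_size) a.u ∘ σ =
      tabFun (rowLen_le_of_sum Λ.mu_size) b.u) (i : Fin r) : Λ.lam (σ i) = Λ.lam i := by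
  refine Λ.fixes_of_gamma hle (fun i => ?_) i
  rw [Shape.gamma, Shape.gamma, ← a.u_init, ← b.u_init]
  exact congrArg Prod.snd (congrFun hσ i)

/-- The pairing with the elements of the same multitableaux reduces to a signed sum. -/
theorem pairing_eq_signedSum (hle : ExtendsDominance le) (hα : Multiset.card α.parts = r)
    {lam : Fin r → YoungDiagram} {sz : ∑ i, (lam i).card = n} {ty inc} {s : ℕ}
    {mu mu' : Fin s → YoungDiagram} {ms mm ms' mm'}
    (a b : StdTab (⟨lam, sz, ty, inc, s, mu, ms, mm⟩ : Shape le r α))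
    (a' b' : StdTab (⟨lam, sz, ty, inc, s, mu', ms', mm'⟩ : Shape le r α))
    (hN : ∀ i, (lam i).rowLen 0 ≤ N) (ha : a'.t = a.t) (hb : b'.t = b.t) :
    pairing q hN a' b' (nElt q _ a b) =
      signedSum R ms (rowLen_le_of_sum ms') a.u b.u a'.u b'.u := by
  classical
  have hincr₁ := a'.t_incr
  have hincr₂ := b'.t_incr
  rw [ha] at hincr₁
  rw [hb] at hincr₂
  have h1 : ∀ σ : Equiv.Perm (Fin r), (∀ i, lam (σ i) = lam i) →
      rho q N r (nElt q _ a b) (tabFun hN a.t) (recolour σ (tabFun hN b.t)) =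
        ∑ w ∈ young ms, if twist a b w = σ then (-1 : R) ^ len w else 0 := fun σ hσ =>
    pairing_self hN q hle (c := fun w => (-1) ^ len w) (fun w hw => twist_fixes hle a b hw)
      a.t_std b.t_std (rho_nElt q hle a b) hincr₁ hincr₂ 
      (Shape.comp_surjective hα ⟨lam, sz, ty, inc, s, mu, ms, mm⟩) hσ
  rw [pairing_apply, ha, hb]
  refine (Finset.sum_congr rfl fun σ hσ =>
    h1 σ (fixes_of_tabFun hle (Finset.mem_filter.1 hσ).2)).trans ?_
  -- Each `w` contributes for the single permutation σ equal to its `twist`, so summing over the σ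
  -- that carry one sequence of μ-tableaux to the other leaves exactly the condition in `signedSum`.
  rw [Finset.sum_comm, signedSum]
  refine Finset.sum_congr rfl fun w _ => ?_
  rw [Finset.sum_ite_eq]
  simp only [Finset.mem_filter, Finset.mem_univ, true_and]
  rfl

/-- The same two levels as for λ: dominance compares the diagrams, and for equal diagrams the keys
of the tableaux are compared. -/
theorem inner_le_of_signedSum_ne_zero (R : Type*) [CommRing R] (hle : ExtendsDominance le) {s : ℕ}
    {mu mu' : Fin s → YoungDiagram} {ms : ∑ i, (mu i).card = r} {ms' : ∑ i, (mu' i).card = r}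
    (hγ : ∀ i, (initTab ms i).comp = (initTab ms' i).comp)
    (hs : Function.Surjective fun i => (initTab ms i).comp)
    {u v : Fin r ≃ Node mu} {u' v' : Fin r ≃ Node mu'} (hu : IsStd u) (hv : IsStd v)
    (hui : ∀ i, (u i).comp = (initTab ms i).comp)
    (hui' : ∀ i, (u' i).comp = (initTab ms' i).comp)
    (hne : signedSum R ms (rowLen_le_of_sum ms') u v u' v' ≠ 0) :
    (toLex (toLex fun i => toOrd hle (mu (initTab ms i).comp),
      toLex (OrderDual.toDual (seqKey u), OrderDual.toDual (seqKey v))) :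
        ShapeSeq hle r ×ₗ TabKey r ×ₗ TabKey r) ≤
    toLex (toLex fun i => toOrd hle (mu' (initTab ms' i).comp),
      toLex (OrderDual.toDual (seqKey u'), OrderDual.toDual (seqKey v'))) := by
  have h4 := le_of_signedSum_ne_zero (rowLen_le_of_sum ms') R hle hγ hui hui' hne
  rw [Prod.Lex.toLex_le_toLex]
  have h5 : ∀ i, toOrd hle (mu (initTab ms i).comp) ≤ toOrd hle (mu' (initTab ms' i).comp) :=
    fun i => by rw [← hγ]; exact h4 _
  rcases (Pi.toLex_monotone h5).lt_or_eq with h6 | h6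
  · exact Or.inl h6
  refine Or.inr ⟨h6, ?_⟩
  have h7 : mu = mu' := by
    funext j
    obtain ⟨i, rfl⟩ := hs j
    have := toOrd_injective hle (congrFun (toLex.injective h6) i)
    rw [← hγ i] at this
    exact this
  subst h7
  have h8 := seqKey_le_of_signedSum_ne_zero (rowLen_le_of_sum ms') R hu hv hui hui' hne
  rw [Prod.Lex.toLex_le_toLex]
  rcases h8.1.lt_or_eq with h9 | h9
  · exact Or.inl h9
  · exact Or.inr ⟨congrArg OrderDual.toDual h9.symm, h8.2⟩

/-- With λ fixed, `pairing_ne_zero` compares the two outer tableaux. If both agree, the pairing is a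
signed sum, and the inner keys decide. -/
theorem fullKey_le_aux (hle : ExtendsDominance le) (hα : Multiset.card α.parts = r)
    {lam : Fin r → YoungDiagram} {sz : ∑ i, (lam i).card = n} {ty inc} {s : ℕ}
    {mu mu' : Fin s → YoungDiagram} {ms mm ms' mm'}
    (a b : StdTab (⟨lam, sz, ty, inc, s, mu, ms, mm⟩ : Shape le r α))
    (a' b' : StdTab (⟨lam, sz, ty, inc, s, mu', ms', mm'⟩ : Shape le r α))
    (hN : ∀ i, (lam i).rowLen 0 ≤ N)
    (hγ : ∀ i, (initTab ms i).comp = (initTab ms' i).comp)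
    (hne : pairing q hN a' b' (nElt q _ a b) ≠ 0) : fullKey hle a b ≤ fullKey hle a' b' := by
  classical
  have h0 := hne
  rw [pairing_apply] at h0
  obtain ⟨σ, hσ, h1⟩ := Finset.exists_ne_zero_of_sum_ne_zero h0
  rw [Finset.mem_filter] at hσ
  have hfix := fixes_of_tabFun hle hσ.2
  have hk : seqKey a'.t ≤ seqKey a.t ∧ seqKey b'.t ≤ seqKey b.t :=
    pairing_ne_zero hN q hle (c := fun w => (-1) ^ len w) (fun w hw => twist_fixes hle a b hw)
      a.t_std b.t_std (rho_nElt q hle a b) a'.t_incr b'.t_incr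
      (Shape.comp_surjective hα ⟨lam, sz, ty, inc, s, mu, ms, mm⟩)
      hfix h1
  rw [fullKey, fullKey, Prod.Lex.toLex_le_toLex]
  refine Or.inr ⟨rfl, ?_⟩
  rw [Prod.Lex.toLex_le_toLex]
  rcases hk.1.lt_or_eq with h2 | h2
  · exact Or.inl h2
  refine Or.inr ⟨congrArg OrderDual.toDual h2.symm, ?_⟩
  rw [Prod.Lex.toLex_le_toLex]
  rcases hk.2.lt_or_eq with h3 | h3
  · exact Or.inl h3
  refine Or.inr ⟨congrArg OrderDual.toDual h3.symm, ?_⟩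
  rw [pairing_eq_signedSum q hle hα a b a' b' hN (seqKey_injOn a'.t_std a.t_std h2)
    (seqKey_injOn b'.t_std b.t_std h3)] at hne
  exact inner_le_of_signedSum_ne_zero R hle hγ
    (Shape.gamma_surjective ⟨lam, sz, ty, inc, s, mu, ms, mm⟩ hle) a.u_std b.u_std a.u_init
    a'.u_init hne

/-- The pairing is triangular. -/
theorem fullKey_le_of_pairing_ne_zero (hle : ExtendsDominance le)
    (hα : Multiset.card α.parts = r) {Λ Λ' : Shape le r α} (hN' : ∀ i, (Λ'.lam i).rowLen 0 ≤ N)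
    (a b : StdTab Λ) (a' b' : StdTab Λ') (hne : pairing q hN' a' b' (nElt q Λ a b) ≠ 0) :
    fullKey hle a b ≤ fullKey hle a' b' := by
  classical
  have h0 := hne
  rw [pairing_apply] at h0
  obtain ⟨σ, -, h1⟩ := Finset.exists_ne_zero_of_sum_ne_zero h0
  have h2 : ∀ i, toOrd hle (Λ.lam i) ≤ toOrd hle (Λ'.lam i) :=
    le_lam_of_rho_nElt q hle hα hN' h1
  rcases (Pi.toLex_monotone h2).lt_or_eq with h3 | h3
  · rw [fullKey, fullKey, Prod.Lex.toLex_le_toLex]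
    exact Or.inl h3
  have hlam : Λ.lam = Λ'.lam := funext fun i =>
    toOrd_injective hle (congrFun (toLex.injective h3) i)
  have hs : Λ.s = Λ'.s := by rw [Λ.s_eq hle, Λ'.s_eq hle, hlam]
  have hγ : ∀ i, (Λ.gamma i : ℕ) = Λ'.gamma i := fun i => by
    rw [Λ.gamma_val hle, Λ'.gamma_val hle, hlam]
  clear h0 h1 h2 h3
  obtain ⟨lam, lam_size, lam_type, lam_incr, s, mu, mu_size, mu_mult⟩ := Λ
  obtain ⟨lam', lam_size', lam_type', lam_incr', s', mu', mu_size', mu_mult'⟩ := Λ'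
  dsimp only at hlam hs
  subst hlam hs
  exact fullKey_le_aux q hle hα a b a' b' hN' (fun i => Fin.ext (hγ i)) hne

/-- The diagonal entries of the pairing. -/
theorem pairing_nElt_self (hle : ExtendsDominance le) (hα : Multiset.card α.parts = r)
    {Λ : Shape le r α} (hN : ∀ i, (Λ.lam i).rowLen 0 ≤ N) (a b : StdTab Λ) :
    pairing q hN a b (nElt q Λ a b) = 1 := by
  obtain ⟨lam, lam_size, lam_type, lam_incr, s, mu, mu_size, mu_mult⟩ := Λ
  rw [pairing_eq_signedSum q hle hα a b a b hN rfl rfl]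
  exact signedSum_self (rowLen_le_of_sum mu_size) R a.u_std b.u_std a.u_init

theorem rho_nElt_of_wide {Λ : Shape le r α} (hΛ : Λ.Wide N) (a b : StdTab Λ) :
    rho q N r (nElt q Λ a b) = 0 := by
  have h1 : rho q N r (eLam q Λ * yLam q Λ) = 0 := rho_eBlock_antisym_eq_zero q hΛ
  rw [nElt, mul_assoc (st q (gPerm q (dPerm Λ.lam_size a.t)))]
  simp only [map_mul _ _ (gPerm q _), map_mul _ _ (bPerm q Λ _), map_mul _ _ (cMu q Λ),
    map_mul _ _ (st q (bPerm q Λ _)), map_mul (rho q N r) (st q (gPerm q _)), h1, mul_zero,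
    zero_mul]

end Unitriangular

/-! ### Standard tableaux and permutations -/

section YoungLattice

/-- The cells of a Young diagram lie in a square. -/
theorem fst_lt_card {κ : YoungDiagram} {c : ℕ × ℕ} (hc : c ∈ κ) : c.1 < κ.card := by
  have h : ((Finset.range (c.1 + 1)).image fun i => (i, c.2)) ⊆ κ.cells := by
    intro x hx
    rw [Finset.mem_image] at hx
    obtain ⟨i, hi', rfl⟩ := hx
    rw [Finset.mem_range] at hi'
    exact κ.up_left_mem (by omega) le_rfl hc
  have h2 := Finset.card_le_card h
  rw [Finset.card_image_of_injective _ (fun a b hab => (Prod.ext_iff.1 hab).1),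
    Finset.card_range] at h2
  exact h2

theorem snd_lt_card {κ : YoungDiagram} {c : ℕ × ℕ} (hc : c ∈ κ) : c.2 < κ.card := by
  have h : ((Finset.range (c.2 + 1)).image fun i => (c.1, i)) ⊆ κ.cells := by
    intro x hx
    rw [Finset.mem_image] at hx
    obtain ⟨i, hi', rfl⟩ := hx
    rw [Finset.mem_range] at hi'
    exact κ.up_left_mem le_rfl (by omega) hc
  have h2 := Finset.card_le_card h
  rw [Finset.card_image_of_injective _ (fun a b hab => (Prod.ext_iff.1 hab).2),
    Finset.card_range] at h2
  exact h2

theorem finite_card_eq (k : ℕ) : {κ : YoungDiagram | κ.card = k}.Finite := by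
  refine Set.Finite.of_finite_image (f := fun κ => κ.cells) ?_ ?_
  · refine Set.Finite.subset (Finset.finite_toSet
      ((Finset.range k ×ˢ Finset.range k).powerset)) ?_
    rintro _ ⟨κ, hκ, rfl⟩
    rw [Finset.mem_coe, Finset.mem_powerset]
    intro c hc
    have hκ' : κ.card = k := hκ
    rw [Finset.mem_product, Finset.mem_range, Finset.mem_range, ← hκ']
    exact ⟨fst_lt_card hc, snd_lt_card hc⟩
  · intro κ _ ν _ he
    exact YoungDiagram.ext he

/-- The Young diagrams with `k` cells. -/
def diagrams (k : ℕ) : Finset YoungDiagram := (finite_card_eq k).toFinset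

theorem mem_diagrams {k : ℕ} {κ : YoungDiagram} : κ ∈ diagrams k ↔ κ.card = k := by
  simp [diagrams]

theorem eq_of_le_of_card_le {κ ν : YoungDiagram} (h : κ ≤ ν) (hc : ν.card ≤ κ.card) : κ = ν :=
  YoungDiagram.ext (Finset.eq_of_subset_of_card_le (YoungDiagram.cells_subset_iff.2 h) hc)

theorem card_sup_add_card_inf (κ ν : YoungDiagram) :
    (κ ⊔ ν).card + (κ ⊓ ν).card = κ.card + ν.card := by
  simp only [YoungDiagram.card, YoungDiagram.cells_sup, YoungDiagram.cells_inf]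
  exact Finset.card_union_add_card_inter _ _

open Classical in
/-- Two different diagrams have as many common upper covers as common lower covers. -/
theorem card_common_covers {k : ℕ} {κ ρ : YoungDiagram} (hκ : κ ∈ diagrams (k + 1))
    (hρ : ρ ∈ diagrams (k + 1)) (hne : κ ≠ ρ) :
    ((diagrams (k + 2)).filter fun ν => κ ≤ ν ∧ ρ ≤ ν).card =
      ((diagrams k).filter fun σ => σ ≤ κ ∧ σ ≤ ρ).card := by
  rw [mem_diagrams] at hκ hρ
  have h0 := card_sup_add_card_inf κ ρ
  have h1 : k + 1 < (κ ⊔ ρ).card := by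
    by_contra hcon
    have e1 := eq_of_le_of_card_le (le_sup_left : κ ≤ κ ⊔ ρ) (by omega)
    have e2 := eq_of_le_of_card_le (le_sup_right : ρ ≤ κ ⊔ ρ) (by omega)
    exact hne (e1.trans e2.symm)
  have h2 : ∀ ν ∈ (diagrams (k + 2)).filter fun ν => κ ≤ ν ∧ ρ ≤ ν, ν = κ ⊔ ρ := by
    intro ν hν
    rw [Finset.mem_filter, mem_diagrams] at hν
    exact (eq_of_le_of_card_le (sup_le hν.2.1 hν.2.2) (by omega)).symm
  have h3 : ∀ σ ∈ (diagrams k).filter fun σ => σ ≤ κ ∧ σ ≤ ρ, σ = κ ⊓ ρ := by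
    intro σ hσ
    rw [Finset.mem_filter, mem_diagrams] at hσ
    exact eq_of_le_of_card_le (le_inf hσ.2.1 hσ.2.2) (by omega)
  -- The only candidates for common covers are the supremum and the infimum; their sizes add up to
  -- `2k + 2`, so either both are covers or neither is.
  by_cases hc : (κ ⊔ ρ).card = k + 2
  · rw [Finset.eq_singleton_iff_unique_mem.2 ⟨?_, h2⟩,
      Finset.eq_singleton_iff_unique_mem.2 ⟨?_, h3⟩, Finset.card_singleton, Finset.card_singleton]
    · rw [Finset.mem_filter, mem_diagrams]
      exact ⟨by omega, inf_le_left, inf_le_right⟩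
    · rw [Finset.mem_filter, mem_diagrams]
      exact ⟨hc, le_sup_left, le_sup_right⟩
  · rw [Finset.card_eq_zero.2, Finset.card_eq_zero.2]
    · rw [Finset.eq_empty_iff_forall_notMem]
      intro σ hσ
      have h4 := h3 σ hσ
      rw [Finset.mem_filter, mem_diagrams] at hσ
      rw [h4] at hσ
      omega
    · rw [Finset.eq_empty_iff_forall_notMem]
      intro ν hν
      have h4 := h2 ν hν
      rw [Finset.mem_filter, mem_diagrams] at hν
      rw [h4] at hν
      omega

/-- The diagram with one more cell in the row `i`. -/
def addRow (κ : YoungDiagram) (i : ℕ) (hi' : ∀ j, j + 1 = i → κ.rowLen i < κ.rowLen j) :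
    YoungDiagram where
  cells := insert (i, κ.rowLen i) κ.cells
  isLowerSet := by
    rintro ⟨a, b⟩ ⟨c, d⟩ hle hab
    obtain ⟨h1, h2⟩ : c ≤ a ∧ d ≤ b := hle
    rw [Finset.mem_coe, Finset.mem_insert] at hab ⊢
    rcases hab with hab | hab
    · rw [Prod.mk.injEq] at hab
      obtain ⟨rfl, rfl⟩ := hab
      rcases h1.eq_or_lt with rfl | h3
      · rcases h2.eq_or_lt with rfl | h4
        · exact Or.inl rfl
        · exact Or.inr (YoungDiagram.mem_iff_lt_rowLen.2 h4)
      · right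
        obtain ⟨a, rfl⟩ : ∃ a', a = a' + 1 := ⟨a - 1, by omega⟩
        rw [YoungDiagram.mem_cells, YoungDiagram.mem_iff_lt_rowLen]
        exact (h2.trans_lt (hi' a rfl)).trans_le (κ.rowLen_anti _ _ (by omega))
    · exact Or.inr (κ.up_left_mem h1 h2 hab)

/-- The diagram with one cell less in the row `i`. -/
def eraseRow (κ : YoungDiagram) (i : ℕ) (hi' : κ.rowLen (i + 1) < κ.rowLen i) : YoungDiagram where
  cells := κ.cells.erase (i, κ.rowLen i - 1)
  isLowerSet := by
    rintro ⟨a, b⟩ ⟨c, d⟩ hle hab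
    obtain ⟨h1, h2⟩ : c ≤ a ∧ d ≤ b := hle
    rw [Finset.mem_coe, Finset.mem_erase] at hab ⊢
    refine ⟨fun he => hab.1 ?_, κ.up_left_mem h1 h2 hab.2⟩
    rw [Prod.mk.injEq] at he ⊢
    obtain ⟨rfl, rfl⟩ := he
    have h3 := YoungDiagram.mem_iff_lt_rowLen.1 hab.2
    rcases h1.eq_or_lt with rfl | h4
    · exact ⟨rfl, by omega⟩
    · have := κ.rowLen_anti (c + 1) a h4
      omega

theorem exists_cell_of_cover {κ ν : YoungDiagram} (h : κ ≤ ν) (hc : ν.card = κ.card + 1) :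
    ∃ c, c ∉ κ ∧ c ∈ ν ∧ ν.cells = insert c κ.cells := by
  have hsub := YoungDiagram.cells_subset_iff.2 h
  have h1 : (ν.cells \ κ.cells).card = 1 := by
    rw [Finset.card_sdiff_of_subset hsub]
    change ν.card - κ.card = 1
    omega
  obtain ⟨c, hc'⟩ := Finset.card_eq_one.1 h1
  have h2 : c ∈ ν.cells \ κ.cells := by rw [hc']; exact Finset.mem_singleton_self c
  rw [Finset.mem_sdiff] at h2
  refine ⟨c, h2.2, h2.1, ?_⟩
  rw [← Finset.sdiff_union_of_subset hsub, hc']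
  rfl

theorem notMem_rowLen (κ : YoungDiagram) (i : ℕ) : (i, κ.rowLen i) ∉ κ.cells := by
  rw [YoungDiagram.mem_cells, YoungDiagram.mem_iff_lt_rowLen]
  exact lt_irrefl _

open Classical in
-- A cell can be added to the top row and to each row that is strictly shorter than the one above,
-- so there is one more addable row than removable rows. Together with `card_lower_covers` this
-- counts one more upper cover than lower covers.
theorem card_upper_covers {k : ℕ} {κ : YoungDiagram} (hκ : κ ∈ diagrams k) :
    ((diagrams (k + 1)).filter fun ν => κ ≤ ν).card =
      ((Finset.range k).filter fun i => κ.rowLen (i + 1) < κ.rowLen i).card + 1 := by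
  rw [mem_diagrams] at hκ
  have h1 : ((Finset.range k).filter fun i => κ.rowLen (i + 1) < κ.rowLen i).card + 1 =
      ((Finset.range (k + 1)).filter fun i => ∀ j, j + 1 = i → κ.rowLen i < κ.rowLen j).card := by
    have : ((Finset.range (k + 1)).filter fun i => ∀ j, j + 1 = i → κ.rowLen i < κ.rowLen j) =
        insert 0 (((Finset.range k).filter fun i => κ.rowLen (i + 1) < κ.rowLen i).image
          Nat.succ) := by
      ext i
      simp only [Finset.mem_filter, Finset.mem_range, Finset.mem_insert, Finset.mem_image]
      constructor
      · rintro ⟨h2, h3⟩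
        rcases Nat.eq_zero_or_pos i with rfl | h4
        · exact Or.inl rfl
        · obtain ⟨j, rfl⟩ : ∃ j, i = j + 1 := ⟨i - 1, by omega⟩
          exact Or.inr ⟨j, ⟨by omega, h3 j rfl⟩, rfl⟩
      · rintro (rfl | ⟨j, ⟨h2, h3⟩, rfl⟩)
        · exact ⟨Nat.succ_pos _, fun j hj => absurd hj (by omega)⟩
        · refine ⟨by omega, fun j' hj' => ?_⟩
          obtain rfl : j' = j := by omega
          exact h3
    rw [this, Finset.card_insert_of_notMem (by simp),
      Finset.card_image_of_injective _ Nat.succ_injective]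
  rw [h1]
  symm
  refine Finset.card_bij (fun i hi' => addRow κ i (Finset.mem_filter.1 hi').2) ?_ ?_ ?_
  · intro i hi'
    rw [Finset.mem_filter, mem_diagrams]
    refine ⟨?_, YoungDiagram.cells_subset_iff.1 (Finset.subset_insert _ _)⟩
    exact (Finset.card_insert_of_notMem (notMem_rowLen κ i)).trans (congrArg (· + 1) hκ)
  · intro i hi' j hj he
    have h2 : (i, κ.rowLen i) ∈ (addRow κ j (Finset.mem_filter.1 hj).2).cells := by
      rw [← he]
      exact Finset.mem_insert_self _ _
    rcases Finset.mem_insert.1 h2 with h3 | h3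
    · exact (Prod.ext_iff.1 h3).1
    · exact absurd h3 (notMem_rowLen κ i)
  · intro ν hν
    rw [Finset.mem_filter, mem_diagrams] at hν
    obtain ⟨⟨i, j⟩, h2, h3, h4⟩ := exists_cell_of_cover hν.2 (by omega)
    have h5 : ∀ a b, a ≤ i → b ≤ j → (a, b) ≠ (i, j) → (a, b) ∈ κ := fun a b ha hb hab => by
      have h6 : (a, b) ∈ ν.cells := ν.up_left_mem ha hb h3
      rw [h4, Finset.mem_insert] at h6
      exact h6.resolve_left hab
    have hj : j = κ.rowLen i := by
      apply le_antisymm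
      · by_contra hcon
        have := YoungDiagram.mem_iff_lt_rowLen.1
          (h5 i (κ.rowLen i) le_rfl (by omega) (by rw [Ne, Prod.mk.injEq]; omega))
        omega
      · by_contra hcon
        exact h2 (YoungDiagram.mem_iff_lt_rowLen.2 (not_le.1 hcon))
    refine ⟨i, ?_, ?_⟩
    · rw [Finset.mem_filter, Finset.mem_range]
      refine ⟨?_, fun a ha => ?_⟩
      · have := fst_lt_card h3
        rw [hν.1] at this
        exact this
      · rw [← hj]
        exact YoungDiagram.mem_iff_lt_rowLen.1
          (h5 a j (by omega) le_rfl (by rw [Ne, Prod.mk.injEq]; omega))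
    · refine YoungDiagram.ext ?_
      change insert (i, κ.rowLen i) κ.cells = ν.cells
      rw [h4, hj]

open Classical in
-- A cell can be removed exactly from the rows that are strictly longer than the next one.
theorem card_lower_covers {k : ℕ} {κ : YoungDiagram} (hκ : κ ∈ diagrams (k + 1)) :
    ((diagrams k).filter fun σ => σ ≤ κ).card =
      ((Finset.range (k + 1)).filter fun i => κ.rowLen (i + 1) < κ.rowLen i).card := by
  rw [mem_diagrams] at hκ
  have hmem : ∀ i, κ.rowLen (i + 1) < κ.rowLen i → (i, κ.rowLen i - 1) ∈ κ.cells := fun i hi' =>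
    YoungDiagram.mem_iff_lt_rowLen.2 (by omega)
  symm
  refine Finset.card_bij (fun i hi' => eraseRow κ i (Finset.mem_filter.1 hi').2) ?_ ?_ ?_
  · intro i hi'
    rw [Finset.mem_filter, mem_diagrams]
    refine ⟨?_, YoungDiagram.cells_subset_iff.1 (Finset.erase_subset _ _)⟩
    have := Finset.card_erase_of_mem (hmem i (Finset.mem_filter.1 hi').2)
    change (κ.cells.erase _).card = k
    rw [this]
    change κ.card - 1 = k
    omega
  · intro i hi' j hj he
    by_contra hne
    have h2 : (i, κ.rowLen i - 1) ∈ (eraseRow κ j (Finset.mem_filter.1 hj).2).cells := by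
      refine Finset.mem_erase.2 ⟨fun h3 => hne (Prod.ext_iff.1 h3).1,
        hmem i (Finset.mem_filter.1 hi').2⟩
    rw [← he] at h2
    exact (Finset.mem_erase.1 h2).1 rfl
  · intro σ hσ
    rw [Finset.mem_filter, mem_diagrams] at hσ
    obtain ⟨⟨i, j⟩, h2, h3, h4⟩ := exists_cell_of_cover hσ.2 (by omega)
    have h5 : ∀ a b, i ≤ a → j ≤ b → (a, b) ≠ (i, j) → (a, b) ∉ κ := fun a b ha hb hab h6 => by
      have h7 : (a, b) ∈ κ.cells := h6
      rw [h4, Finset.mem_insert] at h7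
      exact h2 (σ.up_left_mem ha hb (h7.resolve_left hab))
    have hj : j + 1 = κ.rowLen i := by
      have h6 := YoungDiagram.mem_iff_lt_rowLen.1 h3
      by_contra hcon
      exact h5 i (j + 1) le_rfl (by omega) (by rw [Ne, Prod.mk.injEq]; omega)
        (YoungDiagram.mem_iff_lt_rowLen.2 (by omega))
    refine ⟨i, ?_, ?_⟩
    · rw [Finset.mem_filter, Finset.mem_range]
      refine ⟨?_, ?_⟩
      · have := fst_lt_card h3
        rw [hκ] at this
        exact this
      · rw [← hj]
        by_contra hcon
        exact h5 (i + 1) j (by omega) le_rfl (by rw [Ne, Prod.mk.injEq]; omega)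
          (YoungDiagram.mem_iff_lt_rowLen.2 (by omega))
    · refine YoungDiagram.ext ?_
      change κ.cells.erase (i, κ.rowLen i - 1) = _
      rw [← hj, h4]
      exact Finset.erase_insert h2

open Classical in
/-- The number of the paths from the empty diagram in the Young lattice. -/
def numPaths : ℕ → YoungDiagram → ℕ
  -- The value matters only for the empty diagram, the single diagram without cells.
  | 0, _ => 1
  | k + 1, ν => ∑ κ ∈ (diagrams k).filter fun κ => κ ≤ ν, numPaths k κ

theorem sum_filter_sum_filter {X Y : Type*} (A : Finset X) (B : Finset Y) (p : X → Prop)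
    (r : Y → X → Prop) [DecidablePred p] [∀ y, DecidablePred (r y)]
    [∀ x, DecidablePred fun y => r y x] (f : Y → ℕ) :
    ∑ x ∈ A.filter p, ∑ y ∈ B.filter fun y => r y x, f y =
      ∑ y ∈ B, (A.filter fun x => p x ∧ r y x).card * f y := by
  have h1 : ∀ x, ∑ y ∈ B.filter (fun y => r y x), f y = ∑ y ∈ B, if r y x then f y else 0 :=
    fun x => Finset.sum_filter _ _
  simp only [h1]
  rw [Finset.sum_comm]
  refine Finset.sum_congr rfl fun y _ => ?_
  rw [← Finset.sum_filter, Finset.sum_const, Finset.filter_filter, smul_eq_mul]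

open Classical in
-- The Young lattice is a differential poset: going up and then down exceeds going down and then up
-- by the identity, as the two cover counts show. Induction on the level gives the factor `k + 1`.
theorem sum_upper_covers (k : ℕ) : ∀ κ ∈ diagrams k,
    ∑ ν ∈ (diagrams (k + 1)).filter fun ν => κ ≤ ν, numPaths (k + 1) ν =
      (k + 1) * numPaths k κ := by
  induction k with
  | zero =>
    intro κ hκ
    have h1 : ∀ κ, κ ∈ diagrams 0 ↔ κ = ⊥ := fun κ => by
      rw [mem_diagrams]
      refine ⟨fun h => ?_, fun h => by rw [h]; rfl⟩
      exact (eq_of_le_of_card_le bot_le (by rw [h]; exact Nat.zero_le _)).symm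
    have h2 : ∀ ν, numPaths 1 ν = 1 := fun ν => by
      have : (diagrams 0).filter (fun κ => κ ≤ ν) = {⊥} := by
        ext ρ
        rw [Finset.mem_filter, h1, Finset.mem_singleton]
        exact ⟨fun h => h.1, fun h => ⟨h, h ▸ bot_le⟩⟩
      rw [numPaths, this, Finset.sum_singleton]
      rfl
    simp only [h2, Finset.sum_const, smul_eq_mul, mul_one, card_upper_covers hκ]
    rfl
  | succ k ih =>
    intro κ hκ
    have h1 : ∀ ρ ∈ diagrams (k + 1),
        ((diagrams (k + 2)).filter fun ν => κ ≤ ν ∧ ρ ≤ ν).card =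
          ((diagrams k).filter fun σ => σ ≤ κ ∧ σ ≤ ρ).card + if ρ = κ then 1 else 0 := by
      intro ρ hρ
      split_ifs with h
      · subst h
        simp only [and_self]
        rw [card_upper_covers hρ, card_lower_covers hρ]
      · rw [card_common_covers hκ hρ (Ne.symm h), add_zero]
    calc ∑ ν ∈ (diagrams (k + 2)).filter fun ν => κ ≤ ν, numPaths (k + 2) ν
        = ∑ ρ ∈ diagrams (k + 1), ((diagrams (k + 2)).filter fun ν => κ ≤ ν ∧ ρ ≤ ν).card *
            numPaths (k + 1) ρ := by
          exact sum_filter_sum_filter _ _ _ (fun ρ ν => ρ ≤ ν) _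
      _ = ∑ ρ ∈ diagrams (k + 1), ((diagrams k).filter fun σ => σ ≤ κ ∧ σ ≤ ρ).card *
            numPaths (k + 1) ρ + numPaths (k + 1) κ := by
          rw [Finset.sum_congr rfl fun ρ hρ => by rw [h1 ρ hρ, add_mul], Finset.sum_add_distrib]
          simp [hκ]
      _ = ∑ σ ∈ (diagrams k).filter fun σ => σ ≤ κ,
            (∑ ρ ∈ (diagrams (k + 1)).filter fun ρ => σ ≤ ρ, numPaths (k + 1) ρ) +
              numPaths (k + 1) κ := by
          rw [sum_filter_sum_filter _ _ _ (fun ρ σ => σ ≤ ρ)]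
      _ = (k + 1 + 1) * numPaths (k + 1) κ := by
          rw [Finset.sum_congr rfl fun σ hσ => ih σ (Finset.mem_filter.1 hσ).1, ← Finset.mul_sum]
          change (k + 1) * numPaths (k + 1) κ + numPaths (k + 1) κ = _
          ring

open Classical in
/-- The sum of the squares of the numbers of standard tableaux. -/
theorem sum_numPaths_sq (k : ℕ) : ∑ κ ∈ diagrams k, numPaths k κ ^ 2 = k.factorial := by
  induction k with
  | zero =>
    have h1 : diagrams 0 = {⊥} := by
      ext κ
      rw [mem_diagrams, Finset.mem_singleton]
      refine ⟨fun h => ?_, fun h => by rw [h]; rfl⟩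
      exact (eq_of_le_of_card_le bot_le (by rw [h]; exact Nat.zero_le _)).symm
    rw [h1, Finset.sum_singleton]
    rfl
  | succ k ih =>
    rw [Nat.factorial_succ, ← ih, Finset.mul_sum]
    -- One factor of the square is expanded over the upper covers. After the exchange of sums, the
    -- sum over the lower covers rebuilds the recursion for `numPaths`.
    have h1 : ∀ κ ∈ diagrams k, (k + 1) * numPaths k κ ^ 2 =
        ∑ ν ∈ diagrams (k + 1), if κ ≤ ν then numPaths k κ * numPaths (k + 1) ν else 0 := by
      intro κ hκ
      rw [pow_two, ← mul_assoc, ← sum_upper_covers k κ hκ, Finset.sum_mul, Finset.sum_filter]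
      exact Finset.sum_congr rfl fun ν _ => by split_ifs <;> ring
    rw [Finset.sum_congr rfl h1, Finset.sum_comm]
    refine Finset.sum_congr rfl fun ν _ => ?_
    rw [← Finset.sum_filter, ← Finset.sum_mul, pow_two]
    rfl

end YoungLattice

/-! ### Permutations and pairs of standard tableaux -/

section Correspondence

/-- The function `c` is a standard filling of the diagram `κ` by the labels in `X`. -/
def IsTabOn {n : ℕ} (X : Finset (Fin n)) (κ : YoungDiagram) (c : Fin n → ℕ × ℕ) : Prop :=
  Set.BijOn c X κ.cells ∧
    (∀ x ∈ X, ∀ y ∈ X, (c x).1 = (c y).1 → (c x).2 < (c y).2 → x < y) ∧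
    (∀ x ∈ X, ∀ y ∈ X, (c x).2 = (c y).2 → (c x).1 < (c y).1 → x < y)

theorem IsTabOn.card_eq {n : ℕ} {X : Finset (Fin n)} {κ : YoungDiagram} {c : Fin n → ℕ × ℕ}
    (h : IsTabOn X κ c) : X.card = κ.card :=
  Finset.card_nbij c h.1.mapsTo h.1.injOn h.1.surjOn

theorem IsTabOn.congr {n : ℕ} {X : Finset (Fin n)} {κ : YoungDiagram} {c c' : Fin n → ℕ × ℕ}
    (h : IsTabOn X κ c) (he : ∀ x ∈ X, c x = c' x) : IsTabOn X κ c' := by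
  refine ⟨h.1.congr he, fun x hx y hy => ?_, fun x hx y hy => ?_⟩
  · rw [← he x hx, ← he y hy]; exact h.2.1 x hx y hy
  · rw [← he x hx, ← he y hy]; exact h.2.2 x hx y hy

theorem IsTabOn.diagram_eq {n : ℕ} {X : Finset (Fin n)} {κ κ' : YoungDiagram}
    {c : Fin n → ℕ × ℕ} (h : IsTabOn X κ c) (h' : IsTabOn X κ' c) : κ = κ' := by
  refine YoungDiagram.ext (Finset.coe_injective ?_)
  rw [← h.1.image_eq, h'.1.image_eq]

open Classical in
/-- The standard tableaux of a diagram with `k` cells. -/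
def tabs (k : ℕ) (κ : YoungDiagram) : Finset (Fin k → ℕ × ℕ) :=
  (Fintype.piFinset fun _ => κ.cells).filter (IsTabOn Finset.univ κ)

open Classical in
theorem mem_tabs {k : ℕ} {κ : YoungDiagram} {T : Fin k → ℕ × ℕ} :
    T ∈ tabs k κ ↔ IsTabOn Finset.univ κ T := by
  rw [tabs, Finset.mem_filter, Fintype.mem_piFinset]
  exact ⟨fun h => h.2, fun h => ⟨fun x => h.1.mapsTo (Finset.mem_coe.2 (Finset.mem_univ x)), h⟩⟩

theorem isTabOn_snoc {k : ℕ} {κ ν : YoungDiagram} {T : Fin k → ℕ × ℕ} (hT : IsTabOn Finset.univ κ T)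
    {c : ℕ × ℕ} (hc : c ∉ κ) (hν : ν.cells = insert c κ.cells) :
    IsTabOn Finset.univ ν (Fin.snoc T c : Fin (k + 1) → ℕ × ℕ) := by
  have hmem : ∀ x, T x ∈ κ := fun x => hT.1.mapsTo (Finset.mem_coe.2 (Finset.mem_univ x))
  refine ⟨⟨?_, ?_, ?_⟩, ?_, ?_⟩
  · intro x _
    rw [Finset.mem_coe, hν, Finset.mem_insert]
    refine Fin.lastCases ?_ (fun i => ?_) x
    · left; simp
    · right; simpa using hmem i
  · intro x _ y _
    refine Fin.lastCases ?_ (fun i => ?_) x <;> refine Fin.lastCases ?_ (fun j => ?_) y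
    · intro _; rfl
    · simp only [Fin.snoc_last, Fin.snoc_castSucc]
      intro e
      exact absurd (e ▸ hmem j) hc
    · simp only [Fin.snoc_last, Fin.snoc_castSucc]
      intro e
      exact absurd (e ▸ hmem i) hc
    · simp only [Fin.snoc_castSucc]
      intro e
      rw [hT.1.injOn (Finset.mem_coe.2 (Finset.mem_univ i)) (Finset.mem_coe.2 (Finset.mem_univ j)) e]
  · intro d hd
    rw [Finset.mem_coe, hν, Finset.mem_insert] at hd
    rcases hd with rfl | hd
    · exact ⟨Fin.last k, by simp, by simp⟩
    · obtain ⟨i, -, rfl⟩ := hT.1.surjOn hd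
      exact ⟨i.castSucc, by simp, by simp⟩
  · intro x _ y _
    refine Fin.lastCases ?_ (fun i => ?_) x <;> refine Fin.lastCases ?_ (fun j => ?_) y
    · intro _ h; exact absurd h (lt_irrefl _)
    · simp only [Fin.snoc_last, Fin.snoc_castSucc]
      intro h1 h2
      exact absurd (κ.up_left_mem (i1 := c.1) (j1 := c.2) h1.le h2.le (hmem j)) hc
    · intro _ _; exact Fin.castSucc_lt_last i
    · simp only [Fin.snoc_castSucc, Fin.castSucc_lt_castSucc_iff]
      exact hT.2.1 i (Finset.mem_univ _) j (Finset.mem_univ _)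
  · intro x _ y _
    refine Fin.lastCases ?_ (fun i => ?_) x <;> refine Fin.lastCases ?_ (fun j => ?_) y
    · intro _ h; exact absurd h (lt_irrefl _)
    · simp only [Fin.snoc_last, Fin.snoc_castSucc]
      intro h1 h2
      exact absurd (κ.up_left_mem (i1 := c.1) (j1 := c.2) h2.le h1.le (hmem j)) hc
    · intro _ _; exact Fin.castSucc_lt_last i
    · simp only [Fin.snoc_castSucc, Fin.castSucc_lt_castSucc_iff]
      exact hT.2.2 i (Finset.mem_univ _) j (Finset.mem_univ _)

open Classical in
-- A path becomes a tableau by entering each label in the cell added at its step. The inequality is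
-- enough, since permutations only have to embed into pairs of tableaux.
theorem numPaths_le_card_tabs (k : ℕ) : ∀ ν ∈ diagrams k, numPaths k ν ≤ (tabs k ν).card := by
  induction k with
  | zero =>
    intro ν hν
    rw [mem_diagrams] at hν
    have h0 : ν.cells = ∅ := Finset.card_eq_zero.1 hν
    have : (fun _ => (0, 0)) ∈ tabs 0 ν := by
      rw [mem_tabs]
      refine ⟨⟨fun x => x.elim0, fun x => x.elim0, fun d hd => ?_⟩, fun x => x.elim0,
        fun x => x.elim0⟩
      rw [h0] at hd
      simp at hd
    exact Finset.card_pos.2 ⟨_, this⟩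
  | succ k ih =>
    intro ν hν
    rw [mem_diagrams] at hν
    have hcell : ∀ κ : YoungDiagram, ∃ c, κ ∈ (diagrams k).filter (fun κ => κ ≤ ν) →
        c ∉ κ ∧ ν.cells = insert c κ.cells := by
      intro κ
      by_cases hκ : κ ∈ (diagrams k).filter fun κ => κ ≤ ν
      · have hκ' := hκ
        rw [Finset.mem_filter, mem_diagrams] at hκ'
        obtain ⟨c, h1, -, h2⟩ := exists_cell_of_cover hκ'.2 (by omega)
        exact ⟨c, fun _ => ⟨h1, h2⟩⟩
      · exact ⟨(0, 0), fun h => absurd h hκ⟩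
    choose c hc using hcell
    calc numPaths (k + 1) ν ≤ ∑ κ ∈ (diagrams k).filter fun κ => κ ≤ ν, (tabs k κ).card :=
          Finset.sum_le_sum fun κ hκ => ih κ (Finset.mem_filter.1 hκ).1
      _ = (((diagrams k).filter fun κ => κ ≤ ν).sigma fun κ => tabs k κ).card :=
          (Finset.card_sigma _ _).symm
      _ ≤ (tabs (k + 1) ν).card := by
          refine Finset.card_le_card_of_injOn
            (fun p => (Fin.snoc p.2 (c p.1) : Fin (k + 1) → ℕ × ℕ)) ?_ ?_
          · rintro ⟨κ, T⟩ hp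
            rw [Finset.mem_coe, Finset.mem_sigma] at hp
            rw [Finset.mem_coe, mem_tabs]
            exact isTabOn_snoc (mem_tabs.1 hp.2) (hc κ hp.1).1 (hc κ hp.1).2
          · rintro ⟨κ, T⟩ hp ⟨κ', T'⟩ hp' he
            rw [Finset.mem_coe, Finset.mem_sigma] at hp hp'
            have h1 : T = T' := by
              have := congrArg (fun f : Fin (k + 1) → ℕ × ℕ => Fin.init f) he
              simpa using this
            subst h1
            obtain rfl := (mem_tabs.1 hp.2).diagram_eq (mem_tabs.1 hp'.2)
            rfl

/-- The permutations embed into the pairs of standard tableaux of the same shape. -/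
theorem exists_pairs_of_tableaux (k : ℕ) :
    ∃ F : Equiv.Perm (Fin k) → (Fin k → ℕ × ℕ) × (Fin k → ℕ × ℕ), Function.Injective F ∧
      ∀ π, ∃ κ, IsTabOn Finset.univ κ (F π).1 ∧ IsTabOn Finset.univ κ (F π).2 := by
  classical
  set S := (diagrams k).biUnion fun κ => tabs k κ ×ˢ tabs k κ with hS
  -- A comparison of cardinalities takes the place of an insertion algorithm; only the existence of
  -- an injection is used later.
  have h1 : Fintype.card (Equiv.Perm (Fin k)) ≤ Fintype.card S := by
    rw [Fintype.card_perm, Fintype.card_fin, Fintype.card_coe, hS, Finset.card_biUnion,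
      ← sum_numPaths_sq]
    · refine Finset.sum_le_sum fun κ hκ => ?_
      rw [Finset.card_product, pow_two]
      exact Nat.mul_le_mul (numPaths_le_card_tabs k κ hκ) (numPaths_le_card_tabs k κ hκ)
    · intro κ _ κ' _ hne
      rw [Function.onFun, Finset.disjoint_left]
      rintro ⟨T, T'⟩ h2 h3
      rw [Finset.mem_product] at h2 h3
      exact hne ((mem_tabs.1 h2.1).diagram_eq (mem_tabs.1 h3.1))
  obtain ⟨F⟩ := Function.Embedding.nonempty_of_card_le h1
  refine ⟨fun π => (F π : (Fin k → ℕ × ℕ) × (Fin k → ℕ × ℕ)),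
    fun π π' he => F.injective (Subtype.ext he), fun π => ?_⟩
  obtain ⟨κ, -, h3⟩ := Finset.mem_biUnion.1 (F π).2
  rw [Finset.mem_product] at h3
  exact ⟨κ, mem_tabs.1 h3.1, mem_tabs.1 h3.2⟩

open Classical in
/-- The transport of a filling along an enumeration of the labels. -/
def spread {n k : ℕ} {X : Finset (Fin n)} (e : Fin k ≃o X) (T : Fin k → ℕ × ℕ) (x : Fin n) :
    ℕ × ℕ := if hx : x ∈ X then T (e.symm ⟨x, hx⟩) else (0, 0)

theorem spread_apply {n k : ℕ} {X : Finset (Fin n)} (e : Fin k ≃o X) (T : Fin k → ℕ × ℕ)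
    (i : Fin k) : spread e T (e i) = T i := by
  rw [spread, dif_pos (e i).2]
  simp

theorem isTabOn_spread {n k : ℕ} {X : Finset (Fin n)} (e : Fin k ≃o X) {T : Fin k → ℕ × ℕ}
    {κ : YoungDiagram} (hT : IsTabOn Finset.univ κ T) : IsTabOn X κ (spread e T) := by
  have hX : ∀ x ∈ X, ∃ i, (e i : Fin n) = x := fun x hx => ⟨e.symm ⟨x, hx⟩, by simp⟩
  have hu : ∀ i : Fin k, i ∈ (↑(Finset.univ : Finset (Fin k)) : Set (Fin k)) := fun i => by simp
  refine ⟨⟨?_, ?_, ?_⟩, ?_, ?_⟩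
  · intro x hx
    obtain ⟨i, rfl⟩ := hX x hx
    rw [spread_apply]
    exact hT.1.mapsTo (hu i)
  · intro x hx y hy he
    obtain ⟨i, rfl⟩ := hX x hx
    obtain ⟨j, rfl⟩ := hX y hy
    rw [spread_apply, spread_apply] at he
    rw [hT.1.injOn (hu i) (hu j) he]
  · intro d hd
    obtain ⟨i, -, rfl⟩ := hT.1.surjOn hd
    exact ⟨e i, (e i).2, spread_apply e T i⟩
  · intro x hx y hy
    obtain ⟨i, rfl⟩ := hX x hx
    obtain ⟨j, rfl⟩ := hX y hy
    rw [spread_apply, spread_apply]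
    intro h1 h2
    exact e.lt_iff_lt.2 (hT.2.1 i (Finset.mem_univ _) j (Finset.mem_univ _) h1 h2)
  · intro x hx y hy
    obtain ⟨i, rfl⟩ := hX x hx
    obtain ⟨j, rfl⟩ := hX y hy
    rw [spread_apply, spread_apply]
    intro h1 h2
    exact e.lt_iff_lt.2 (hT.2.2 i (Finset.mem_univ _) j (Finset.mem_univ _) h1 h2)

/-- A correspondence of Robinson-Schensted type for the bijections between two sets of labels. -/
theorem exists_correspondence {n : ℕ} (X Y : Finset (Fin n)) :
    ∃ F : Equiv.Perm (Fin n) → (Fin n → ℕ × ℕ) × (Fin n → ℕ × ℕ),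
      (∀ w : Equiv.Perm (Fin n), X.image w = Y →
        ∃ κ, IsTabOn X κ (F w).1 ∧ IsTabOn Y κ (F w).2) ∧
      ∀ w w' : Equiv.Perm (Fin n), X.image w = Y → X.image w' = Y →
        (∀ x ∈ X, (F w).1 x = (F w').1 x) → (∀ y ∈ Y, (F w).2 y = (F w').2 y) →
          ∀ x ∈ X, w x = w' x := by
  classical
  by_cases hc : Y.card = X.card
  · set eX := X.orderIsoOfFin rfl
    set eY := Y.orderIsoOfFin hc
    obtain ⟨ψ, hψ, hψ'⟩ := exists_pairs_of_tableaux X.card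
    -- The increasing enumerations of `X` and `Y` turn the restriction of `w` into a permutation,
    -- and they transport standard tableaux.
    have hπ : ∀ w : Equiv.Perm (Fin n), ∃ π : Equiv.Perm (Fin X.card), X.image w = Y →
        ∀ i, (eY (π i) : Fin n) = w (eX i) := by
      intro w
      by_cases hw : X.image w = Y
      · have hmem : ∀ i, w (eX i) ∈ Y := fun i => hw ▸ Finset.mem_image_of_mem _ (eX i).2
        have hinj : Function.Injective fun i => eY.symm ⟨w (eX i), hmem i⟩ := by
          intro i j hij
          have := congrArg Subtype.val (eY.symm.injective hij)
          exact eX.injective (Subtype.ext (w.injective this))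
        refine ⟨Equiv.ofBijective _ (Finite.injective_iff_bijective.1 hinj), fun _ i => ?_⟩
        simp
      · exact ⟨1, fun h => absurd h hw⟩
    choose π hπ using hπ
    refine ⟨fun w => (spread eX (ψ (π w)).1, spread eY (ψ (π w)).2), fun w _ => ?_, ?_⟩
    · obtain ⟨κ, h1, h2⟩ := hψ' (π w)
      exact ⟨κ, isTabOn_spread eX h1, isTabOn_spread eY h2⟩
    · intro w w' hw hw' h1 h2 x hx
      have h3 : π w = π w' := by
        apply hψ
        apply Prod.ext
        · funext i
          have := h1 (eX i) (eX i).2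
          simpa only [spread_apply] using this
        · funext i
          have := h2 (eY i) (eY i).2
          simpa only [spread_apply] using this
      obtain ⟨i, hi'⟩ := eX.surjective ⟨x, hx⟩
      have h4 : (eX i : Fin n) = x := congrArg Subtype.val hi'
      rw [← h4, ← hπ w hw, ← hπ w' hw', h3]
  · have hne : ∀ w : Equiv.Perm (Fin n), X.image w ≠ Y := fun w hw =>
      hc (by rw [← hw, Finset.card_image_of_injective _ w.injective])
    exact ⟨fun _ => (fun _ => (0, 0), fun _ => (0, 0)), fun w hw => absurd hw (hne w),
      fun w _ hw => absurd hw (hne w)⟩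

/-- The chosen correspondence. -/
def corr {n : ℕ} (X Y : Finset (Fin n)) (w : Equiv.Perm (Fin n)) :
    (Fin n → ℕ × ℕ) × (Fin n → ℕ × ℕ) := (exists_correspondence X Y).choose w

theorem corr_spec {n : ℕ} {X Y : Finset (Fin n)} {w : Equiv.Perm (Fin n)} (hw : X.image w = Y) :
    ∃ κ, IsTabOn X κ (corr X Y w).1 ∧ IsTabOn Y κ (corr X Y w).2 :=
  (exists_correspondence X Y).choose_spec.1 w hw

theorem corr_inj {n : ℕ} {X Y : Finset (Fin n)} {w w' : Equiv.Perm (Fin n)} (hw : X.image w = Y)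
    (hw' : X.image w' = Y) (h1 : ∀ x ∈ X, (corr X Y w).1 x = (corr X Y w').1 x)
    (h2 : ∀ y ∈ Y, (corr X Y w).2 y = (corr X Y w').2 y) : ∀ x ∈ X, w x = w' x :=
  (exists_correspondence X Y).choose_spec.2 w w' hw hw' h1 h2

end Correspondence

/-! ### Multitableaux assembled from the components -/

section Gluing

variable {k m : ℕ}

/-- The fibre of the map `c` over `i`. -/
def fib (c : Fin m → Fin k) (i : Fin k) : Finset (Fin m) := Finset.univ.filter fun x => c x = i

theorem mem_fib {c : Fin m → Fin k} {i : Fin k} {x : Fin m} : x ∈ fib c i ↔ c x = i := by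
  simp [fib]

theorem image_fib {c c' : Fin m → Fin k} {w : Equiv.Perm (Fin m)} {τ : Equiv.Perm (Fin k)}
    (hw : ∀ x, c' (w x) = τ (c x)) (i : Fin k) : (fib c i).image w = fib c' (τ i) := by
  ext y
  rw [Finset.mem_image, mem_fib]
  constructor
  · rintro ⟨x, hx, rfl⟩
    rw [hw, mem_fib.1 hx]
  · intro hy
    refine ⟨w.symm y, mem_fib.2 (τ.injective ?_), by simp⟩
    rw [← hw, Equiv.apply_symm_apply, hy]

theorem sum_card_fib (c : Fin m → Fin k) : ∑ i, (fib c i).card = m := by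
  have := Finset.card_eq_sum_card_fiberwise (f := c) (s := Finset.univ) (t := Finset.univ)
    (fun x _ => Finset.mem_coe.2 (Finset.mem_univ _))
  rw [Finset.card_univ, Fintype.card_fin] at this
  exact this.symm

theorem min_fib_injective {c : Fin m → Fin k} (hc : Function.Surjective c) :
    Function.Injective fun i => (fib c i).min := by
  intro i j hij
  obtain ⟨x, hx⟩ := hc i
  obtain ⟨a, ha⟩ := Finset.min_of_mem (mem_fib.2 hx)
  have ha' : (fib c j).min = a := by rw [← ha]; exact hij.symm
  rw [← mem_fib.1 (Finset.mem_of_min ha), ← mem_fib.1 (Finset.mem_of_min ha')]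

/-- The multitableaux `t` and `t'` correspond componentwise to the permutation `w`, which maps
the labels of the component `i` of `t` to those of the component `τ i` of `t'`. -/
def Glued {lam lam' : Fin k → YoungDiagram} (τ : Equiv.Perm (Fin k)) (t : Fin m ≃ Node lam)
    (t' : Fin m ≃ Node lam') (w : Equiv.Perm (Fin m)) : Prop :=
  ∀ i, (fib (fun x => (t x).comp) i).image w = fib (fun x => (t' x).comp) (τ i) ∧
    (∀ x ∈ fib (fun x => (t x).comp) i,
      (corr (fib (fun x => (t x).comp) i) (fib (fun x => (t' x).comp) (τ i)) w).1 x =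
        (t x).1.2) ∧
    ∀ y ∈ fib (fun x => (t' x).comp) (τ i),
      (corr (fib (fun x => (t x).comp) i) (fib (fun x => (t' x).comp) (τ i)) w).2 y =
        (t' y).1.2

/-- On each component the permutation is recovered from the two tableaux by the injectivity of
`corr`. -/
theorem Glued.unique {lam lam' : Fin k → YoungDiagram} {τ : Equiv.Perm (Fin k)}
    {t : Fin m ≃ Node lam} {t' : Fin m ≃ Node lam'} {w w' : Equiv.Perm (Fin m)}
    (h : Glued τ t t' w) (h' : Glued τ t t' w') : w = w' := by
  refine Equiv.ext fun x => ?_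
  exact corr_inj (h (t x).comp).1 (h' (t x).comp).1
    (fun x hx => ((h _).2.1 x hx).trans ((h' _).2.1 x hx).symm)
    (fun x hx => ((h _).2.2 x hx).trans ((h' _).2.2 x hx).symm) x (mem_fib.2 rfl)

theorem exists_multitableau {lam : Fin k → YoungDiagram} (c : Fin m → Fin k) (p : Fin m → ℕ × ℕ)
    (h : ∀ i, IsTabOn (fib c i) (lam i) p) :
    ∃ t : Fin m ≃ Node lam, (∀ x, (t x).comp = c x) ∧ (∀ x, (t x).1.2 = p x) ∧ IsStd t := by
  have hm : ∀ x, p x ∈ lam (c x) := fun x => (h (c x)).1.mapsTo (mem_fib.2 rfl)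
  have hbij : Function.Bijective fun x => (⟨(c x, p x), hm x⟩ : Node lam) := by
    constructor
    · intro x y hxy
      have h1 := congrArg (fun z : Node lam => z.1) hxy
      simp only [Prod.mk.injEq] at h1
      exact (h (c x)).1.injOn (mem_fib.2 rfl) (mem_fib.2 h1.1.symm) h1.2
    · rintro ⟨⟨i, d⟩, hd⟩
      obtain ⟨x, hx, rfl⟩ := (h i).1.surjOn hd
      obtain rfl := mem_fib.1 hx
      exact ⟨x, rfl⟩
  refine ⟨Equiv.ofBijective _ hbij, fun x => rfl, fun x => rfl, fun x y h1 h2 h3 => ?_,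
    fun x y h1 h2 h3 => ?_⟩
  · exact (h (c x)).2.1 x (mem_fib.2 rfl) y (mem_fib.2 h1.symm) h2 h3
  · exact (h (c x)).2.2 x (mem_fib.2 rfl) y (mem_fib.2 h1.symm) h2 h3

/-- The correspondence is applied to each pair of fibres matched by τ, and the fillings so obtained
are put together to two multitableaux. -/
theorem exists_glued {lam : Fin k → YoungDiagram} {c c' : Fin m → Fin k}
    {w : Equiv.Perm (Fin m)} {τ : Equiv.Perm (Fin k)} (hw : ∀ x, c' (w x) = τ (c x))
    (h : ∀ i, IsTabOn (fib c i) (lam i) (corr (fib c i) (fib c' (τ i)) w).1)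
    (h' : ∀ i, IsTabOn (fib c' (τ i)) (lam (τ i)) (corr (fib c i) (fib c' (τ i)) w).2) :
    ∃ t t' : Fin m ≃ Node lam, (∀ x, (t x).comp = c x) ∧ (∀ x, (t' x).comp = c' x) ∧
      IsStd t ∧ IsStd t' ∧ Glued τ t t' w := by
  obtain ⟨t, h1, h2, h3⟩ := exists_multitableau (lam := lam) c
    (fun x => (corr (fib c (c x)) (fib c' (τ (c x))) w).1 x) fun i => (h i).congr fun x hx => by
      rw [mem_fib.1 hx]
  obtain ⟨t', h1', h2', h3'⟩ := exists_multitableau (lam := lam) c'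
    (fun y => (corr (fib c (τ.symm (c' y))) (fib c' (c' y)) w).2 y) fun i => by
      have := h' (τ.symm i)
      rw [Equiv.apply_symm_apply] at this
      exact this.congr fun x hx => by rw [mem_fib.1 hx]
  refine ⟨t, t', h1, h1', h3, h3', ?_⟩
  obtain rfl : (fun x => (t x).comp) = c := funext h1
  obtain rfl : (fun x => (t' x).comp) = c' := funext h1'
  refine fun i => ⟨image_fib hw i, fun x hx => ?_, fun y hy => ?_⟩
  · have hx' : (t x).comp = i := mem_fib.1 hx
    rw [h2]
    simp only [hx']
  · rw [h2']
    have hy' : (t' y).comp = τ i := mem_fib.1 hy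
    simp only [hy', Equiv.symm_apply_apply]

end Gluing

/-! ### Encoding a set partition and a permutation by an index of the dual basis -/

section IndexInjection

variable {le : YoungDiagram → YoungDiagram → Prop} {n r : ℕ} {α : n.Partition}

theorem exists_strictMono_factorization {X : Type*} [LinearOrder X] {F : Fin r → X}
    (hF : Monotone F) : ∃ (s : ℕ) (γ : Fin r → Fin s) (v : Fin s → X), StrictMono v ∧
      Monotone γ ∧ Function.Surjective γ ∧ ∀ i, F i = v (γ i) := by
  set e := (Finset.univ.image F).orderIsoOfFin rfl
  have hm : ∀ i, F i ∈ Finset.univ.image F := fun i => Finset.mem_image_of_mem _ (Finset.mem_univ i)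
  refine ⟨_, fun i => e.symm ⟨F i, hm i⟩, fun j => e j, fun i j hij => e.strictMono hij,
    fun i j hij => e.symm.monotone (hF hij), fun j => ?_, fun i => by simp⟩
  obtain ⟨i, -, hi'⟩ := Finset.mem_image.1 (e j).2
  refine ⟨i, e.injective (Subtype.ext ?_)⟩
  simp [hi']

theorem exists_sort {X : Type*} [LinearOrder X] {F : Fin r → X} (hF : Function.Injective F) :
    ∃ σ : Equiv.Perm (Fin r), StrictMono fun i => F (σ i) :=
  ⟨Tuple.sort F, (Tuple.monotone_sort F).strictMono_of_injective (hF.comp (Tuple.sort F).injective)⟩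

theorem exists_labelling (hα : Multiset.card α.parts = r) {A : SetPart n} (hA : HasType A α) :
    ∃ b : Fin n → Fin r, Function.Surjective b ∧ ∀ x y, A.part x = A.part y ↔ b x = b y := by
  have hc : A.parts.card = r := by
    rw [← hα, ← hA, Multiset.card_map]; rfl
  set e := A.parts.equivFinOfCardEq hc
  refine ⟨fun x => e ⟨A.part x, A.part_mem.2 (Finset.mem_univ x)⟩, fun i => ?_, fun x y => by simp⟩
  obtain ⟨x, hx⟩ := A.nonempty_of_mem_parts (e.symm i).2
  refine ⟨x, ?_⟩
  rw [← e.eq_symm_apply]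
  exact Subtype.ext (A.part_eq_of_mem (e.symm i).2 hx)

theorem hasType_blockPart {lam : Fin r → YoungDiagram} (h : ∑ i, (lam i).card = n)
    {A : SetPart n} (hA : HasType A α) (t : Fin n ≃ Node lam)
    (ht : ∀ x y, A.part x = A.part y ↔ (t x).comp = (t y).comp) : HasType (blockPart h) α := by
  have : blockPart h = permPart A (dPerm h t).symm := by
    refine setPart_ext fun x y => ?_
    rw [permPart_part_eq_iff, ht, blockPart, ofSetoid_part_eq_iff]
    simp [dPerm]
  rw [this, hasType_permPart]
  exact hA

/-- The index `x` and the pair of the set partition `A` and the permutation `w` correspond to each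
other. -/
def Linked (x : Σ Λ : Shape le r α, StdTab Λ × StdTab Λ) (A : SetPart n)
    (w : Equiv.Perm (Fin n)) : Prop :=
  (∀ y z, A.part y = A.part z ↔ (x.2.1.t y).comp = (x.2.1.t z).comp) ∧
    ∃ τ : Equiv.Perm (Fin r), Glued 1 x.2.1.u x.2.2.u τ ∧ Glued τ x.2.1.t x.2.2.t w

theorem Linked.unique {x : Σ Λ : Shape le r α, StdTab Λ × StdTab Λ} {A A' : SetPart n}
    {w w' : Equiv.Perm (Fin n)} (h : Linked x A w) (h' : Linked x A' w') : A = A' ∧ w = w' := by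
  obtain ⟨h1, τ, h2, h3⟩ := h
  obtain ⟨h1', τ', h2', h3'⟩ := h'
  obtain rfl := h2.unique h2'
  exact ⟨setPart_ext fun y z => (h1 y z).trans (h1' y z).symm, h3.unique h3'⟩

/-- The permutation maps each block of `A` to a block of the transported partition, and the
correspondence turns this map into two tableaux of a common shape. Sorting the blocks on both sides
gives λ and two multitableaux; the mismatch τ of the two sortings permutes equal components. A
second application of the correspondence, to τ on each class of equal components, gives μ and its
tableaux. -/
theorem exists_linked (hle : ExtendsDominance le) (hα : Multiset.card α.parts = r) {A : SetPart n}
    (hA : HasType A α) (w : Equiv.Perm (Fin n)) :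
    ∃ x : (Σ Λ : Shape le r α, StdTab Λ × StdTab Λ), Linked x A w := by
  classical
  obtain ⟨b, hb, hAb⟩ := exists_labelling hα hA
  have hb' : Function.Surjective fun y => b (w.symm y) := hb.comp w.symm.surjective
  have himage : ∀ i, (fib b i).image w = fib (fun y => b (w.symm y)) i := fun i =>
    image_fib (τ := 1) (fun x => by simp) i
  choose κ hκ hκ' using fun i => corr_spec (himage i)
  -- Sorting first by shape and then by least label makes λ weakly increasing and orders equal
  -- components by their least labels, as `StdTab` requires.
  obtain ⟨σ, hσ⟩ := exists_sort (F := fun i => toLex (toOrd hle (κ i), (fib b i).min))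
    fun i j hij => min_fib_injective hb (congrArg (fun z => (ofLex z).2) hij)
  obtain ⟨σ', hσ'⟩ := exists_sort
    (F := fun i => toLex (toOrd hle (κ i), (fib (fun y => b (w.symm y)) i).min))
    fun i j hij => min_fib_injective hb' (congrArg (fun z => (ofLex z).2) hij)
  have hmono : Monotone fun i => toOrd hle (κ (σ i)) := fun i j hij =>
    Prod.Lex.monotone_fst _ _ (hσ.monotone hij)
  have hmono' : Monotone fun i => toOrd hle (κ (σ' i)) := fun i j hij =>
    Prod.Lex.monotone_fst _ _ (hσ'.monotone hij)
  -- Two weakly increasing arrangements of the same family of diagrams coincide.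
  have hκσ : ∀ i, κ (σ i) = κ (σ' i) := by
    intro i
    apply toOrd_injective hle
    apply le_antisymm
    · exact le_of_le_perm hmono hmono' (τ := σ.trans σ'.symm) (fun i => by simp) i
    · exact le_of_le_perm hmono' hmono (τ := σ'.trans σ.symm) (fun i => by simp) i
  set lam : Fin r → YoungDiagram := fun i => κ (σ i) with hlam
  set τ : Equiv.Perm (Fin r) := σ.trans σ'.symm with hτ
  have hlamτ : ∀ i, lam (τ i) = lam i := by
    intro i
    simp only [hlam, hτ]
    rw [hκσ]
    simp
  have hfib : ∀ i, fib (fun x => σ.symm (b x)) i = fib b (σ i) := by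
    intro i; ext x; simp [mem_fib, Equiv.symm_apply_eq]
  have hfib' : ∀ i, fib (fun x => σ'.symm (b (w.symm x))) i =
      fib (fun y => b (w.symm y)) (σ' i) := by
    intro i; ext x; simp [mem_fib, Equiv.symm_apply_eq]
  have hστ : ∀ i, σ' (τ i) = σ i := by intro i; simp [hτ]
  obtain ⟨t, t', hc, hc', hs, hs', hg⟩ := exists_glued (lam := lam) (c := fun x => σ.symm (b x))
    (c' := fun x => σ'.symm (b (w.symm x))) (w := w) (τ := τ) (fun x => by simp [hτ])
    (fun i => by rw [hfib, hfib', hστ]; exact hκ (σ i))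
    (fun i => by rw [hfib, hfib', hστ, hlamτ]; exact hκ' (σ i))
  have hsize : ∑ i, (lam i).card = n := by
    rw [← sum_card_fib (fun x => σ.symm (b x))]
    exact Finset.sum_congr rfl fun i _ => by rw [hfib]; exact (hκ (σ i)).card_eq.symm
  have hmin : ∀ i, minLabel t i = (fib b (σ i)).min := by
    intro i; rw [← hfib]; simp only [minLabel, fib, hc]
  have hmin' : ∀ i, minLabel t' i = (fib (fun y => b (w.symm y)) (σ' i)).min := by
    intro i; rw [← hfib']; simp only [minLabel, fib, hc']
  have hAt : ∀ y z, A.part y = A.part z ↔ (t y).comp = (t z).comp := by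
    intro y z; rw [hAb, hc, hc]; simp
  obtain ⟨s, γ, v, hv, hγ, hγs, hvγ⟩ := exists_strictMono_factorization hmono
  have hγlam : ∀ i j, lam i = lam j ↔ γ i = γ j := by
    intro i j
    rw [← hv.injective.eq_iff, ← hvγ, ← hvγ]
    exact (toOrd_injective hle).eq_iff.symm
  have hγτ : ∀ i, γ (τ i) = γ i := fun i => (hγlam _ _).1 (hlamτ i)
  -- The classes of equal components are the fibres of `γ`, and τ preserves each of them.
  have himageτ : ∀ j, (fib γ j).image τ = fib γ ((1 : Equiv.Perm (Fin s)) j) :=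
    fun j => image_fib (fun x => hγτ x) j
  choose mu hmu hmu' using fun j => corr_spec (himageτ j)
  obtain ⟨u, u', hd, hd', hus, hus', hug⟩ := exists_glued (lam := mu) (c := γ) (c' := γ) (w := τ)
    (τ := 1) hγτ hmu hmu'
  have hmusize : ∑ j, (mu j).card = r := by
    rw [← sum_card_fib γ]
    exact Finset.sum_congr rfl fun i _ => (hmu i).card_eq.symm
  have hinit : ∀ i, γ i = (initTab hmusize i).comp := by
    refine fun i => congrFun (eq_of_monotone_of_card_fiber (G := fun i => (initTab hmusize i).comp)
      hγ ?_ fun j => ?_) i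
    · exact fun i j hij => comp_mono hmusize hij
    · rw [card_comp]
      exact (hmu j).card_eq
  have hval : ∀ j, ∃ ν, v j = toOrd hle ν := fun j => by
    obtain ⟨i, rfl⟩ := hγs j
    exact ⟨lam i, (hvγ i).symm⟩
  choose val hval using hval
  have hlamval : ∀ i, lam i = val (γ i) := fun i =>
    toOrd_injective hle ((hvγ i).trans (hval _))
  let Λ : Shape le r α :=
    { lam := lam
      lam_size := hsize
      lam_type := hasType_blockPart hsize hA t hAt
      lam_incr := fun i j hij => toOrd_le.1 (hmono hij)
      s := s
      mu := mu
      mu_size := hmusize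
      mu_mult := by
        refine ⟨val, fun i j hij => ⟨?_, ?_⟩, ?_, fun j => ?_⟩
        · rw [← toOrd_le (hle := hle), ← hval, ← hval]
          exact hv.monotone hij.le
        · intro h
          have := hv hij
          rw [hval, hval, h] at this
          exact lt_irrefl _ this
        · rw [show lam = val ∘ γ from funext hlamval, hγs.range_comp]
        · rw [← (hmu j).card_eq, Nat.card_eq_fintype_card, Fintype.card_subtype]
          congr 1
          ext i
          obtain ⟨i', rfl⟩ := hγs j
          rw [mem_fib, Finset.mem_filter, ← hlamval, hγlam]
          simp }
  have hincr : ∀ i j, lam i = lam j → (i < j ↔ minLabel t i < minLabel t j) := by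
    intro i j hij
    rw [hmin, hmin, ← hσ.lt_iff_lt, Prod.Lex.toLex_lt_toLex]
    simp only [hlam] at hij
    simp [hij]
  have hincr' : ∀ i j, lam i = lam j → (i < j ↔ minLabel t' i < minLabel t' j) := by
    intro i j hij
    rw [hmin', hmin', ← hσ'.lt_iff_lt, Prod.Lex.toLex_lt_toLex]
    simp only [hlam, hκσ] at hij
    simp [hij]
  exact ⟨⟨Λ, ⟨t, hs, hincr, u, hus, fun i => (hd i).trans (hinit i)⟩,
    ⟨t', hs', hincr', u', hus', fun i => (hd' i).trans (hinit i)⟩⟩, hAt, τ, hug, hg⟩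

/-- The elements `𝔼_A g_w` with `A` of type `α` inject into the index set of the dual basis. -/
theorem exists_injection_index (hle : ExtendsDominance le) (hα : Multiset.card α.parts = r) :
    ∃ f : {A : SetPart n // HasType A α} × Equiv.Perm (Fin n) →
      Σ Λ : Shape le r α, StdTab Λ × StdTab Λ, Function.Injective f := by
  choose f hf using fun p : {A : SetPart n // HasType A α} × Equiv.Perm (Fin n) =>
    exists_linked hle hα p.1.2 p.2
  refine ⟨f, fun p p' h => ?_⟩
  obtain ⟨h1, h2⟩ := (hf p).unique (h ▸ hf p')
  exact Prod.ext (Subtype.ext h1) h2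

end IndexInjection

/-! ### Linear algebra of triangular families -/

section Triangular

variable {R M I J K : Type*} [CommRing R] [AddCommGroup M] [Module R M] [LinearOrder K]

/-- If a linear combination is killed by a triangular family of functionals, then its coefficients
vanish. -/
theorem eq_zero_of_triangular {v : I → M} {φ : I → M →ₗ[R] R} {key : I → K} {S : Set I}
    (hkey : Function.Injective key) (h1 : ∀ i ∈ S, φ i (v i) = 1)
    (h2 : ∀ i, ∀ i' ∈ S, φ i' (v i) ≠ 0 → key i ≤ key i') {c : I →₀ R}
    (hc : ∀ i ∈ S, φ i (Finsupp.linearCombination R v c) = 0) (hS : ↑c.support ⊆ S) : c = 0 := by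
  by_contra hne
  -- At an index of least key in the support, the functional sees no other term, so it returns the
  -- coefficient itself.
  obtain ⟨i, hi', hmin⟩ := c.support.exists_min_image key (Finsupp.support_nonempty_iff.2 hne)
  have h := hc i (hS hi')
  rw [Finsupp.linearCombination_apply, Finsupp.sum, map_sum, Finset.sum_eq_single i] at h
  · rw [map_smul, h1 i (hS hi'), smul_eq_mul, mul_one] at h
    exact Finsupp.mem_support_iff.1 hi' h
  · intro j hj hji
    rw [map_smul]
    by_cases h0 : φ i (v j) = 0
    · rw [h0, smul_zero]
    · exact absurd (hkey (le_antisymm (h2 j i (hS hi') h0) (hmin j hj))) hji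
  · exact fun h' => absurd hi' h'

theorem linearIndependent_of_triangular {v : I → M} {φ : I → M →ₗ[R] R} {key : I → K}
    (hkey : Function.Injective key) (h1 : ∀ i, φ i (v i) = 1)
    (h2 : ∀ i i', φ i' (v i) ≠ 0 → key i ≤ key i') : LinearIndependent R v := by
  rw [linearIndependent_iff]
  intro c hc
  exact eq_zero_of_triangular (S := Set.univ) hkey (fun i _ => h1 i) (fun i i' _ => h2 i i')
    (fun i _ => by rw [hc, map_zero]) (Set.subset_univ _)

/-- A triangular family that is at least as large as a finite spanning family spans. -/
theorem span_le_of_triangular [Nontrivial R] [Finite J] {v : I → M} {φ : I → M →ₗ[R] R}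
    {key : I → K} (hkey : Function.Injective key) (h1 : ∀ i, φ i (v i) = 1)
    (h2 : ∀ i i', φ i' (v i) ≠ 0 → key i ≤ key i') {m : J → M}
    (hv : ∀ i, v i ∈ Submodule.span R (Set.range m)) {f : J → I} (hf : Function.Injective f) :
    Submodule.span R (Set.range m) ≤ Submodule.span R (Set.range v) := by
  classical
  have := Fintype.ofFinite J
  -- Linearly independent vectors in the span of a finite set are finite in number over a nontrivial
  -- commutative ring.
  have hI : Finite I := (linearIndependent_of_triangular hkey h1 h2).finite_of_le_span_finite v
    (Set.range m) (by rintro _ ⟨i, rfl⟩; exact hv i)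
  have := Fintype.ofFinite I
  set Φ : M →ₗ[R] I → R := LinearMap.pi φ with hΦ
  -- The functionals map the span of `v` onto all coordinate vectors: unitriangular elimination,
  -- starting from the largest key.
  have hsingle : ∀ i, Pi.single i (1 : R) ∈ (Submodule.span R (Set.range v)).map Φ := by
    have hwf : WellFounded fun i j : I => key j < key i :=
      have : IsTrans I fun i j => key j < key i := ⟨fun _ _ _ h h' => h'.trans h⟩
      have : Std.Irrefl fun i j : I => key j < key i := ⟨fun i => lt_irrefl (key i)⟩
      Finite.wellFounded_of_trans_of_irrefl _
    intro i
    induction i using hwf.induction with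
    | _ i ih =>
      have h3 : Φ (v i) = Pi.single i 1 + ∑ j with key i < key j, φ j (v i) • Pi.single j (1 : R) := by
        funext j
        simp only [hΦ, LinearMap.pi_apply, Pi.add_apply, Finset.sum_apply, Pi.smul_apply,
          Pi.single_apply, smul_eq_mul, mul_ite, mul_one, mul_zero, Finset.sum_ite_eq,
          Finset.mem_filter, Finset.mem_univ, true_and]
        by_cases hj : j = i
        · subst hj; simp [h1]
        · rw [if_neg hj, zero_add]
          split_ifs with hlt
          · rfl
          · by_contra h0
            exact hlt (lt_of_le_of_ne (h2 i j h0) fun h => hj (hkey h.symm))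
      rw [eq_sub_of_add_eq h3.symm]
      refine sub_mem (Submodule.mem_map_of_mem (Submodule.subset_span ⟨i, rfl⟩)) ?_
      exact sum_mem fun j hj => Submodule.smul_mem _ _ (ih j (Finset.mem_filter.1 hj).2)
  have hΦv : ∀ y : I → R, ∃ x ∈ Submodule.span R (Set.range v), Φ x = y := by
    intro y
    rw [← Submodule.mem_map, pi_eq_sum_univ' y]
    exact sum_mem fun i _ => by
      have := Submodule.smul_mem _ (y i) (hsingle i)
      convert this using 2
  set T : (J → R) →ₗ[R] M := Fintype.linearCombination R m with hT
  have hTm : LinearMap.range T = Submodule.span R (Set.range m) := Fintype.range_linearCombination R m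
  have hvm : Submodule.span R (Set.range v) ≤ LinearMap.range T := by
    rw [hTm, Submodule.span_le]
    rintro _ ⟨i, rfl⟩
    exact hv i
  -- Since `f` is injective, restriction along `f` maps the functions on `I` onto those on `J`. The
  -- composite is a surjective endomorphism of a finite free module, hence injective, and so the
  -- functionals separate the elements of the span of `m`.
  have hsurj : Function.Surjective (Φ ∘ₗ T ∘ₗ LinearMap.funLeft R R f) := by
    intro y
    obtain ⟨x, hx, rfl⟩ := hΦv y
    obtain ⟨z, rfl⟩ := hvm hx
    obtain ⟨z', rfl⟩ := LinearMap.funLeft_surjective_of_injective R R f hf z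
    exact ⟨z', rfl⟩
  have hinj := OrzechProperty.injective_of_surjective_endomorphism _ hsurj
  intro x hx
  obtain ⟨y, hy, hyx⟩ := hΦv (Φ x)
  obtain ⟨z, rfl⟩ := hvm hy
  rw [← hTm] at hx
  obtain ⟨z', rfl⟩ := hx
  obtain ⟨z, rfl⟩ := LinearMap.funLeft_surjective_of_injective R R f hf z
  obtain ⟨z', rfl⟩ := LinearMap.funLeft_surjective_of_injective R R f hf z'
  rw [← hinj hyx]
  exact hy

end Triangular

/-! ### The dual cellular basis and the annihilator ideal -/

section DualBasisTheorem

variable {R : Type*} [CommRing R] (q : Rˣ) {le : YoungDiagram → YoungDiagram → Prop} {n r : ℕ}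
  {α : n.Partition}

theorem nElt_mem_btType {Λ : Shape le r α} (a b : StdTab Λ) : nElt q Λ a b ∈ btType q α := by
  simp only [nElt, mul_assoc]
  rw [← mul_assoc]
  refine idem_mul_gPerm_mem_btType q Λ.lam_type _ _ ?_
  rw [st_gPerm]
  exact idemType_mul_gPerm q α _

theorem rowLen_lam_le (Λ : Shape le r α) (i : Fin r) : (Λ.lam i).rowLen 0 ≤ n :=
  rowLen_le_of_sum Λ.lam_size i

/-- The pairings are taken on the tensor space with `n` values, which is large enough for every
shape, independently of the `N` of the annihilator. -/
theorem linearIndependent_nElt (hle : ExtendsDominance le) (hα : Multiset.card α.parts = r) :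
    LinearIndependent R fun x : (Σ Λ : Shape le r α, StdTab Λ × StdTab Λ) =>
      nElt q x.1 x.2.1 x.2.2 :=
  linearIndependent_of_triangular (fullKey_injective hle)
    (φ := fun x => pairing q (rowLen_lam_le x.1) x.2.1 x.2.2)
    (fun x => pairing_nElt_self q hle hα _ x.2.1 x.2.2)
    fun _ _ => fullKey_le_of_pairing_ne_zero q hle hα _ _ _ _ _

/-- The dual cellular basis elements span the ideal `𝓔_n^α(q)`. -/
theorem btType_le_span_nElt [Nontrivial R] (hle : ExtendsDominance le)
    (hα : Multiset.card α.parts = r) :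
    btType q α ≤ Submodule.span R
      (Set.range fun x : (Σ Λ : Shape le r α, StdTab Λ × StdTab Λ) => nElt q x.1 x.2.1 x.2.2) := by
  obtain ⟨f, hf⟩ := exists_injection_index (n := n) (α := α) hle hα
  refine le_trans (fun x hx => mem_span_of_mem_btType q hx) ?_
  refine span_le_of_triangular
    (v := fun x : (Σ Λ : Shape le r α, StdTab Λ × StdTab Λ) => nElt q x.1 x.2.1 x.2.2)
    (φ := fun x => pairing q (rowLen_lam_le x.1) x.2.1 x.2.2) (fullKey_injective hle)
    (fun x => ?_) (fun x x' => ?_) (fun x => ?_) hf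
  · exact pairing_nElt_self q hle hα _ x.2.1 x.2.2
  · exact fullKey_le_of_pairing_ne_zero q hle hα _ _ _ _ _
  · exact mem_span_of_mem_btType q (nElt_mem_btType q x.2.1 x.2.2)

theorem pairing_eq_zero_of_rho {N : ℕ} {Λ : Shape le r α} (hN : ∀ i, (Λ.lam i).rowLen 0 ≤ N)
    (a b : StdTab Λ) {x : BT q n} (hx : rho q N r x = 0) : pairing q hN a b x = 0 := by
  rw [pairing_apply, hx]
  simp

theorem nElt_mem_annIdeal {N : ℕ} {Λ : Shape le r α} (hΛ : Λ.Wide N) (a b : StdTab Λ) :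
    nElt q Λ a b ∈ annIdeal q N r α :=
  (mem_annIdeal_iff q N r).2 ⟨nElt_mem_btType q a b, rho_nElt_of_wide q hΛ a b⟩

/-- The elements of the annihilator ideal only involve basis elements with a wide shape. -/
theorem annIdeal_le_span [Nontrivial R] (hle : ExtendsDominance le)
    (hα : Multiset.card α.parts = r) (N : ℕ) :
    annIdeal q N r α ≤ Submodule.span R
      (Set.range fun x : WideIndex le N r α => nElt q x.1.1 x.2.1 x.2.2) := by
  classical
  intro x hx
  rw [mem_annIdeal_iff] at hx
  obtain ⟨hx1, hx2⟩ := hx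
  have hx3 := btType_le_span_nElt q hle hα hx1
  rw [Finsupp.mem_span_range_iff_exists_finsupp] at hx3
  obtain ⟨c, rfl⟩ := hx3
  set v := fun x : (Σ Λ : Shape le r α, StdTab Λ × StdTab Λ) => nElt q x.1 x.2.1 x.2.2 with hv
  have hwide : ∀ i, i.1.Wide N → v i ∈ Submodule.span R
      (Set.range fun x : WideIndex le N r α => nElt q x.1.1 x.2.1 x.2.2) :=
    fun i hi' => Submodule.subset_span ⟨⟨⟨i.1, hi'⟩, i.2⟩, rfl⟩
  set W : Set (Σ Λ : Shape le r α, StdTab Λ × StdTab Λ) := {i | i.1.Wide N} with hW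
  have hsplit : Finsupp.linearCombination R v c =
      Finsupp.linearCombination R v (c.filter fun i => i ∈ W) +
        Finsupp.linearCombination R v (c.filter fun i => i ∉ W) := by
    rw [← map_add, Finsupp.filter_add_filter_not]
  have hmem : Finsupp.linearCombination R v (c.filter fun i => i ∈ W) ∈ Submodule.span R
      (Set.range fun x : WideIndex le N r α => nElt q x.1.1 x.2.1 x.2.2) := by
    rw [Finsupp.linearCombination_apply]
    refine Submodule.sum_mem _ fun i hi' => Submodule.smul_mem _ _ (hwide i ?_)
    rw [Finsupp.support_filter, Finset.mem_filter] at hi'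
    exact hi'.2
  have hrho : rho q N r (Finsupp.linearCombination R v (c.filter fun i => i ∈ W)) = 0 := by
    rw [Finsupp.linearCombination_apply, Finsupp.sum, map_sum]
    refine Finset.sum_eq_zero fun i hi' => ?_
    rw [Finsupp.support_filter, Finset.mem_filter] at hi'
    rw [map_smul, rho_nElt_of_wide q hi'.2, smul_zero]
  have hrho' : rho q N r (Finsupp.linearCombination R v (c.filter fun i => i ∉ W)) = 0 := by
    have : rho q N r (Finsupp.linearCombination R v c) = 0 := hx2
    rwa [hsplit, map_add, hrho, zero_add] at this
  have hN : ∀ i ∉ W, ∀ k, (i.1.lam k).rowLen 0 ≤ N := fun i hi' k => by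
    by_contra h
    exact hi' ⟨k, not_le.1 h⟩
  -- For non-wide shapes the pairings can be formed on the given tensor space, so they vanish on an
  -- element that acts by zero. The value 0 chosen for wide indices is never used.
  have hzero : (c.filter fun i => i ∉ W) = 0 := by
    refine eq_zero_of_triangular (S := Wᶜ) (v := v) (fullKey_injective hle)
      (φ := fun i => if h : i ∉ W then pairing q (hN i h) i.2.1 i.2.2 else 0)
      (fun i hi' => ?_) (fun i i' hi' h => ?_) (fun i hi' => ?_) (fun i hi' => ?_)
    · have hW' : i ∉ W := hi'
      rw [dif_pos hW']
      exact pairing_nElt_self q hle hα _ i.2.1 i.2.2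
    · have hW' : i' ∉ W := hi'
      rw [dif_pos hW'] at h
      exact fullKey_le_of_pairing_ne_zero q hle hα _ _ _ _ _ h
    · have hW' : i ∉ W := hi'
      rw [dif_pos hW']
      exact pairing_eq_zero_of_rho q _ _ _ hrho'
    · rw [Finset.mem_coe, Finsupp.support_filter, Finset.mem_filter] at hi'
      exact hi'.2
  change Finsupp.linearCombination R v c ∈ _
  rw [hsplit, hzero, map_zero, add_zero]
  exact hmem

/-- The dual cellular basis elements with a wide shape form a basis of the annihilator ideal. -/
theorem exists_basis_annIdeal [Nontrivial R] (hle : ExtendsDominance le)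
    (hα : Multiset.card α.parts = r) (N : ℕ) :
    ∃ b : Module.Basis (WideIndex le N r α) R (annIdeal q N r α),
      ∀ x, (b x : BT q n) = nElt q x.1.1 x.2.1 x.2.2 := by
  set v : WideIndex le N r α → annIdeal q N r α :=
    fun x => ⟨nElt q x.1.1 x.2.1 x.2.2, nElt_mem_annIdeal q x.1.2 x.2.1 x.2.2⟩ with hv
  have hli : LinearIndependent R v := by
    refine LinearIndependent.of_comp (annIdeal q N r α).subtype ?_
    refine (linearIndependent_nElt q hle hα).comp
      (fun x : WideIndex le N r α => ⟨x.1.1, x.2⟩) ?_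
    rintro ⟨⟨Λ, hΛ⟩, a⟩ ⟨⟨Λ', hΛ'⟩, a'⟩ h
    simp only [Sigma.mk.injEq] at h
    obtain ⟨rfl, h⟩ := h
    obtain rfl := eq_of_heq h
    rfl
  have hspan : ⊤ ≤ Submodule.span R (Set.range v) := by
    intro x _
    have h := annIdeal_le_span q hle hα N x.2
    have hr : (Set.range fun x : WideIndex le N r α => nElt q x.1.1 x.2.1 x.2.2) =
        (annIdeal q N r α).subtype '' Set.range v := by
      rw [← Set.range_comp]; rfl
    rw [hr, ← Submodule.map_span] at h
    obtain ⟨y, hy, hyx⟩ := h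
    rwa [← Subtype.ext hyx]
  exact ⟨Module.Basis.mk hli hspan, fun x => by rw [Module.Basis.mk_apply]⟩

end DualBasisTheorem

end BraidsTies

end

theorem theorem5p3 (le : YoungDiagram → YoungDiagram → Prop)
    (hle : BraidsTies.ExtendsDominance le) (n N r : ℕ) (hn : 0 < n) (hN : 0 < N)
    (α : n.Partition) (hα : Multiset.card α.parts = r) :
    (∃ b : Module.Basis (BraidsTies.WideIndex le N r α) (LaurentPolynomial ℤ)
        (BraidsTies.annIdeal BraidsTies.laurentQ N r α),
      ∀ x, (b x : BraidsTies.BT BraidsTies.laurentQ n) =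
        BraidsTies.nElt BraidsTies.laurentQ x.1.1 x.2.1 x.2.2) ∧
    ∀ (K : Type*) [Field K] (q : Kˣ),
      ∃ b : Module.Basis (BraidsTies.WideIndex le N r α) K (BraidsTies.annIdeal q N r α),
        ∀ x, (b x : BraidsTies.BT q n) = BraidsTies.nElt q x.1.1 x.2.1 x.2.2 := by
  refine ⟨?_, fun K _ q => ?_⟩
  · exact BraidsTies.exists_basis_annIdeal BraidsTies.laurentQ hle hα N
  · exact BraidsTies.exists_basis_annIdeal q hle hα N
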